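/- **Conventions.** Repeated indices are summed; capital indices run over $\{1,2\}$, the indices $i,j,k,l,m,n$ over $\{0,1,2,3\}$; $\tau$ is the flip; all algebras are unital over $\mathbb C$; tensor products of matrices are $(v\otimes w)^{ij}{}_{kl}=v^i{}_kw^j{}_l$; $\sigma_0=\mathbf 1,\sigma_1,\sigma_2,\sigma_3$ are the Pauli matrices, $V^{AB}{}_i=(\sigma_i)_{AB}$. **Quantum Lorentz groups.** Let $q,q^{1/2}$, $E=(E^{AB})$, $E'=(E'_{AB})$ and $X=\tau Q'$ be one of the following ($e_{ij}$ are the $4\times4$ matrix units in the basis $e_1\otimes e_1,e_1\otimes e_2,e_2\otimes e_1,e_2\otimes e_2$; $c\in\mathbb R\setminus\{0\}$): (1)–(4) $q=q^{1/2}=1$, with, in (1),(2), $E=e_1\otimes e_2-e_2\otimes e_1$, $E'=-e^1\otimes e^2+e^2\otimes e^1$ and in (3),(4) $E=e_1\otimes e_2-e_2\otimes e_1+c\,e_1\otimes e_1$, $E'=-e^1\otimes e^2+e^2\otimes e^1+c\,e^2\otimes e^2$; here (1) $Q'=\mathrm{diag}(t^{-1},t,t,t^{-1})$, $0<t\le1$;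 (2) $Q'=\mathbf 1+c^2e_{14}$; (3) $Q'=\mathbf 1+rc^2e_{14}$, $r\ge0$; (4) $Q'=\mathbf 1+c(e_{12}+e_{13}-e_{24}-e_{34})$; (5)–(7) $q=-1$, $q^{1/2}=i$, $E=e_1\otimes e_2+e_2\otimes e_1$, $E'=e^1\otimes e^2+e^2\otimes e^1$; here (5) $Q'=i\,\mathrm{diag}(t^{-1},-t,-t,t^{-1})$, $0<t\le1$; (6) $Q'=i(\mathrm{diag}(1,-1,-1,1)+c^2e_{14})$; (7) $Q'=i(\mathrm{diag}(r,-r,-r,r)+\varsigma(e_{14}+e_{23}+e_{32}+e_{41}))$, $r=\frac{t+t^{-1}}2$, $\varsigma=\frac{t-t^{-1}}2$, $0<t<1$. $\mathcal A$ is the universal $*$-algebra generated by $w=(w^A{}_B)$ with $(w\otimes w)E=E$, $E'(w\otimes w)=E'$, $X(w\otimes\bar w)=(\bar w\otimes w)X$, where $\bar w^A{}_B=(w^A{}_B)^*$. It is a Hopf $*$-algebra in which $w$ is a representation, with counit $\varepsilon$ and antipode $S$. Put $\Lambda=V^{-1}(w\otimes\bar w)V$. **Quantum Poincaré groups.** Let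 $s=\pm1$, let $H^{ABC}{}_D,T^{ABCD}\in\mathbb C$, and put $(H_V)^{iC}{}_D=(V^{-1})^i{}_{AB}H^{ABC}{}_D$, $T^{ij}=(V^{-1})^i{}_{AB}(V^{-1})^j{}_{CD}T^{ABCD}$, $L=sq^{1/2}(\mathbf 1+qEE')$, $\tilde L=q\tau L\tau$, $$R=(V^{-1}\otimes V^{-1})(\mathbf 1\otimes X\otimes\mathbf 1)(L\otimes\tilde L)(\mathbf 1\otimes X^{-1}\otimes\mathbf 1)(V\otimes V),$$ $$G=(V^{-1}\otimes\mathbf 1)(\mathbf 1\otimes X)(L\otimes\mathbf 1)(\mathbf 1\otimes V),\quad \tilde G=(V^{-1}\otimes\mathbf 1)(\mathbf 1\otimes\tilde L)(X^{-1}\otimes\mathbf 1)(\mathbf 1\otimes V),$$ $$\tilde H_V=-\tau\overline{G^{-1}H_V},\quad Z=(\mathbf 1\otimes V^{-1})[H_V\otimes\mathbf 1+(G\otimes\mathbf 1)(\mathbf 1\otimes\tilde H_V)]V.$$ $\mathcal B$ is the universal $*$-algebra generated by $\mathcal A$ and selfadjoint $y^i$ with $$(R-\mathbf 1)^{ij}{}_{kl}(y^ky^l-Z^{kl}{}_my^m+T^{kl}-\Lambda^k{}_m\Lambda^l{}_nT^{mn})=0,$$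 $$y^iw^A{}_B=G^{iA}{}_{Cj}w^C{}_By^j+(H_V)^{iA}{}_Cw^C{}_B-\Lambda^i{}_jw^A{}_C(H_V)^{jC}{}_B .$$ Assume that these data define a quantum Poincaré group, i.e. the left $\mathcal A$-module spanned in $\mathcal B$ by the $y^iy^j$, the $y^i$ and $I$ has, as in the classical case, a free basis of $10+4+1$ elements (ten linear combinations of the $y^iy^j$, the four $y^i$, and $I$). Assume also that the four-dimensional covariant differential calculus exists, i.e. $$\tilde F=[(R-\mathbf 1)\otimes\mathbf 1]\{(\mathbf 1\otimes Z)Z-(Z\otimes\mathbf 1)Z+T\otimes\mathbf 1-(\mathbf 1\otimes R)(R\otimes\mathbf 1)(\mathbf 1\otimes T)\}=0.$$ **Quantum Minkowski space.** $\mathcal C$ is the universal $*$-algebra generated by selfadjoint $x^i$ with $(R-\mathbf 1)^{ij}{}_{kl}(x^kx^l-Z^{kl}{}_mx^m+T^{kl})=0$. Then (as part of the assertion) there are unique maps as follows: * the counit $\varepsilon$ and the antipode $S$ of $\mathcal A$, and a homomorphism $f=(f^i{}_j):\mathcal A\to M_4(\mathbb C)$ with $f^i{}_j(w^C{}_D)=G^{iC}{}_{Dj}$,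 $f^i{}_j((w^C{}_D)^*)=\tilde G^{iC}{}_{Dj}$; * a homomorphism $\mathbf X:\mathcal B\to M_5(\mathbb C)$ with $\mathbf X(a)=\begin{pmatrix}(f^l{}_j(S(a)))_{j,l}&0\\0&\varepsilon(a)\end{pmatrix}$ for $a\in\mathcal A$ and $\mathbf X(y^i)=\begin{pmatrix}(Z^{il}{}_j)_{j,l}&(\delta^i{}_j)_j\\0&0\end{pmatrix}$; the first four entries of its last column are functionals $Y_j\in\mathcal B'$; * a $*$-homomorphism $\Psi:\mathcal C\to\mathcal B\otimes\mathcal C$ with $\Psi(x^i)=\Lambda^i{}_j\otimes x^j+y^i\otimes I$; * linear maps $\partial_i:\mathcal C\to\mathcal C$ with $\partial_i(I)=0$ and $\partial_i(x^kg)=\delta^k{}_ig+(R^{kl}{}_{in}x^n+Z^{kl}{}_i)\partial_lg$ for $g\in\mathcal C$. **Bispinors.** Let $\tilde{\mathcal C}=\mathbb C^4\otimes\mathcal C$, let $\varepsilon_1,\dots,\varepsilon_4$ be the standard basis of $\mathbb C^4=\mathbb C^2\oplus\mathbb C^2$, let $\mathcal G=(w^T)^{-1}\oplus\bar w$, and let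 $\tilde\Psi:\tilde{\mathcal C}\to\mathcal B\otimes\tilde{\mathcal C}$ be the linear map with $\tilde\Psi(\varepsilon_a\otimes\phi)=\sum_l\mathcal G_a{}^l\phi^{(1)}\otimes\varepsilon_l\otimes\phi^{(2)}$, where $\Psi(\phi)=\phi^{(1)}\otimes\phi^{(2)}$. The Dirac operator is $\partial\!\!\!/=\gamma^i\otimes\partial_i$ on $\tilde{\mathcal C}$, with $$\gamma^i=\begin{pmatrix}0&bA_i\\a\sigma_i&0\end{pmatrix},\qquad A_i=q^{-1/2}E^T(\sigma_i\circ D)E,\quad (\sigma_i\circ D)_{KL}=(\sigma_i)_{AB}D^{AB}{}_{KL},\quad D=\tau X^{-1}\tau,$$ $a,b\in\mathbb C$ (the normalized choice being $a=b=1$). **Proposition.** Let $\tilde\partial_j=(Y_j\otimes\mathrm{id})\tilde\Psi:\tilde{\mathcal C}\to\tilde{\mathcal C}$, $j=0,1,2,3$. Then, for all $j$ and all $a,b$, $$\tilde\partial_j\,\partial\!\!\!/=\partial\!\!\!/\,\tilde\partial_j,\qquad (\mathrm{id}\otimes\tilde\partial_j)\tilde\Psi(\phi)=(\Lambda^i{}_j\otimes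 I)\tilde\Psi(\tilde\partial_i\phi),\quad\phi\in\tilde{\mathcal C}.$$ -/

import Mathlib

open scoped TensorProduct BigOperators

noncomputable section

namespace QuantumMinkowski

/-! ## Unital star-algebras over the complex numbers given by generators and relations -/

/-- The free unital complex algebra on `G`; the involution of `G` extends to an antilinear,
antimultiplicative involution, see the instance below. -/
def FreeStar (G : Type) : Type := FreeAlgebra ℂ G

namespace FreeStar

variable {G : Type}

instance : Ring (FreeStar G) := inferInstanceAs (Ring (FreeAlgebra ℂ G))

instance : Algebra ℂ (FreeStar G) := inferInstanceAs (Algebra ℂ (FreeAlgebra ℂ G))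

/-- The generators. -/
def gen (g : G) : FreeStar G := FreeAlgebra.ι ℂ g

/-- Every map of `G` into a unital algebra extends to the free algebra. -/
def lift {S : Type} [Ring S] [Algebra ℂ S] (φ : G → S) : FreeStar G →ₐ[ℂ] S :=
  FreeAlgebra.lift ℂ φ

theorem lift_gen {S : Type} [Ring S] [Algebra ℂ S] (φ : G → S) (g : G) :
    lift φ (gen g) = φ g :=
  FreeAlgebra.lift_ι_apply (R := ℂ) φ g

theorem induction {C : FreeStar G → Prop} (h1 : ∀ c : ℂ, C (algebraMap ℂ _ c))
    (h2 : ∀ g, C (gen g)) (h3 : ∀ a b, C a → C b → C (a * b))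
    (h4 : ∀ a b, C a → C b → C (a + b)) (a : FreeStar G) : C a :=
  FreeAlgebra.induction ℂ G (motive := C) h1 h2 h3 h4 a

/-- The complex conjugate of the scalar action on the opposite of a complex algebra. -/
abbrev conjOpAlgebra (S : Type) [Ring S] [Algebra ℂ S] : Algebra ℂ Sᵐᵒᵖ :=
  ((algebraMap ℂ Sᵐᵒᵖ).comp (starRingEnd ℂ)).toAlgebra'
    (fun c x => Algebra.commutes ((starRingEnd ℂ) c) x)

variable [InvolutiveStar G]

/-- The adjoint as a ring homomorphism to the opposite algebra. -/
def adj : FreeStar G →+* (FreeStar G)ᵐᵒᵖ :=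
  letI := conjOpAlgebra (FreeStar G)
  (FreeAlgebra.lift ℂ (fun g : G => MulOpposite.op (gen (star g))) :
    FreeAlgebra ℂ G →ₐ[ℂ] (FreeStar G)ᵐᵒᵖ).toRingHom

theorem adj_gen (g : G) : adj (gen g) = MulOpposite.op (gen (star g)) := by
  let _ := conjOpAlgebra (FreeStar G)
  exact FreeAlgebra.lift_ι_apply (R := ℂ) (fun g : G => MulOpposite.op (gen (star g))) g

theorem adj_algebraMap (c : ℂ) :
    adj (algebraMap ℂ (FreeStar G) c) =
      MulOpposite.op (algebraMap ℂ (FreeStar G) ((starRingEnd ℂ) c)) := by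
  let _ := conjOpAlgebra (FreeStar G)
  exact (FreeAlgebra.lift ℂ (fun g : G => MulOpposite.op (gen (star g))) :
    FreeAlgebra ℂ G →ₐ[ℂ] (FreeStar G)ᵐᵒᵖ).commutes c

instance : StarRing (FreeStar G) where
  star a := (adj a).unop
  star_involutive a := by
    induction a using induction with
    | h1 c => simp [adj_algebraMap]
    | h2 g => simp [adj_gen]
    | h3 a b ha hb => simp only [map_mul, MulOpposite.unop_mul, ha, hb]
    | h4 a b ha hb => simp only [map_add, MulOpposite.unop_add, ha, hb]
  star_mul a b := by simp [map_mul]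
  star_add a b := by simp [map_add]

theorem star_gen (g : G) : star (gen g) = gen (star g) := by
  change (adj (gen g)).unop = _
  rw [adj_gen]; rfl

theorem star_algebraMap (c : ℂ) :
    star (algebraMap ℂ (FreeStar G) c) = algebraMap ℂ (FreeStar G) (star c) := by
  change (adj (algebraMap ℂ (FreeStar G) c)).unop = _
  rw [adj_algebraMap]; rfl

instance : StarModule ℂ (FreeStar G) where
  star_smul c a := by
    rw [Algebra.smul_def, star_mul, star_algebraMap, ← Algebra.commutes, ← Algebra.smul_def]

theorem lift_star {S : Type} [Ring S] [StarRing S] [Algebra ℂ S] [StarModule ℂ S] (φ : G → S)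
    (hφ : ∀ g, φ (star g) = star (φ g)) (a : FreeStar G) : lift φ (star a) = star (lift φ a) := by
  induction a using induction with
  | h1 c => rw [star_algebraMap, AlgHom.commutes, AlgHom.commutes, algebraMap_star_comm]
  | h2 g => rw [star_gen, lift_gen, lift_gen, hφ]
  | h3 a b ha hb => rw [star_mul, map_mul, map_mul, star_mul, ha, hb]
  | h4 a b ha hb => rw [star_add, map_add, map_add, star_add, ha, hb]

end FreeStar

section Presentation

variable {G : Type} [InvolutiveStar G]

/-- The relations `p = 0` and `star p = 0` for `p ∈ P`. -/
def starRel (P : Set (FreeStar G)) (a b : FreeStar G) : Prop :=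
  (a ∈ P ∨ star a ∈ P) ∧ b = 0

/-- The universal unital star-algebra with the generators `G` (whose adjoints are prescribed by
the involution of `G`) and the relations `p = 0`, `p ∈ P`. -/
def StarPres (P : Set (FreeStar G)) : Type := RingQuot (starRel P)

namespace StarPres

variable (P : Set (FreeStar G))

instance : Ring (StarPres P) := inferInstanceAs (Ring (RingQuot (starRel P)))

instance : Algebra ℂ (StarPres P) := inferInstanceAs (Algebra ℂ (RingQuot (starRel P)))

/-- The quotient map. -/
def mk : FreeStar G →ₐ[ℂ] StarPres P := RingQuot.mkAlgHom ℂ (starRel P)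

theorem mk_surjective : Function.Surjective (mk P) := RingQuot.mkAlgHom_surjective ℂ (starRel P)

theorem mk_eq_zero {p : FreeStar G} (hp : p ∈ P) : mk P p = 0 :=
  (RingQuot.mkAlgHom_rel ℂ (s := starRel P) ⟨Or.inl hp, rfl⟩).trans (map_zero (mk P))

theorem mk_star_eq_zero {p : FreeStar G} (hp : p ∈ P) : mk P (star p) = 0 :=
  (RingQuot.mkAlgHom_rel ℂ (s := starRel P)
    ⟨Or.inr (by rwa [star_star]), rfl⟩).trans (map_zero (mk P))

/-- The adjoint, as a ring homomorphism to the opposite algebra. -/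
def adj : StarPres P →+* (StarPres P)ᵐᵒᵖ :=
  RingQuot.lift (r := starRel P)
    ⟨((mk P).toRingHom.op).comp
        (starRingEquiv (R := FreeStar G) : FreeStar G →+* (FreeStar G)ᵐᵒᵖ), by
      rintro a b ⟨h | h, rfl⟩
      · simp [mk_star_eq_zero P h]
      · simpa using congrArg MulOpposite.op (mk_eq_zero P h)⟩

theorem adj_mk (a : FreeStar G) : adj P (mk P a) = MulOpposite.op (mk P (star a)) := by
  have h : mk P a = RingQuot.mkRingHom (starRel P) a :=
    congrArg (fun φ : FreeStar G →+* RingQuot (starRel P) => φ a)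
      (RingQuot.mkAlgHom_coe ℂ (starRel P))
  rw [h]
  exact RingQuot.lift_mkRingHom_apply _ _ _

instance : StarRing (StarPres P) where
  star a := (adj P a).unop
  star_involutive a := by
    obtain ⟨a, rfl⟩ := mk_surjective P a
    simp [adj_mk]
  star_mul a b := by simp [map_mul]
  star_add a b := by simp [map_add]

theorem star_mk (a : FreeStar G) : star (mk P a) = mk P (star a) := by
  change (adj P (mk P a)).unop = _
  rw [adj_mk]; rfl

instance : StarModule ℂ (StarPres P) where
  star_smul c a := by
    obtain ⟨a, rfl⟩ := mk_surjective P a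
    rw [← map_smul, star_mk, star_smul, map_smul, star_mk]

/-- The generators. -/
def gen (g : G) : StarPres P := mk P (FreeStar.gen g)

theorem star_gen (g : G) : star (gen P g) = gen P (star g) := by
  rw [gen, gen, star_mk, FreeStar.star_gen]

/-- The universal property. -/
def lift {S : Type} [Ring S] [StarRing S] [Algebra ℂ S] [StarModule ℂ S] (φ : G → S)
    (hφ : ∀ g, φ (star g) = star (φ g)) (hP : ∀ p ∈ P, FreeStar.lift φ p = 0) :
    StarPres P →ₐ[ℂ] S :=
  RingQuot.liftAlgHom ℂ (s := starRel P) ⟨FreeStar.lift φ, by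
    rintro a b ⟨h | h, rfl⟩
    · rw [hP a h, map_zero]
    · have := hP _ h
      rw [FreeStar.lift_star φ hφ, star_eq_zero] at this
      rw [this, map_zero]⟩

theorem lift_gen {S : Type} [Ring S] [StarRing S] [Algebra ℂ S] [StarModule ℂ S] (φ : G → S)
    (hφ : ∀ g, φ (star g) = star (φ g)) (hP : ∀ p ∈ P, FreeStar.lift φ p = 0) (g : G) :
    lift P φ hφ hP (gen P g) = φ g :=
  (RingQuot.liftAlgHom_mkAlgHom_apply ℂ _ _ _).trans (FreeStar.lift_gen φ g)

end StarPres

end Presentation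

/-! ## Quantum Lorentz groups -/

/-- The quantum Lorentz groups that underlie quantum Poincaré groups: seven families with their
parameters. -/
inductive LorentzCase : Type
  | one (t : ℝ) (h0 : 0 < t) (h1 : t ≤ 1)
  | two (c : ℝ) (hc : c ≠ 0)
  | three (c r : ℝ) (hc : c ≠ 0) (hr : 0 ≤ r)
  | four (c : ℝ) (hc : c ≠ 0)
  | five (t : ℝ) (h0 : 0 < t) (h1 : t ≤ 1)
  | six (c : ℝ) (hc : c ≠ 0)
  | seven (t : ℝ) (h0 : 0 < t) (h1 : t < 1)

namespace LorentzCase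

/-- `q = 1` or `q = -1`. -/
def q : LorentzCase → ℂ
  | one .. | two .. | three .. | four .. => 1
  | five .. | six .. | seven .. => -1

/-- The chosen square root of `q`. -/
def qHalf : LorentzCase → ℂ
  | one .. | two .. | three .. | four .. => 1
  | five .. | six .. | seven .. => Complex.I

/-- `E`, as a `2 × 2` matrix. -/
def E : LorentzCase → Matrix (Fin 2) (Fin 2) ℂ
  | one .. | two .. => !![0, 1; -1, 0]
  | three c .. | four c .. => !![(c : ℂ), 1; -1, 0]
  | five .. | six .. | seven .. => !![0, 1; 1, 0]

/-- `E'`, as a `2 × 2` matrix. -/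
def E' : LorentzCase → Matrix (Fin 2) (Fin 2) ℂ
  | one .. | two .. => !![0, -1; 1, 0]
  | three c .. | four c .. => !![0, -1; 1, (c : ℂ)]
  | five .. | six .. | seven .. => !![0, 1; 1, 0]

/-- `Q'` in the basis `e₁⊗e₁, e₁⊗e₂, e₂⊗e₁, e₂⊗e₂`. -/
def Q' : LorentzCase → Matrix (Fin 4) (Fin 4) ℂ
  | one t .. =>
      !![(t : ℂ)⁻¹, 0, 0, 0; 0, (t : ℂ), 0, 0; 0, 0, (t : ℂ), 0; 0, 0, 0, (t : ℂ)⁻¹]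
  | two c .. => !![1, 0, 0, (c : ℂ) ^ 2; 0, 1, 0, 0; 0, 0, 1, 0; 0, 0, 0, 1]
  | three c r .. => !![1, 0, 0, (r : ℂ) * (c : ℂ) ^ 2; 0, 1, 0, 0; 0, 0, 1, 0; 0, 0, 0, 1]
  | four c .. => !![1, (c : ℂ), (c : ℂ), 0; 0, 1, 0, -(c : ℂ); 0, 0, 1, -(c : ℂ); 0, 0, 0, 1]
  | five t .. => Complex.I •
      !![(t : ℂ)⁻¹, 0, 0, 0; 0, -(t : ℂ), 0, 0; 0, 0, -(t : ℂ), 0; 0, 0, 0, (t : ℂ)⁻¹]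
  | six c .. => Complex.I •
      !![1, 0, 0, (c : ℂ) ^ 2; 0, -1, 0, 0; 0, 0, -1, 0; 0, 0, 0, 1]
  | seven t .. =>
      let r : ℂ := ((t : ℂ) + (t : ℂ)⁻¹) / 2
      let ς : ℂ := ((t : ℂ) - (t : ℂ)⁻¹) / 2
      Complex.I • !![r, 0, 0, ς; 0, -r, ς, 0; 0, ς, -r, 0; ς, 0, 0, r]

/-- `X = τ Q'`, where `τ` is the flip of the two tensor factors. -/
def X (L : LorentzCase) : Matrix (Fin 2 × Fin 2) (Fin 2 × Fin 2) ℂ :=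
  Matrix.of fun p r => L.Q' (finProdFinEquiv p.swap) (finProdFinEquiv r)

theorem E_mul_E' (L : LorentzCase) : L.E * L.E' = 1 := by
  cases L <;> simp [E, E', Matrix.one_fin_two]

theorem E'_mul_E (L : LorentzCase) : L.E' * L.E = 1 := by
  cases L <;> simp [E, E', Matrix.one_fin_two]

/-- The left-hand sides of the relations `(w ⊗ w) E = E`, `E' (w ⊗ w) = E'` and
`X (w ⊗ w̄) = (w̄ ⊗ w) X`, all terms moved to the left, for matrices `w`, `w̄` with entries in an
algebra. -/
def relators (L : LorentzCase) {S : Type} [Ring S] [Algebra ℂ S] (w wbar : Fin 2 → Fin 2 → S) :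
    Set S :=
  {p | ∃ A C, p = (∑ B, ∑ D, L.E B D • (w A B * w C D)) - algebraMap ℂ S (L.E A C)} ∪
  {p | ∃ B D, p = (∑ A, ∑ C, L.E' A C • (w A B * w C D)) - algebraMap ℂ S (L.E' B D)} ∪
  {p | ∃ A B K M, p = (∑ C, ∑ D, L.X (A, B) (C, D) • (w C K * wbar D M)) -
    ∑ C, ∑ D, L.X (C, D) (K, M) • (wbar A C * w B D)}

theorem map_relators (L : LorentzCase) {S S' : Type} [Ring S] [Algebra ℂ S] [Ring S']
    [Algebra ℂ S'] (φ : S →ₐ[ℂ] S') {w wbar : Fin 2 → Fin 2 → S} {p : S}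
    (hp : p ∈ L.relators w wbar) :
    φ p ∈ L.relators (fun A B => φ (w A B)) (fun A B => φ (wbar A B)) := by
  rcases hp with (⟨A, C, rfl⟩ | ⟨B, D, rfl⟩) | ⟨A, B, K, M, rfl⟩
  · exact Or.inl (Or.inl ⟨A, C, by simp⟩)
  · exact Or.inl (Or.inr ⟨B, D, by simp⟩)
  · exact Or.inr ⟨A, B, K, M, by simp⟩

end LorentzCase

/-- The generators of the quantum Lorentz group: `w A B` and its adjoint `wbar A B`. -/
inductive LorentzGen : Type
  | w (A B : Fin 2)
  | wbar (A B : Fin 2)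

instance : InvolutiveStar LorentzGen where
  star
    | .w A B => .wbar A B
    | .wbar A B => .w A B
  star_involutive g := by cases g <;> rfl

/-- The star-algebra `𝒜` of polynomials on the quantum Lorentz group. -/
def LorentzAlg (L : LorentzCase) : Type :=
  StarPres (L.relators (fun A B => FreeStar.gen (LorentzGen.w A B))
    (fun A B => FreeStar.gen (LorentzGen.wbar A B)))

instance (L : LorentzCase) : Ring (LorentzAlg L) := inferInstanceAs (Ring (StarPres _))

instance (L : LorentzCase) : Algebra ℂ (LorentzAlg L) := inferInstanceAs (Algebra ℂ (StarPres _))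

instance (L : LorentzCase) : StarRing (LorentzAlg L) := inferInstanceAs (StarRing (StarPres _))

instance (L : LorentzCase) : StarModule ℂ (LorentzAlg L) :=
  inferInstanceAs (StarModule ℂ (StarPres _))

/-! ## The Pauli matrices -/

/-- The Pauli matrices `σ₀, σ₁, σ₂, σ₃`. -/
def pauli : Fin 4 → Matrix (Fin 2) (Fin 2) ℂ :=
  ![!![1, 0; 0, 1], !![0, 1; 1, 0], !![0, -Complex.I; Complex.I, 0], !![1, 0; 0, -1]]

/-- `V^{AB}_i`. -/
def V (A B : Fin 2) (i : Fin 4) : ℂ := pauli i A B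

/-- `(V⁻¹)^i_{AB}`. -/
def Vinv (i : Fin 4) (A B : Fin 2) : ℂ := (1 / 2) * pauli i B A

/-- `Λ = V⁻¹ (w ⊗ w̄) V`. -/
def LambdaOf {S : Type} [Ring S] [Algebra ℂ S] (w wbar : Fin 2 → Fin 2 → S) (i j : Fin 4) : S :=
  ∑ A, ∑ B, ∑ C, ∑ D, (Vinv i A B * V C D j) • (w A C * wbar B D)

/-! ## Quantum Poincaré groups and quantum Minkowski spaces -/

/-- The numerical data of a quantum Poincaré group: the quantum Lorentz group, the sign `s` and
the arrays `H A B C D = H^{ABC}_D` and `T A B C D = T^{ABCD}`. Which arrays are allowed is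
decided by `IsQuantumPoincareGroup` below. -/
structure PoincareData : Type where
  lor : LorentzCase
  s : ℤˣ
  H : Fin 2 → Fin 2 → Fin 2 → Fin 2 → ℂ
  T : Fin 2 → Fin 2 → Fin 2 → Fin 2 → ℂ

namespace PoincareData

variable (D : PoincareData)

/-- `X`. -/
def Xm : Matrix (Fin 2 × Fin 2) (Fin 2 × Fin 2) ℂ := D.lor.X

/-- `L = s q^{1/2} (1 + q E E')`. -/
def Lm : Matrix (Fin 2 × Fin 2) (Fin 2 × Fin 2) ℂ :=
  (((D.s : ℤ) : ℂ) * D.lor.qHalf) •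
    (1 + D.lor.q • Matrix.of fun p r => D.lor.E p.1 p.2 * D.lor.E' r.1 r.2)

/-- `L̃ = q τ L τ`. -/
def Lt : Matrix (Fin 2 × Fin 2) (Fin 2 × Fin 2) ℂ :=
  D.lor.q • Matrix.of fun p r => D.Lm p.swap r.swap

/-- `R^{ij}_{kl}`, with
`R = (V⁻¹ ⊗ V⁻¹)(1 ⊗ X ⊗ 1)(L ⊗ L̃)(1 ⊗ X⁻¹ ⊗ 1)(V ⊗ V)`. -/
def R (i j k l : Fin 4) : ℂ :=
  ∑ a1, ∑ a2, ∑ a3, ∑ a4, ∑ b2, ∑ b3, ∑ c2, ∑ c3, ∑ d1, ∑ d2, ∑ d3, ∑ d4,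
    Vinv i a1 a2 * Vinv j a3 a4 * D.Xm (a2, a3) (b2, b3) *
      (D.Lm (a1, b2) (d1, c2) * D.Lt (b3, a4) (c3, d4)) *
      D.Xm⁻¹ (c2, c3) (d2, d3) * (V d1 d2 k * V d3 d4 l)

/-- `G^{iC}_{Dj}`, as the matrix with the entry `G^{iC}_{Dj}` in row `(i, C)` and column
`(j, D)`, where `G = (V⁻¹ ⊗ 1)(1 ⊗ X)(L ⊗ 1)(1 ⊗ V)`. In this form the inverse matrix is
`τ G⁻¹`. -/
def G : Matrix (Fin 4 × Fin 2) (Fin 4 × Fin 2) ℂ :=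
  Matrix.of fun p r => ∑ a1, ∑ a2, ∑ b1, ∑ b2, ∑ b3,
    Vinv p.1 a1 a2 * D.Xm (a2, p.2) (b2, b3) * D.Lm (a1, b2) (r.2, b1) * V b1 b3 r.1

/-- `G̃^{iC}_{Dj}`, in row `(i, C)` and column `(j, D)`, where
`G̃ = (V⁻¹ ⊗ 1)(1 ⊗ L̃)(X⁻¹ ⊗ 1)(1 ⊗ V)`. -/
def Gt : Matrix (Fin 4 × Fin 2) (Fin 4 × Fin 2) ℂ :=
  Matrix.of fun p r => ∑ a1, ∑ a2, ∑ b1, ∑ b2, ∑ b3,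
    Vinv p.1 a1 a2 * D.Lt (a2, p.2) (b2, b3) * D.Xm⁻¹ (a1, b2) (r.2, b1) * V b1 b3 r.1

/-- `(H_V)^{iC}_D`, in row `(i, C)`. -/
def HV : Matrix (Fin 4 × Fin 2) (Fin 2) ℂ :=
  Matrix.of fun p d => ∑ a, ∑ b, Vinv p.1 a b * D.H a b p.2 d

/-- `H̃_V`, the negative complex conjugate of `τ G⁻¹ H_V`. -/
def HVt : Matrix (Fin 4 × Fin 2) (Fin 2) ℂ :=
  -(D.G⁻¹ * D.HV).map (starRingEnd ℂ)

/-- `Z^{ij}_m`, with `Z = (1 ⊗ V⁻¹)(H_V ⊗ 1 + (G ⊗ 1)(1 ⊗ H̃_V)) V`. -/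
def Z (i j m : Fin 4) : ℂ :=
  ∑ a, ∑ b, ∑ c, ∑ d, Vinv j a b *
    (D.HV (i, a) c * (if b = d then 1 else 0) + ∑ k, D.G (i, a) (k, c) * D.HVt (k, b) d) * V c d m

/-- `T^{ij}`. -/
def TV (i j : Fin 4) : ℂ :=
  ∑ a, ∑ b, ∑ c, ∑ d, Vinv i a b * Vinv j c d * D.T a b c d

/-- `(R - 1)^{ij}_{kl}`. -/
def R1 (i j k l : Fin 4) : ℂ := D.R i j k l - if i = k ∧ j = l then 1 else 0

/-- `F̃^{ijn}_m`, where `F̃ = ((R - 1) ⊗ 1)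
((1 ⊗ Z) Z - (Z ⊗ 1) Z + T ⊗ 1 - (1 ⊗ R)(R ⊗ 1)(1 ⊗ T))`. -/
def Ftilde (i j n m : Fin 4) : ℂ :=
  ∑ k, ∑ l, D.R1 i j k l *
    ((∑ p, D.Z l n p * D.Z k p m) - (∑ p, D.Z k l p * D.Z p n m) +
      D.TV k l * (if n = m then 1 else 0) -
      ∑ a, ∑ b, ∑ p, D.R l n p b * D.R k p m a * D.TV a b)

/-- The star-algebra `𝒜`. -/
abbrev Lor : Type := LorentzAlg D.lor

/-- `w^A_B` in `𝒜`. -/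
def wA (A B : Fin 2) : D.Lor := StarPres.gen _ (LorentzGen.w A B)

/-- `w̄^A_B = (w^A_B)*` in `𝒜`. -/
def wbarA (A B : Fin 2) : D.Lor := StarPres.gen _ (LorentzGen.wbar A B)

end PoincareData

/-- The generators of the quantum Poincaré group: those of the quantum Lorentz group and the
selfadjoint `y i`. -/
inductive PoincareGen : Type
  | w (A B : Fin 2)
  | wbar (A B : Fin 2)
  | y (i : Fin 4)

instance : InvolutiveStar PoincareGen where
  star
    | .w A B => .wbar A B
    | .wbar A B => .w A B
    | .y i => .y i
  star_involutive g := by cases g <;> rfl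

/-- The generators of the quantum Minkowski space: the selfadjoint coordinates `x i`. -/
inductive MinkowskiGen : Type
  | x (i : Fin 4)

instance : InvolutiveStar MinkowskiGen where
  star g := g
  star_involutive _ := rfl

namespace PoincareData

variable (D : PoincareData)

/-- The relations of `𝒜` and the two sets of relations that involve the `y i`, namely
`(R-1)^{ij}_{kl}(y^k y^l - Z^{kl}_m y^m + T^{kl} - Λ^k_m Λ^l_n T^{mn}) = 0` and
`y^i w^A_B = G^{iA}_{Cj} w^C_B y^j + (H_V)^{iA}_C w^C_B - Λ^i_j w^A_C (H_V)^{jC}_B`. -/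
def poincareRelators : Set (FreeStar PoincareGen) :=
  let w : Fin 2 → Fin 2 → FreeStar PoincareGen := fun A B => FreeStar.gen (.w A B)
  let wbar : Fin 2 → Fin 2 → FreeStar PoincareGen := fun A B => FreeStar.gen (.wbar A B)
  let y : Fin 4 → FreeStar PoincareGen := fun i => FreeStar.gen (.y i)
  D.lor.relators w wbar ∪
  {p | ∃ i j, p = ∑ k, ∑ l, D.R1 i j k l •
    (y k * y l - (∑ m, D.Z k l m • y m) + algebraMap ℂ _ (D.TV k l) -
      ∑ m, ∑ n, D.TV m n • (LambdaOf w wbar k m * LambdaOf w wbar l n))} ∪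
  {p | ∃ i A B, p = y i * w A B -
    ((∑ C, ∑ j, D.G (i, A) (j, C) • (w C B * y j)) + (∑ C, D.HV (i, A) C • w C B) -
      ∑ j, ∑ C, D.HV (j, C) B • (LambdaOf w wbar i j * w A C))}

/-- The star-algebra `ℬ` of polynomials on the quantum Poincaré group. -/
def Poin : Type := StarPres D.poincareRelators

instance : Ring D.Poin := inferInstanceAs (Ring (StarPres D.poincareRelators))

instance : Algebra ℂ D.Poin := inferInstanceAs (Algebra ℂ (StarPres D.poincareRelators))

instance : StarRing D.Poin := inferInstanceAs (StarRing (StarPres D.poincareRelators))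

instance : StarModule ℂ D.Poin := inferInstanceAs (StarModule ℂ (StarPres D.poincareRelators))

/-- `w^A_B` in `ℬ`. -/
def w (A B : Fin 2) : D.Poin := StarPres.gen D.poincareRelators (PoincareGen.w A B)

/-- `w̄^A_B` in `ℬ`. -/
def wbar (A B : Fin 2) : D.Poin := StarPres.gen D.poincareRelators (PoincareGen.wbar A B)

/-- `y^i` in `ℬ`. -/
def y (i : Fin 4) : D.Poin := StarPres.gen D.poincareRelators (PoincareGen.y i)

/-- `Λ^i_j` in `ℬ`. -/
def Lam (i j : Fin 4) : D.Poin := LambdaOf D.w D.wbar i j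

/-- `w` and `w̄` in `ℬ`, on the generators of `𝒜`. -/
def inclGen : LorentzGen → D.Poin
  | .w A B => D.w A B
  | .wbar A B => D.wbar A B

/-- The canonical homomorphism `𝒜 → ℬ`. -/
def incl : D.Lor →ₐ[ℂ] D.Poin :=
  StarPres.lift _ D.inclGen
    (fun g => by
      cases g
      · exact (StarPres.star_gen D.poincareRelators (PoincareGen.w _ _)).symm
      · exact (StarPres.star_gen D.poincareRelators (PoincareGen.wbar _ _)).symm)
    (by
      intro p hp
      have h1 := D.lor.map_relators (FreeStar.lift D.inclGen) hp
      let φ : FreeStar LorentzGen →ₐ[ℂ] FreeStar PoincareGen :=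
        FreeStar.lift fun g => match g with
          | .w A B => FreeStar.gen (.w A B)
          | .wbar A B => FreeStar.gen (.wbar A B)
      have h2 : FreeStar.lift D.inclGen = (StarPres.mk D.poincareRelators).comp φ := by
        apply FreeAlgebra.hom_ext
        funext g
        change FreeStar.lift D.inclGen (FreeStar.gen g) =
          StarPres.mk D.poincareRelators (φ (FreeStar.gen g))
        rw [FreeStar.lift_gen, FreeStar.lift_gen]
        cases g <;> rfl
      have h3 : φ p ∈ D.poincareRelators := by
        refine Or.inl (Or.inl ?_)
        have := D.lor.map_relators φ hp
        simpa only [φ, FreeStar.lift_gen] using this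
      rw [h2]
      exact StarPres.mk_eq_zero _ h3)

/-- The data define a quantum Poincaré group: the polynomials of degree at most two in the `y i`
are as many as in the classical case. Precisely, the left `𝒜`-module spanned by the `y^i y^j`,
the `y^i` and the unit has a free basis of `10 + 4 + 1` elements, namely ten linear combinations
of the `y^i y^j`, the four `y^i` and the unit. -/
def IsQuantumPoincareGroup : Prop :=
  ∃ u : Fin 10 → D.Poin,
    (∀ n, u n ∈ Submodule.span ℂ (Set.range fun p : Fin 4 × Fin 4 => D.y p.1 * D.y p.2)) ∧
    (∀ i j, ∃ (a : Fin 10 → D.Lor) (b : Fin 4 → D.Lor) (c : D.Lor),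
      D.y i * D.y j =
        (∑ n, D.incl (a n) * u n) + (∑ k, D.incl (b k) * D.y k) + D.incl c) ∧
    (∀ (a : Fin 10 → D.Lor) (b : Fin 4 → D.Lor) (c : D.Lor),
      (∑ n, D.incl (a n) * u n) + (∑ k, D.incl (b k) * D.y k) + D.incl c = 0 →
        a = 0 ∧ b = 0 ∧ c = 0)

/-- The relations `(R-1)^{ij}_{kl}(x^k x^l - Z^{kl}_m x^m + T^{kl}) = 0`. -/
def minkowskiRelators : Set (FreeStar MinkowskiGen) :=
  let x : Fin 4 → FreeStar MinkowskiGen := fun i => FreeStar.gen (.x i)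
  {p | ∃ i j, p = ∑ k, ∑ l, D.R1 i j k l •
    (x k * x l - (∑ m, D.Z k l m • x m) + algebraMap ℂ _ (D.TV k l))}

/-- The star-algebra `𝒞` of polynomials on the quantum Minkowski space. -/
def Mink : Type := StarPres D.minkowskiRelators

instance : Ring D.Mink := inferInstanceAs (Ring (StarPres D.minkowskiRelators))

instance : Algebra ℂ D.Mink := inferInstanceAs (Algebra ℂ (StarPres D.minkowskiRelators))

instance : StarRing D.Mink := inferInstanceAs (StarRing (StarPres D.minkowskiRelators))

instance : StarModule ℂ D.Mink := inferInstanceAs (StarModule ℂ (StarPres D.minkowskiRelators))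

/-- The coordinate `x^i` in `𝒞`. -/
def x (i : Fin 4) : D.Mink := StarPres.gen D.minkowskiRelators (MinkowskiGen.x i)

/-- The defining properties of the standard maps of a quantum Poincaré group and its quantum
Minkowski space: of the counit `ε` and the antipode `S` of `𝒜` (`ε(w) = 1`, `S(w) = w⁻¹`, and the
same for `w̄`), of the homomorphism `f = (f^i_j)`, of the homomorphism `𝐗` into the `5 × 5`
matrices, of the action `Ψ` on the quantum Minkowski space, and of the partial derivatives `pd`.
-/
structure AreStandardMaps (ε : D.Lor →ₐ[ℂ] ℂ) (S : D.Lor →ₐ[ℂ] D.Lorᵐᵒᵖ)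
    (f : D.Lor →ₐ[ℂ] Matrix (Fin 4) (Fin 4) ℂ)
    (X : D.Poin →ₐ[ℂ] Matrix (Fin 4 ⊕ Unit) (Fin 4 ⊕ Unit) ℂ)
    (Ψ : D.Mink →⋆ₐ[ℂ] D.Poin ⊗[ℂ] D.Mink) (pd : Fin 4 → D.Mink →ₗ[ℂ] D.Mink) : Prop where
  eps_w : ∀ A B, ε (D.wA A B) = if A = B then 1 else 0
  eps_wbar : ∀ A B, ε (D.wbarA A B) = if A = B then 1 else 0
  S_w : ∀ A B, ∑ C, (S (D.wA A C)).unop * D.wA C B = if A = B then 1 else 0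
  w_S : ∀ A B, ∑ C, D.wA A C * (S (D.wA C B)).unop = if A = B then 1 else 0
  S_wbar : ∀ A B, ∑ C, (S (D.wbarA A C)).unop * D.wbarA C B = if A = B then 1 else 0
  wbar_S : ∀ A B, ∑ C, D.wbarA A C * (S (D.wbarA C B)).unop = if A = B then 1 else 0
  f_w : ∀ A B i j, f (D.wA A B) i j = D.G (i, A) (j, B)
  f_wbar : ∀ A B i j, f (D.wbarA A B) i j = D.Gt (i, A) (j, B)
  X_incl : ∀ a, X (D.incl a) =
    Matrix.fromBlocks (Matrix.of fun j l => f (S a).unop l j) 0 0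
      (Matrix.of fun _ _ => ε a)
  X_y : ∀ i, X (D.y i) =
    Matrix.fromBlocks (Matrix.of fun j l => D.Z i l j)
      (Matrix.of fun j _ => if i = j then 1 else 0) 0 0
  Ψ_x : ∀ i, Ψ (D.x i) = (∑ j, D.Lam i j ⊗ₜ[ℂ] D.x j) + D.y i ⊗ₜ[ℂ] 1
  pd_one : ∀ i, pd i 1 = 0
  pd_x_mul : ∀ i k g, pd i (D.x k * g) = (if k = i then g else 0) +
    ∑ l, ((∑ n, D.R k l i n • D.x n) + D.Z k l i • 1) * pd l g

/-! ## Bispinors -/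

/-- The index set of bispinors, `ℂ⁴ = ℂ² ⊕ ℂ²`. -/
abbrev Spin : Type := Fin 2 ⊕ Fin 2

/-- `(w^T)⁻¹ = E⁻¹ w E`. -/
def cw (a b : Fin 2) : D.Poin := ∑ c, ∑ d, (D.lor.E' a c * D.lor.E d b) • D.w c d

/-- The representation `𝒢 = ᶜw ⊕ w̄`; `Gspin a l` is `𝒢_a^l`. -/
def Gspin : Matrix Spin Spin D.Poin :=
  Matrix.fromBlocks (Matrix.of D.cw) 0 0 (Matrix.of D.wbar)

/-- The matrix `A_i = q^{-1/2} Eᵀ (σ_i ∘ τ X⁻¹ τ) E`, where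
`(σ ∘ M)_{KL} = σ_{AB} M^{AB}_{KL}`. -/
def gammaA (i : Fin 4) : Matrix (Fin 2) (Fin 2) ℂ :=
  D.lor.qHalf⁻¹ • (D.lor.E.transpose *
    (Matrix.of fun k l => ∑ a, ∑ b, pauli i a b * D.Xm⁻¹ (b, a) (l, k)) * D.lor.E)

/-- The gamma matrices. -/
def gamma (a b : ℂ) (i : Fin 4) : Matrix Spin Spin ℂ :=
  Matrix.fromBlocks 0 (b • D.gammaA i) (a • pauli i) 0

/-- Bispinor functions `ℂ⁴ ⊗ 𝒞`. -/
abbrev Bispinor : Type := (Spin → ℂ) ⊗[ℂ] D.Mink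

variable {D}

/-- The Dirac operator `γ^i ⊗ ∂_i`. -/
def dirac (a b : ℂ) (pd : Fin 4 → D.Mink →ₗ[ℂ] D.Mink) : D.Bispinor →ₗ[ℂ] D.Bispinor :=
  ∑ i, TensorProduct.map (Matrix.toLin' (D.gamma a b i)) (pd i)

/-- The functional `Y_j` on `ℬ`, an entry of the last column of `𝐗`. -/
def Y (X : D.Poin →ₐ[ℂ] Matrix (Fin 4 ⊕ Unit) (Fin 4 ⊕ Unit) ℂ) (j : Fin 4) : D.Poin →ₗ[ℂ] ℂ :=
  (Matrix.entryLinearMap ℂ ℂ (Sum.inl j) (Sum.inr ())).comp X.toLinearMap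

/-- The action on bispinor functions,
`Ψ̃(ε_a ⊗ φ) = 𝒢_a^l φ⁽¹⁾ ⊗ ε_l ⊗ φ⁽²⁾` with `Ψ(φ) = φ⁽¹⁾ ⊗ φ⁽²⁾`. -/
def PsiTilde (Ψ : D.Mink →⋆ₐ[ℂ] D.Poin ⊗[ℂ] D.Mink) :
    D.Bispinor →ₗ[ℂ] D.Poin ⊗[ℂ] D.Bispinor :=
  ∑ a : Spin, ∑ l : Spin,
    (TensorProduct.map (LinearMap.mulLeft ℂ (D.Gspin a l))
        (TensorProduct.mk ℂ (Spin → ℂ) D.Mink (Pi.single l 1))) ∘ₗ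
      Ψ.toAlgHom.toLinearMap ∘ₗ
      (TensorProduct.lid ℂ D.Mink).toLinearMap ∘ₗ
      (LinearMap.proj (R := ℂ) (φ := fun _ : Spin => ℂ) a).rTensor D.Mink

/-- `∂̃_j = (Y_j ⊗ id) Ψ̃`. -/
def pdTilde (X : D.Poin →ₐ[ℂ] Matrix (Fin 4 ⊕ Unit) (Fin 4 ⊕ Unit) ℂ)
    (Ψ : D.Mink →⋆ₐ[ℂ] D.Poin ⊗[ℂ] D.Mink) (j : Fin 4) : D.Bispinor →ₗ[ℂ] D.Bispinor :=
  (TensorProduct.lid ℂ D.Bispinor).toLinearMap ∘ₗ (Y X j).rTensor D.Bispinor ∘ₗ PsiTilde Ψ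

end PoincareData

end QuantumMinkowski

end

/-!
The proof reduces every assertion to exchange relations `u w g = g w u`, the relation `Exch u w g`
between a matrix `u` over an algebra `S`, the matrix `w` over `S`, and a numerical matrix `g` of
matrices. They are compatible with tensor products, and a pair `(w, w̄)` satisfying the relations of
`𝒜` (a Lorentz pair) has them with numerical values `g` that are again Lorentz pairs: `w` is
exchanged with `(w, w̄)` through `(L, X⁻¹)` and `w̄` through `(X, L̃)`. Tensoring the two gives the
exchange of `Λ` with `(w, w̄)` through `f` (`exch_lamM_w`), the existence of `f`
(`isLorentzPair_f`), and `Λ Λ R = R Λ Λ`, because `f(Λ) = R`.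

The commutation rule of `y` with `w` is the exchange of the affine matrix `(Λ y; 0 1)` with `w`,
through the affine matrices `aw` with linear part `f(w)` and translation part `H_V` (`exch_Pm_w`).
These form a Lorentz pair too (`isLorentzPair_aw`): a failure of the relations would be a translation
covariant under `𝒜`, by the embedding of `𝒜` in `ℬ`, and the character `w ↦ -1`, `w̄ ↦ 1` rules
this out. The translation part of `Λ` in this pair is `Z`, so that the exchange of `Λ` with `w` in it
says that the matrices prescribed for `𝐗(y^i)` have the right commutation rules with `𝐗(w)`;
here `f(S(Λ))` is expressed by `R` because `R² = 1` (`fS_LamA`). The quadratic relations for them are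
the equation `F̃ = 0` (`quadratic_X`). As `𝐗` is not a `*`-homomorphism, the adjoint relations have
to be respected as well; for the quadratic ones this is automatic, because freeness forces their
difference from the given ones to have vanishing linear and constant parts (`R1_mul_Z_sub_conj`).
This yields `𝐗` (`XB`). The relations of `𝒞` are covariant (`transformed_relation`), which yields
`Ψ`.

The partial derivatives are the entries of the last column of `(𝐗 ⊗ id) Ψ` (`pdB`), so the twisted
Leibniz rule is the multiplicativity of `(𝐗 ⊗ id) Ψ`. Their covariance
`(id ⊗ ∂_j) Ψ(g) = (Λ^i_j ⊗ 1) Ψ(∂_i g)` follows by induction on words (`lTensor_pdB_PsiHom`), and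
the application of `𝐗 ⊗ id` to it gives `∂_j ∂_k = R^{il}_{kj} ∂_l ∂_i` (`pdB_pdB`).

For bispinors, `∂̃_j` acts by the matrix `𝐗(𝒢)` and the derivatives `∂_p` (`pdTilde_single`). The
gamma matrices intertwine `𝒢` with `𝒢 ⊗ Λ` (`sum_gamma_smul_Gspin`); with `∂∂ = R ∂∂` this gives
the commutation with the Dirac operator. The exchange of `𝒢` with `Λ` (`exch_Gspin`) and the
covariance of the `∂_i` give the covariance of the `∂̃_j`. The uniqueness of the standard maps holds
because they are prescribed on generators.
-/

namespace QuantumMinkowski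

open Matrix
open scoped Kronecker

/-! ### The numerical data of the seven families -/

namespace LorentzCase

variable (L : LorentzCase)

theorem q_mul_q : L.q * L.q = 1 := by
  cases L <;> simp [q]

theorem qHalf_mul_qHalf : L.qHalf * L.qHalf = L.q := by
  cases L <;> simp [q, qHalf]

theorem conj_q : (starRingEnd ℂ) L.q = L.q := by
  cases L <;> simp [q]

theorem conj_qHalf : (starRingEnd ℂ) L.qHalf = L.q * L.qHalf := by
  cases L <;> simp [q, qHalf]

theorem conj_E (A B : Fin 2) : (starRingEnd ℂ) (L.E A B) = L.E A B := by
  cases L <;> fin_cases A <;> fin_cases B <;> simp [E]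

theorem conj_E' (A B : Fin 2) : (starRingEnd ℂ) (L.E' A B) = L.E' A B := by
  cases L <;> fin_cases A <;> fin_cases B <;> simp [E']

theorem finProdFinEquiv_apply (a b : Fin 2) :
    finProdFinEquiv (a, b) = ((![![0, 1], ![2, 3]] : Fin 2 → Fin 2 → Fin 4) a b) := by
  fin_cases a <;> fin_cases b <;> rfl

theorem X_apply (a b c d : Fin 2) :
    L.X (a, b) (c, d) = L.Q' ((![![0, 1], ![2, 3]] : Fin 2 → Fin 2 → Fin 4) b a)
      ((![![0, 1], ![2, 3]] : Fin 2 → Fin 2 → Fin 4) c d) := by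
  simp only [X, Matrix.of_apply, Prod.swap_prod_mk, finProdFinEquiv_apply]

/-- The reality of `X`: complex conjugation amounts to the exchange of the tensor factors. -/
theorem conj_X (p r : Fin 2 × Fin 2) :
    (starRingEnd ℂ) (L.X p r) = L.q * L.X p.swap r.swap := by
  obtain ⟨a, b⟩ := p
  obtain ⟨c, d⟩ := r
  simp only [Prod.swap_prod_mk, X_apply]
  cases L <;> fin_cases a <;> fin_cases b <;> fin_cases c <;> fin_cases d <;>
    simp [Q', q, map_ofNat]

end LorentzCase

/-- A matrix whose rows and columns are indexed by pairs, as a matrix of matrices: the pair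
`(w^A_B)^a_e = M^{aA}_{Be}`. -/
def blk (M : Matrix (Fin 2 × Fin 2) (Fin 2 × Fin 2) ℂ) :
    Matrix (Fin 2) (Fin 2) (Matrix (Fin 2) (Fin 2) ℂ) :=
  of fun A B => of fun a e => M (a, A) (B, e)

namespace LorentzCase
variable (L : LorentzCase)

/-- For each of the seven families, the matrix `X`, read as a representation `w ↦ blk X`, satisfies
the relation `(w ⊗ w) E = E`. -/
theorem X_E (A C a d : Fin 2) :
    ∑ B, ∑ D, ∑ e, L.X (a, A) (B, e) * L.E B D * L.X (e, C) (D, d) =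
      L.E A C * if a = d then 1 else 0 := by
  simp only [X_apply, Fin.sum_univ_two]
  cases L with
  | one t h0 =>
    have : (t : ℂ) ≠ 0 := by exact_mod_cast h0.ne'
    fin_cases a <;> fin_cases A <;> fin_cases C <;> fin_cases d <;> simp [Q', E, this]
  | two c =>
    fin_cases a <;> fin_cases A <;> fin_cases C <;> fin_cases d <;> simp [Q', E]
  | three c r =>
    fin_cases a <;> fin_cases A <;> fin_cases C <;> fin_cases d <;> simp [Q', E]
  | four c =>
    fin_cases a <;> fin_cases A <;> fin_cases C <;> fin_cases d <;> simp [Q', E]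
  | five t h0 =>
    have : (t : ℂ) ≠ 0 := by exact_mod_cast h0.ne'
    fin_cases a <;> fin_cases A <;> fin_cases C <;> fin_cases d <;> simp [Q', E] <;>
      ring_nf <;> simp [this]
  | six c =>
    fin_cases a <;> fin_cases A <;> fin_cases C <;> fin_cases d <;> simp [Q', E]
    ring_nf
  | seven t h0 =>
    have : (t : ℂ) ≠ 0 := by exact_mod_cast h0.ne'
    fin_cases a <;> fin_cases A <;> fin_cases C <;> fin_cases d <;> simp [Q', E] <;>
      field_simp <;> ring_nf <;> simp

theorem exists_Q'_inv : ∃ Y, L.Q' * Y = 1 := by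
  cases L with
  | one t h0 =>
    have : (t : ℂ) ≠ 0 := by exact_mod_cast h0.ne'
    refine ⟨!![(t : ℂ), 0, 0, 0; 0, (t : ℂ)⁻¹, 0, 0; 0, 0, (t : ℂ)⁻¹, 0; 0, 0, 0, (t : ℂ)], ?_⟩
    ext i j
    fin_cases i <;> fin_cases j <;> simp [Q', mul_apply, Fin.sum_univ_four, this]
  | two c =>
    refine ⟨!![1, 0, 0, -(c : ℂ) ^ 2; 0, 1, 0, 0; 0, 0, 1, 0; 0, 0, 0, 1], ?_⟩
    ext i j
    fin_cases i <;> fin_cases j <;> simp [Q', mul_apply, Fin.sum_univ_four]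
  | three c r =>
    refine ⟨!![1, 0, 0, -((r : ℂ) * (c : ℂ) ^ 2); 0, 1, 0, 0; 0, 0, 1, 0; 0, 0, 0, 1], ?_⟩
    ext i j
    fin_cases i <;> fin_cases j <;> simp [Q', mul_apply, Fin.sum_univ_four]
  | four c =>
    refine ⟨!![1, -(c : ℂ), -(c : ℂ), -2 * (c : ℂ) ^ 2; 0, 1, 0, (c : ℂ); 0, 0, 1, (c : ℂ);
      0, 0, 0, 1], ?_⟩
    ext i j
    fin_cases i <;> fin_cases j <;> simp [Q', mul_apply, Fin.sum_univ_four]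
    ring
  | five t h0 =>
    have : (t : ℂ) ≠ 0 := by exact_mod_cast h0.ne'
    refine ⟨-Complex.I • !![(t : ℂ), 0, 0, 0; 0, -(t : ℂ)⁻¹, 0, 0; 0, 0, -(t : ℂ)⁻¹, 0;
      0, 0, 0, (t : ℂ)], ?_⟩
    ext i j
    fin_cases i <;> fin_cases j <;> simp [Q', mul_apply, Fin.sum_univ_four] <;>
      field_simp <;> simp
  | six c =>
    refine ⟨-Complex.I • !![1, 0, 0, -(c : ℂ) ^ 2; 0, -1, 0, 0; 0, 0, -1, 0; 0, 0, 0, 1], ?_⟩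
    ext i j
    fin_cases i <;> fin_cases j <;> simp [Q', mul_apply, Fin.sum_univ_four]
    ring
  | seven t h0 =>
    have : (t : ℂ) ≠ 0 := by exact_mod_cast h0.ne'
    let r : ℂ := ((t : ℂ) + (t : ℂ)⁻¹) / 2
    let u : ℂ := ((t : ℂ) - (t : ℂ)⁻¹) / 2
    refine ⟨-Complex.I • !![r, 0, 0, -u; 0, -r, -u, 0; 0, -u, -r, 0; -u, 0, 0, r], ?_⟩
    ext i j
    fin_cases i <;> fin_cases j <;> simp [Q', r, u, mul_apply, Fin.sum_univ_four] <;>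
      field_simp <;> ring_nf <;> simp

theorem X_mul_inv : L.X * L.X⁻¹ = 1 := by
  obtain ⟨Y, hY⟩ := L.exists_Q'_inv
  let e : Fin 2 × Fin 2 ≃ Fin 4 := finProdFinEquiv
  let e' : Fin 2 × Fin 2 ≃ Fin 4 := (Equiv.prodComm _ _).trans finProdFinEquiv
  have h : L.X * Y.submatrix e e' = 1 := by
    have : L.X = L.Q'.submatrix e' e := rfl
    rw [this, submatrix_mul_equiv, hY, submatrix_one_equiv]
  exact mul_nonsing_inv _ (isUnit_det_of_right_inverse h)

theorem X_inv_mul : L.X⁻¹ * L.X = 1 := mul_eq_one_comm.mp L.X_mul_inv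

end LorentzCase
end QuantumMinkowski

namespace QuantumMinkowski

open Matrix
open scoped Kronecker

/-! ### Lorentz pairs -/

/-- A pair of matrices over an algebra `S` that satisfies the relations of `w` and `w̄`, those
obtained by the involution included. Such pairs are the homomorphisms `𝒜 → S`. -/
structure IsLorentzPair (L : LorentzCase) {S : Type} [Ring S] [Algebra ℂ S]
    (w wb : Matrix (Fin 2) (Fin 2) S) : Prop where
  w_E : w * L.E.map (algebraMap ℂ S) * wᵀ = L.E.map (algebraMap ℂ S)
  E'_w : wᵀ * L.E'.map (algebraMap ℂ S) * w = L.E'.map (algebraMap ℂ S)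
  wb_E : wb * L.Eᵀ.map (algebraMap ℂ S) * wbᵀ = L.Eᵀ.map (algebraMap ℂ S)
  E'_wb : wbᵀ * L.E'ᵀ.map (algebraMap ℂ S) * wb = L.E'ᵀ.map (algebraMap ℂ S)
  X_rel : ∀ A B K M, ∑ C, ∑ D, L.X (A, B) (C, D) • (w C K * wb D M) =
    ∑ C, ∑ D, L.X (C, D) (K, M) • (wb A C * w B D)

section entries

variable {S : Type} [Ring S] [Algebra ℂ S]

theorem mul_map_mul_transpose_apply (w : Matrix (Fin 2) (Fin 2) S) (E : Matrix (Fin 2) (Fin 2) ℂ)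
    (A C : Fin 2) : (w * E.map (algebraMap ℂ S) * wᵀ) A C =
      ∑ B, ∑ D, E B D • (w A B * w C D) := by
  simp only [mul_apply, map_apply, transpose_apply, Finset.sum_mul]
  rw [Finset.sum_comm]
  refine Finset.sum_congr rfl fun B _ => Finset.sum_congr rfl fun D _ => ?_
  rw [← Algebra.commutes, mul_assoc, Algebra.smul_def]

theorem transpose_mul_map_mul_apply (w : Matrix (Fin 2) (Fin 2) S) (E : Matrix (Fin 2) (Fin 2) ℂ)
    (B D : Fin 2) : (wᵀ * E.map (algebraMap ℂ S) * w) B D =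
      ∑ A, ∑ C, E A C • (w A B * w C D) := by
  simpa using mul_map_mul_transpose_apply wᵀ E B D

end entries

namespace IsLorentzPair

variable {L : LorentzCase} {S : Type} [Ring S] [Algebra ℂ S] {w wb : Matrix (Fin 2) (Fin 2) S}

theorem relator_eq_zero (h : IsLorentzPair L w wb) {p : S} (hp : p ∈ L.relators w wb) :
    p = 0 := by
  rcases hp with (⟨A, C, rfl⟩ | ⟨B, D, rfl⟩) | ⟨A, B, K, M, rfl⟩
  · rw [← mul_map_mul_transpose_apply, h.w_E, map_apply, sub_self]
  · rw [← transpose_mul_map_mul_apply, h.E'_w, map_apply, sub_self]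
  · rw [h.X_rel, sub_self]

theorem of_relators (h : ∀ p ∈ L.relators w wb, p = 0)
    (hb : wb * L.Eᵀ.map (algebraMap ℂ S) * wbᵀ = L.Eᵀ.map (algebraMap ℂ S))
    (hb' : wbᵀ * L.E'ᵀ.map (algebraMap ℂ S) * wb = L.E'ᵀ.map (algebraMap ℂ S)) :
    IsLorentzPair L w wb where
  w_E := by
    ext A C
    rw [mul_map_mul_transpose_apply, map_apply]
    exact sub_eq_zero.mp (h _ (Or.inl (Or.inl ⟨A, C, rfl⟩)))
  E'_w := by
    ext B D
    rw [transpose_mul_map_mul_apply, map_apply]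
    exact sub_eq_zero.mp (h _ (Or.inl (Or.inr ⟨B, D, rfl⟩)))
  wb_E := hb
  E'_wb := hb'
  X_rel A B K M := sub_eq_zero.mp (h _ (Or.inr ⟨A, B, K, M, rfl⟩))

theorem map (h : IsLorentzPair L w wb) {S' : Type} [Ring S'] [Algebra ℂ S'] (φ : S →ₐ[ℂ] S') :
    IsLorentzPair L (w.map φ) (wb.map φ) := by
  have hc : ∀ M : Matrix (Fin 2) (Fin 2) ℂ,
      (M.map (algebraMap ℂ S)).map φ = M.map (algebraMap ℂ S') := fun M => by
    ext i j; simp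
  constructor
  · have := congrArg (fun M => M.map φ) h.w_E
    simpa only [Matrix.map_mul, hc, transpose_map] using this
  · have := congrArg (fun M => M.map φ) h.E'_w
    simpa only [Matrix.map_mul, hc, transpose_map] using this
  · have := congrArg (fun M => M.map φ) h.wb_E
    simpa only [Matrix.map_mul, hc, transpose_map] using this
  · have := congrArg (fun M => M.map φ) h.E'_wb
    simpa only [Matrix.map_mul, hc, transpose_map] using this
  · intro A B K M
    have := congrArg φ (h.X_rel A B K M)
    simpa only [map_sum, map_smul, map_mul, map_apply] using this

theorem exists_relator_map {S' : Type} [Ring S'] [Algebra ℂ S'] (φ : S →ₐ[ℂ] S') {p : S'}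
    (hp : p ∈ L.relators (fun A B => φ (w A B)) (fun A B => φ (wb A B))) :
    ∃ r ∈ L.relators w wb, φ r = p := by
  rcases hp with (⟨A, C, rfl⟩ | ⟨B, D, rfl⟩) | ⟨A, B, K, M, rfl⟩
  · exact ⟨_, Or.inl (Or.inl ⟨A, C, rfl⟩), by simp⟩
  · exact ⟨_, Or.inl (Or.inr ⟨B, D, rfl⟩), by simp⟩
  · exact ⟨_, Or.inr ⟨A, B, K, M, rfl⟩, by simp⟩

/-- In an algebra with involution, `w̄ = w*` satisfies the relations conjugate to those of `w`. -/
theorem of_relators_star [StarRing S] [StarModule ℂ S] (h : ∀ p ∈ L.relators w wb, p = 0)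
    (hs : ∀ A B, wb A B = star (w A B)) : IsLorentzPair L w wb := by
  refine of_relators h ?_ ?_
  · ext A C
    have := congrArg star (h _ (Or.inl (Or.inl ⟨C, A, rfl⟩)))
    simp only [star_sub, star_sum, star_smul, star_mul, star_zero, ← hs,
      ← algebraMap_star_comm, ← starRingEnd_apply, L.conj_E] at this
    rw [mul_map_mul_transpose_apply, map_apply, transpose_apply, Finset.sum_comm]
    exact sub_eq_zero.mp this
  · ext A C
    have := congrArg star (h _ (Or.inl (Or.inr ⟨C, A, rfl⟩)))
    simp only [star_sub, star_sum, star_smul, star_mul, star_zero, ← hs,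
      ← algebraMap_star_comm, ← starRingEnd_apply, L.conj_E'] at this
    rw [transpose_mul_map_mul_apply, map_apply, transpose_apply, Finset.sum_comm]
    exact sub_eq_zero.mp this

/-- The involution maps the relators to consequences of the relations of a Lorentz pair. -/
theorem lift_star_relator {G : Type} [InvolutiveStar G] {φ : G → S}
    {g gb : Fin 2 → Fin 2 → G} (hg : ∀ A B, star (g A B) = gb A B)
    (h : IsLorentzPair L (of fun A B => φ (g A B)) (of fun A B => φ (gb A B)))
    {p : FreeStar G} (hp : p ∈ L.relators (fun A B => FreeStar.gen (g A B))
      (fun A B => FreeStar.gen (gb A B))) : FreeStar.lift φ (star p) = 0 := by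
  have hgb : ∀ A B, star (gb A B) = g A B := fun A B => by rw [← hg, star_star]
  rcases hp with (⟨A, C, rfl⟩ | ⟨B, D, rfl⟩) | ⟨A, B, K, M, rfl⟩
  · have := congrFun (congrFun h.wb_E C) A
    rw [mul_map_mul_transpose_apply, map_apply, transpose_apply, Finset.sum_comm] at this
    simp only [star_sub, star_sum, star_smul, star_mul, FreeStar.star_gen, hg,
      FreeStar.star_algebraMap, map_sub, map_sum, map_smul, map_mul, FreeStar.lift_gen,
      AlgHom.commutes, ← starRingEnd_apply, L.conj_E, sub_eq_zero]
    exact this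
  · have := congrFun (congrFun h.E'_wb D) B
    rw [transpose_mul_map_mul_apply, map_apply, transpose_apply, Finset.sum_comm] at this
    simp only [star_sub, star_sum, star_smul, star_mul, FreeStar.star_gen, hg,
      FreeStar.star_algebraMap, map_sub, map_sum, map_smul, map_mul, FreeStar.lift_gen,
      AlgHom.commutes, ← starRingEnd_apply, L.conj_E', sub_eq_zero]
    exact this
  · have := h.X_rel B A M K
    simp only [star_sub, star_sum, star_smul, star_mul, FreeStar.star_gen, hg, hgb,
      map_sub, map_sum, map_smul, map_mul, FreeStar.lift_gen,
      ← starRingEnd_apply, L.conj_X, Prod.swap_prod_mk, sub_eq_zero, mul_smul,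
      ← Finset.smul_sum]
    congr 1
    rw [Finset.sum_comm]
    conv_rhs => rw [Finset.sum_comm]
    simpa only [of_apply] using this

end IsLorentzPair

/-- The universal property for homomorphisms that need not respect the involution. -/
def StarPres.liftOfRel {G : Type} [InvolutiveStar G] (P : Set (FreeStar G)) {S : Type} [Ring S]
    [Algebra ℂ S] (φ : G → S) (hP : ∀ p ∈ P, FreeStar.lift φ p = 0)
    (hP' : ∀ p ∈ P, FreeStar.lift φ (star p) = 0) : StarPres P →ₐ[ℂ] S :=
  RingQuot.liftAlgHom ℂ (s := starRel P) ⟨FreeStar.lift φ, by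
    rintro a b ⟨h | h, rfl⟩
    · rw [hP a h, map_zero]
    · have := hP' _ h
      rw [star_star] at this
      rw [this, map_zero]⟩

theorem StarPres.liftOfRel_gen {G : Type} [InvolutiveStar G] (P : Set (FreeStar G)) {S : Type}
    [Ring S] [Algebra ℂ S] (φ : G → S) (hP : ∀ p ∈ P, FreeStar.lift φ p = 0)
    (hP' : ∀ p ∈ P, FreeStar.lift φ (star p) = 0) (g : G) :
    StarPres.liftOfRel P φ hP hP' (StarPres.gen P g) = φ g :=
  (RingQuot.liftAlgHom_mkAlgHom_apply ℂ _ _ _).trans (FreeStar.lift_gen φ g)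

theorem StarPres.algHom_ext {G : Type} [InvolutiveStar G] {P : Set (FreeStar G)} {S : Type}
    [Ring S] [Algebra ℂ S] {φ ψ : StarPres P →ₐ[ℂ] S}
    (h : ∀ g, φ (StarPres.gen P g) = ψ (StarPres.gen P g)) : φ = ψ := by
  apply RingQuot.ringQuot_ext' ℂ
  apply FreeAlgebra.hom_ext
  funext g
  exact h g

namespace PoincareData

variable (D : PoincareData)

/-- The image of a generator of `𝒜` under the homomorphism of a Lorentz pair. -/
def pairGen {S : Type} (w wb : Matrix (Fin 2) (Fin 2) S) : LorentzGen → S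
  | .w A B => w A B
  | .wbar A B => wb A B

variable {D} in
/-- The homomorphism `𝒜 → S` of a Lorentz pair. -/
def lorLift {S : Type} [Ring S] [Algebra ℂ S] {w wb : Matrix (Fin 2) (Fin 2) S}
    (h : IsLorentzPair D.lor w wb) : D.Lor →ₐ[ℂ] S :=
  StarPres.liftOfRel _ (pairGen w wb)
    (fun p hp => h.relator_eq_zero (p := FreeStar.lift (pairGen w wb) p) (by
      have := D.lor.map_relators (FreeStar.lift (pairGen w wb)) hp
      simp only [FreeStar.lift_gen] at this
      exact this))
    (fun p hp => IsLorentzPair.lift_star_relator (G := LorentzGen) (φ := pairGen w wb)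
      (g := LorentzGen.w) (gb := LorentzGen.wbar) (fun _ _ => rfl) (show _ from h) hp)

section
variable {D} {S : Type} [Ring S] [Algebra ℂ S] {w wb : Matrix (Fin 2) (Fin 2) S}

theorem lorLift_wA (h : IsLorentzPair D.lor w wb) (A B : Fin 2) :
    lorLift h (D.wA A B) = w A B :=
  StarPres.liftOfRel_gen _ _ _ _ _

theorem lorLift_wbarA (h : IsLorentzPair D.lor w wb) (A B : Fin 2) :
    lorLift h (D.wbarA A B) = wb A B :=
  StarPres.liftOfRel_gen _ _ _ _ _

theorem lor_algHom_ext {φ ψ : D.Lor →ₐ[ℂ] S} (h : ∀ A B, φ (D.wA A B) = ψ (D.wA A B))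
    (h' : ∀ A B, φ (D.wbarA A B) = ψ (D.wbarA A B)) : φ = ψ :=
  StarPres.algHom_ext (by rintro (⟨A, B⟩ | ⟨A, B⟩); exacts [h A B, h' A B])

end

theorem isLorentzPair_A : IsLorentzPair D.lor (of D.wA) (of D.wbarA) := by
  refine IsLorentzPair.of_relators_star (S := D.Lor) (fun p hp => ?_) fun A B => ?_
  · obtain ⟨r, hr, rfl⟩ := IsLorentzPair.exists_relator_map (StarPres.mk _) hp
    exact StarPres.mk_eq_zero _ hr
  · exact (StarPres.star_gen _ (LorentzGen.w A B)).symm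

theorem isLorentzPair_B : IsLorentzPair D.lor (of D.w) (of D.wbar) := by
  have h := (isLorentzPair_A D).map D.incl
  have h1 : (of D.wA).map D.incl = of D.w := by
    ext A B; exact StarPres.lift_gen _ _ _ _ _
  have h2 : (of D.wbarA).map D.incl = of D.wbar := by
    ext A B; exact StarPres.lift_gen _ _ _ _ _
  rwa [h1, h2] at h

end PoincareData
end QuantumMinkowski

namespace QuantumMinkowski

open Matrix
open scoped Kronecker

/-! ### Products of Lorentz pairs -/

theorem transpose_mul_of_commute {S : Type} [Ring S] {l m n : Type} [Fintype m]
    (u : Matrix l m S) (v : Matrix m n S)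
    (h : ∀ i j k k', Commute (u i j) (v k k')) : (u * v)ᵀ = vᵀ * uᵀ := by
  ext i j
  simp only [transpose_apply, mul_apply]
  exact Finset.sum_congr rfl fun k _ => (h _ _ _ _).eq

theorem kronecker_mul_of_commute {S : Type} [Ring S] {l m n l' m' n' : Type}
    [Fintype m] [Fintype m']
    (u : Matrix l m S) (v : Matrix m n S) (u' : Matrix l' m' S) (v' : Matrix m' n' S)
    (h : ∀ i j k k', Commute (u' i j) (v k k')) :
    (u * v) ⊗ₖ (u' * v') = (u ⊗ₖ u') * (v ⊗ₖ v') := by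
  ext ⟨i, i'⟩ ⟨j, j'⟩
  simp only [kroneckerMap_apply, mul_apply, Fintype.sum_prod_type, Finset.sum_mul_sum]
  refine Finset.sum_congr rfl fun a _ => Finset.sum_congr rfl fun b _ => ?_
  rw [mul_assoc, mul_assoc, ← mul_assoc (v a j), ← (h i' b a j).eq, mul_assoc]

section products

variable {S : Type} [Ring S] [Algebra ℂ S]

theorem transpose_map_mul {l m n : Type} [Fintype m] (E : Matrix l m ℂ) (v : Matrix m n S) :
    (E.map (algebraMap ℂ S) * v)ᵀ = vᵀ * Eᵀ.map (algebraMap ℂ S) :=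
  transpose_mul_of_commute _ _ fun _ _ _ _ => Algebra.commutes _ _

theorem transpose_mul_map {l m n : Type} [Fintype m] (v : Matrix l m S) (E : Matrix m n ℂ) :
    (v * E.map (algebraMap ℂ S))ᵀ = Eᵀ.map (algebraMap ℂ S) * vᵀ :=
  transpose_mul_of_commute _ _ fun _ _ _ _ => (Algebra.commutes _ _).symm

theorem map_algebraMap_mul {l m n : Type} [Fintype m] (E : Matrix l m ℂ) (F : Matrix m n ℂ) :
    (E * F).map (algebraMap ℂ S) = E.map (algebraMap ℂ S) * F.map (algebraMap ℂ S) :=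
  Matrix.map_mul

theorem E_mul_E'_map (L : LorentzCase) :
    L.E.map (algebraMap ℂ S) * L.E'.map (algebraMap ℂ S) = 1 := by
  rw [← map_algebraMap_mul, L.E_mul_E', Matrix.map_one _ (map_zero _) (map_one _)]

theorem E'_mul_E_map (L : LorentzCase) :
    L.E'.map (algebraMap ℂ S) * L.E.map (algebraMap ℂ S) = 1 := by
  rw [← map_algebraMap_mul, L.E'_mul_E, Matrix.map_one _ (map_zero _) (map_one _)]

theorem E_mul_E'_transpose_map (L : LorentzCase) :
    L.Eᵀ.map (algebraMap ℂ S) * L.E'ᵀ.map (algebraMap ℂ S) = 1 := by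
  rw [← map_algebraMap_mul, ← transpose_mul, L.E'_mul_E, transpose_one,
    Matrix.map_one _ (map_zero _) (map_one _)]

theorem mul_E_of_commute (E : Matrix (Fin 2) (Fin 2) ℂ) (u v : Matrix (Fin 2) (Fin 2) S)
    (h : ∀ i j k k', Commute (u i j) (v k k')) :
    (u * v) * E.map (algebraMap ℂ S) * (u * v)ᵀ =
      u * (v * E.map (algebraMap ℂ S) * vᵀ) * uᵀ := by
  rw [transpose_mul_of_commute u v h]
  simp only [Matrix.mul_assoc]

theorem X_rel_iff (X : Matrix (Fin 2 × Fin 2) (Fin 2 × Fin 2) ℂ)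
    (w wb : Matrix (Fin 2) (Fin 2) S) :
    (∀ A B K M, ∑ C, ∑ D, X (A, B) (C, D) • (w C K * wb D M) =
      ∑ C, ∑ D, X (C, D) (K, M) • (wb A C * w B D)) ↔
    X.map (algebraMap ℂ S) * (w ⊗ₖ wb) = (wb ⊗ₖ w) * X.map (algebraMap ℂ S) := by
  rw [← Matrix.ext_iff]
  simp only [Prod.forall, mul_apply, Fintype.sum_prod_type, kroneckerMap_apply, map_apply,
    ← Algebra.smul_def, ← Algebra.commutes]

theorem X_rel_mul (X : Matrix (Fin 2 × Fin 2) (Fin 2 × Fin 2) ℂ)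
    {u ub v vb : Matrix (Fin 2) (Fin 2) S}
    (hu : X.map (algebraMap ℂ S) * (u ⊗ₖ ub) = (ub ⊗ₖ u) * X.map (algebraMap ℂ S))
    (hv : X.map (algebraMap ℂ S) * (v ⊗ₖ vb) = (vb ⊗ₖ v) * X.map (algebraMap ℂ S))
    (h : ∀ i j k k', Commute (ub i j) (v k k')) (h' : ∀ i j k k', Commute (u i j) (vb k k')) :
    X.map (algebraMap ℂ S) * ((u * v) ⊗ₖ (ub * vb)) =
      ((ub * vb) ⊗ₖ (u * v)) * X.map (algebraMap ℂ S) := by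
  rw [kronecker_mul_of_commute _ _ _ _ h, kronecker_mul_of_commute _ _ _ _ h', ← Matrix.mul_assoc,
    hu, Matrix.mul_assoc, hv, Matrix.mul_assoc]

end products

/-- Entrywise complex conjugation of a matrix of matrices. -/
def conj2 {n : Type} [Fintype n] [DecidableEq n] (w : Matrix (Fin 2) (Fin 2) (Matrix n n ℂ)) :
    Matrix (Fin 2) (Fin 2) (Matrix n n ℂ) :=
  w.map (starRingEnd ℂ).mapMatrix

theorem conj2_mul {n : Type} [Fintype n] [DecidableEq n]
    (w v : Matrix (Fin 2) (Fin 2) (Matrix n n ℂ)) : conj2 (w * v) = conj2 w * conj2 v :=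
  Matrix.map_mul

theorem conj2_map {n : Type} [Fintype n] [DecidableEq n] (E : Matrix (Fin 2) (Fin 2) ℂ)
    (hE : ∀ A B, (starRingEnd ℂ) (E A B) = E A B) :
    conj2 (E.map (algebraMap ℂ (Matrix n n ℂ))) = E.map (algebraMap ℂ _) := by
  ext A B i j
  simp only [conj2, map_apply, RingHom.mapMatrix_apply, algebraMap_matrix_apply]
  split_ifs
  · exact hE A B
  · exact map_zero _

/-- In a matrix algebra, a Lorentz pair is determined by `w`, subject to the first relation, since
`w̄` is the inverse of the complex conjugate of `w`; only the mixed relation is left to check. -/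
theorem isLorentzPair_of_conj (L : LorentzCase) {n : Type} [Fintype n] [DecidableEq n]
    {w wb : Matrix (Fin 2) (Fin 2) (Matrix n n ℂ)}
    (hE : w * L.E.map (algebraMap ℂ _) * wᵀ = L.E.map (algebraMap ℂ _))
    (hX : L.X.map (algebraMap ℂ _) * (w ⊗ₖ wb) = (wb ⊗ₖ w) * L.X.map (algebraMap ℂ _))
    (hc : conj2 w * wb = 1) : IsLorentzPair L w wb := by
  have key : ∀ v : Matrix (Fin 2) (Fin 2) (Matrix n n ℂ),
      v * L.E.map (algebraMap ℂ _) * vᵀ = L.E.map (algebraMap ℂ _) →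
      v * (L.E.map (algebraMap ℂ _) * vᵀ * L.E'.map (algebraMap ℂ _)) = 1 := fun v hv => by
    rw [← Matrix.mul_assoc, ← Matrix.mul_assoc, hv, E_mul_E'_map]
  have key' : ∀ v : Matrix (Fin 2) (Fin 2) (Matrix n n ℂ),
      v * L.E.map (algebraMap ℂ _) * vᵀ = L.E.map (algebraMap ℂ _) →
      vᵀ * L.E'.map (algebraMap ℂ _) * v = L.E'.map (algebraMap ℂ _) := fun v hv => by
    have h := mul_eq_one_comm.mp (key v hv)
    have := congrArg (fun M => L.E'.map (algebraMap ℂ _) * M) h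
    simpa only [← Matrix.mul_assoc, E'_mul_E_map, Matrix.one_mul, Matrix.mul_one] using this
  have hEc : conj2 w * L.E.map (algebraMap ℂ _) * (conj2 w)ᵀ = L.E.map (algebraMap ℂ _) := by
    have := congrArg conj2 hE
    rwa [conj2_mul, conj2_mul, conj2_map _ L.conj_E] at this
  have hwb : wb = L.E.map (algebraMap ℂ _) * (conj2 w)ᵀ * L.E'.map (algebraMap ℂ _) :=
    (left_inv_eq_right_inv (mul_eq_one_comm.mp (key _ hEc)) hc).symm
  have hwbT : wbᵀ = L.E'ᵀ.map (algebraMap ℂ _) * conj2 w * L.Eᵀ.map (algebraMap ℂ _) := by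
    rw [hwb, transpose_mul_map, transpose_map_mul, transpose_transpose, Matrix.mul_assoc]
  refine ⟨hE, key' w hE, ?_, ?_, (X_rel_iff _ _ _).mpr hX⟩
  · rw [hwbT, hwb]
    calc _ = L.E.map (algebraMap ℂ (Matrix n n ℂ)) * ((conj2 w)ᵀ * (L.E'.map (algebraMap ℂ _) *
          (L.Eᵀ.map (algebraMap ℂ _) * L.E'ᵀ.map (algebraMap ℂ _))) * conj2 w) *
          L.Eᵀ.map (algebraMap ℂ _) := by simp only [Matrix.mul_assoc]
      _ = _ := by
        rw [E_mul_E'_transpose_map, Matrix.mul_one, key' _ hEc, E_mul_E'_map, Matrix.one_mul]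
  · rw [hwbT, hwb]
    calc _ = L.E'ᵀ.map (algebraMap ℂ (Matrix n n ℂ)) * (conj2 w * ((L.Eᵀ.map (algebraMap ℂ _) *
          L.E'ᵀ.map (algebraMap ℂ _)) * L.E.map (algebraMap ℂ _)) * (conj2 w)ᵀ) *
          L.E'.map (algebraMap ℂ _) := by simp only [Matrix.mul_assoc]
      _ = _ := by
        rw [E_mul_E'_transpose_map, Matrix.one_mul, hEc, Matrix.mul_assoc, E_mul_E'_map,
          Matrix.mul_one]

/-! ### Tensor legs -/

section legs

variable {S : Type} [Ring S] [Algebra ℂ S] (m n : Type) [Fintype m] [DecidableEq m] [Fintype n]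
  [DecidableEq n]

/-- `u ↦ u ⊗ 1`. -/
def legL : Matrix m m S →ₐ[ℂ] Matrix (m × n) (m × n) S :=
  AlgHom.ofLinearMap
    { toFun := fun u => of fun p r => if p.2 = r.2 then u p.1 r.1 else 0
      map_add' := fun u v => by ext p r; simp only [of_apply, Matrix.add_apply]; split_ifs <;> simp
      map_smul' := fun c u => by
        ext p r; simp only [of_apply, Matrix.smul_apply, RingHom.id_apply]; split_ifs <;> simp }
    (by
      ext ⟨a, b⟩ ⟨c, d⟩
      simp only [LinearMap.coe_mk, AddHom.coe_mk, of_apply, one_apply, Prod.mk.injEq]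
      split_ifs <;> tauto)
    (fun u v => by
      ext ⟨a, b⟩ ⟨c, d⟩
      simp [mul_apply, Fintype.sum_prod_type])

/-- `v ↦ 1 ⊗ v`. -/
def legR : Matrix n n S →ₐ[ℂ] Matrix (m × n) (m × n) S :=
  AlgHom.ofLinearMap
    { toFun := fun u => of fun p r => if p.1 = r.1 then u p.2 r.2 else 0
      map_add' := fun u v => by ext p r; simp only [of_apply, Matrix.add_apply]; split_ifs <;> simp
      map_smul' := fun c u => by
        ext p r; simp only [of_apply, Matrix.smul_apply, RingHom.id_apply]; split_ifs <;> simp }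
    (by
      ext ⟨a, b⟩ ⟨c, d⟩
      simp only [LinearMap.coe_mk, AddHom.coe_mk, of_apply, one_apply, Prod.mk.injEq]
      split_ifs <;> tauto)
    (fun u v => by
      ext ⟨a, b⟩ ⟨c, d⟩
      simp [mul_apply, Fintype.sum_prod_type])

variable {m n}

theorem legL_apply (u : Matrix m m S) (p r : m × n) :
    legL m n u p r = if p.2 = r.2 then u p.1 r.1 else 0 := rfl

theorem legR_apply (u : Matrix n n S) (p r : m × n) :
    legR m n u p r = if p.1 = r.1 then u p.2 r.2 else 0 := rfl

theorem legL_mul_legR (u : Matrix m m S) (v : Matrix n n S) :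
    legL m n u * legR m n v = u ⊗ₖ v := by
  ext ⟨a, b⟩ ⟨c, d⟩
  simp [mul_apply, Fintype.sum_prod_type, legL_apply, legR_apply]

theorem legR_mul_legL (u : Matrix m m S) (v : Matrix n n S)
    (h : ∀ i j k k', Commute (u i j) (v k k')) :
    legR m n v * legL m n u = u ⊗ₖ v := by
  ext ⟨a, b⟩ ⟨c, d⟩
  simp [mul_apply, Fintype.sum_prod_type, legL_apply, legR_apply, (h _ _ _ _).eq]

theorem legL_commute_legR (u : Matrix m m S) (v : Matrix n n S)
    (h : ∀ i j k k', Commute (u i j) (v k k')) :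
    Commute (legL m n u) (legR m n v) := by
  rw [commute_iff_eq, legL_mul_legR, legR_mul_legL u v h]

end legs

end QuantumMinkowski

namespace QuantumMinkowski

open Matrix
open scoped Kronecker

/-! ### Spinor representations -/

section threeLegs

/-- `M ⊗ 1` on three tensor factors. -/
def leg12 (M : Matrix (Fin 2 × Fin 2) (Fin 2 × Fin 2) ℂ) :
    Matrix (Fin 2 × Fin 2 × Fin 2) (Fin 2 × Fin 2 × Fin 2) ℂ :=
  of fun p r => if p.2.2 = r.2.2 then M (p.1, p.2.1) (r.1, r.2.1) else 0

/-- `1 ⊗ M` on three tensor factors. -/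
def leg23 (M : Matrix (Fin 2 × Fin 2) (Fin 2 × Fin 2) ℂ) :
    Matrix (Fin 2 × Fin 2 × Fin 2) (Fin 2 × Fin 2 × Fin 2) ℂ :=
  of fun p r => if p.1 = r.1 then M p.2 r.2 else 0

variable (M N P : Matrix (Fin 2 × Fin 2) (Fin 2 × Fin 2) ℂ)

theorem leg12_mul : leg12 (M * N) = leg12 M * leg12 N := by
  ext ⟨a, b, c⟩ ⟨d, e, f⟩
  simp [leg12, mul_apply, Fintype.sum_prod_type]

theorem leg23_mul : leg23 (M * N) = leg23 M * leg23 N := by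
  ext ⟨a, b, c⟩ ⟨d, e, f⟩
  simp [leg23, mul_apply, Fintype.sum_prod_type]

theorem leg12_one : leg12 1 = 1 := by
  ext ⟨a, b, c⟩ ⟨d, e, f⟩
  simp only [leg12, of_apply, one_apply, Prod.mk.injEq]
  split_ifs <;> tauto

theorem leg23_one : leg23 1 = 1 := by
  ext ⟨a, b, c⟩ ⟨d, e, f⟩
  simp only [leg23, of_apply, one_apply, Prod.mk.injEq]
  split_ifs <;> tauto

theorem leg23_mul_leg12_mul_leg23_apply (a A B K J d : Fin 2) :
    (leg23 M * leg12 N * leg23 P) (a, A, B) (K, J, d) =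
      ∑ C, ∑ D, ∑ e, M (A, B) (C, D) * N (a, C) (K, e) * P (e, D) (J, d) := by
  simp only [leg12, leg23, mul_apply, Fintype.sum_prod_type, of_apply, ite_mul, mul_ite, zero_mul,
    mul_zero, Finset.sum_ite_irrel, Finset.sum_const_zero, Finset.sum_ite_eq, Finset.sum_ite_eq',
    Finset.mem_univ, if_true]
  simp only [Fin.sum_univ_two]
  ring

theorem leg12_mul_leg23_mul_leg12_apply (a A B K J d : Fin 2) :
    (leg12 M * leg23 N * leg12 P) (a, A, B) (K, J, d) =
      ∑ C, ∑ D, ∑ e, M (a, A) (C, e) * N (e, B) (D, d) * P (C, D) (K, J) := by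
  simp only [leg12, leg23, mul_apply, Fintype.sum_prod_type, of_apply, ite_mul, mul_ite, zero_mul,
    mul_zero, Finset.sum_ite_irrel, Finset.sum_const_zero, Finset.sum_ite_eq, Finset.sum_ite_eq',
    Finset.mem_univ, if_true]
  simp only [Fin.sum_univ_two]
  ring

/-- The mixed relation for the pair `(blk N, blk P)` is a braid equation on three spinor factors. -/
theorem X_rel_blk_iff :
    M.map (algebraMap ℂ _) * (blk N ⊗ₖ blk P) = (blk P ⊗ₖ blk N) * M.map (algebraMap ℂ _) ↔
    leg23 M * leg12 N * leg23 P = leg12 P * leg23 N * leg12 M := by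
  rw [← X_rel_iff, ← Matrix.ext_iff]
  simp only [Prod.forall, leg23_mul_leg12_mul_leg23_apply, leg12_mul_leg23_mul_leg12_apply]
  constructor
  · intro h a A B K J d
    have := congrFun (congrFun (h A B K J) a) d
    simp only [Matrix.sum_apply, Matrix.smul_apply, mul_apply, blk, of_apply, smul_eq_mul] at this
    simp only [Fin.sum_univ_two] at this ⊢
    linear_combination this
  · intro h A B K J
    ext a d
    have := h a A B K J d
    simp only [Matrix.sum_apply, Matrix.smul_apply, mul_apply, blk, of_apply, smul_eq_mul]
    simp only [Fin.sum_univ_two] at this ⊢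
    linear_combination this

theorem blk_E_iff (E : Matrix (Fin 2) (Fin 2) ℂ) :
    blk M * E.map (algebraMap ℂ _) * (blk M)ᵀ = E.map (algebraMap ℂ _) ↔
    ∀ A C a d, ∑ B, ∑ D, ∑ e, M (a, A) (B, e) * E B D * M (e, C) (D, d) =
      E A C * if a = d then 1 else 0 := by
  have : ∀ A C a d, (blk M * E.map (algebraMap ℂ (Matrix (Fin 2) (Fin 2) ℂ)) * (blk M)ᵀ) A C a d =
      ∑ B, ∑ D, ∑ e, M (a, A) (B, e) * E B D * M (e, C) (D, d) := fun A C a d => by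
    rw [mul_map_mul_transpose_apply]
    simp only [Matrix.sum_apply, Matrix.smul_apply, mul_apply, blk, of_apply, smul_eq_mul]
    simp only [Fin.sum_univ_two]
    ring
  have h2 : ∀ A C a d, (E.map (algebraMap ℂ (Matrix (Fin 2) (Fin 2) ℂ))) A C a d =
      E A C * if a = d then 1 else 0 := fun A C a d => by
    simp [algebraMap_matrix_apply]
  rw [← Matrix.ext_iff]
  simp only [← Matrix.ext_iff, this, h2]

theorem blk_E'_iff (E' : Matrix (Fin 2) (Fin 2) ℂ) :
    (blk M)ᵀ * E'.map (algebraMap ℂ _) * blk M = E'.map (algebraMap ℂ _) ↔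
    ∀ B D a d, ∑ A, ∑ C, ∑ e, E' A C * M (a, A) (B, e) * M (e, C) (D, d) =
      E' B D * if a = d then 1 else 0 := by
  have : ∀ B D a d, ((blk M)ᵀ * E'.map (algebraMap ℂ (Matrix (Fin 2) (Fin 2) ℂ)) * blk M) B D a d =
      ∑ A, ∑ C, ∑ e, E' A C * M (a, A) (B, e) * M (e, C) (D, d) := fun A C a d => by
    rw [transpose_mul_map_mul_apply]
    simp only [Matrix.sum_apply, Matrix.smul_apply, mul_apply, blk, of_apply, smul_eq_mul]
    simp only [Fin.sum_univ_two]
    ring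
  have h2 : ∀ A C a d, (E'.map (algebraMap ℂ (Matrix (Fin 2) (Fin 2) ℂ))) A C a d =
      E' A C * if a = d then 1 else 0 := fun A C a d => by
    simp [algebraMap_matrix_apply]
  rw [← Matrix.ext_iff]
  simp only [← Matrix.ext_iff, this, h2]

end threeLegs

namespace LorentzCase

variable (L : LorentzCase)

theorem blk_X_E : blk L.X * L.E.map (algebraMap ℂ _) * (blk L.X)ᵀ = L.E.map (algebraMap ℂ _) :=
  (blk_E_iff _ _).mpr L.X_E

theorem blk_X_E' :
    (blk L.X)ᵀ * L.E'.map (algebraMap ℂ _) * blk L.X = L.E'.map (algebraMap ℂ _) := by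
  have h : blk L.X * (L.E.map (algebraMap ℂ _) * (blk L.X)ᵀ * L.E'.map (algebraMap ℂ _)) = 1 := by
    rw [← Matrix.mul_assoc, ← Matrix.mul_assoc, blk_X_E, E_mul_E'_map]
  have := congrArg (fun M => L.E'.map (algebraMap ℂ _) * M) (mul_eq_one_comm.mp h)
  simpa only [← Matrix.mul_assoc, E'_mul_E_map, Matrix.one_mul, Matrix.mul_one] using this

/-- The rank one matrix `E E'`. -/
def EE : Matrix (Fin 2 × Fin 2) (Fin 2 × Fin 2) ℂ :=
  of fun p r => L.E p.1 p.2 * L.E' r.1 r.2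

theorem E'_dot_E : ∑ A, ∑ B, L.E' A B * L.E A B = -2 * L.q := by
  cases L <;> simp [E, E', q] <;> norm_num

theorem EE_mul_EE : L.EE * L.EE = (-2 * L.q) • L.EE := by
  ext p r
  rw [← E'_dot_E]
  simp only [EE, mul_apply, Fintype.sum_prod_type, of_apply, Matrix.smul_apply, smul_eq_mul,
    Fin.sum_univ_two]
  ring

/-- `X` moves `E E'` from two tensor factors to the neighbouring ones. -/
theorem leg23_EE_mul_X :
    leg23 L.EE * (leg12 L.X * leg23 L.X) = leg12 L.X * leg23 L.X * leg12 L.EE := by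
  have h1 := (blk_E_iff _ _).mp L.blk_X_E
  have h2 := (blk_E'_iff _ _).mp L.blk_X_E'
  ext ⟨a, A, B⟩ ⟨K, J, d⟩
  trans L.E A B * L.E' K J * if a = d then 1 else 0
  · rw [mul_assoc, ← h2 K J a d]
    simp only [leg12, leg23, EE, mul_apply, Fintype.sum_prod_type, of_apply, ite_mul, mul_ite,
      zero_mul, mul_zero, Finset.sum_ite_irrel, Finset.sum_const_zero, Finset.sum_ite_eq,
      Finset.sum_ite_eq', Finset.mem_univ, if_true]
    simp only [Fin.sum_univ_two]
    ring
  · rw [mul_right_comm, ← h1 A B a d]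
    simp only [leg12, leg23, EE, mul_apply, Fintype.sum_prod_type, of_apply, ite_mul, mul_ite,
      zero_mul, mul_zero, Finset.sum_ite_irrel, Finset.sum_const_zero, Finset.sum_ite_eq,
      Finset.sum_ite_eq', Finset.mem_univ, if_true]
    simp only [Fin.sum_univ_two]
    ring

end LorentzCase

end QuantumMinkowski

namespace QuantumMinkowski

open Matrix
open scoped Kronecker

/-! ### The matrices `L` and `L̃` -/

/-- Complex conjugation followed by the exchange of the two tensor factors. -/
def flipConj (M : Matrix (Fin 2 × Fin 2) (Fin 2 × Fin 2) ℂ) :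
    Matrix (Fin 2 × Fin 2) (Fin 2 × Fin 2) ℂ :=
  of fun p r => (starRingEnd ℂ) (M p.swap r.swap)

/-- Complex conjugation followed by the reversal of the three tensor factors. -/
def revConj (M : Matrix (Fin 2 × Fin 2 × Fin 2) (Fin 2 × Fin 2 × Fin 2) ℂ) :
    Matrix (Fin 2 × Fin 2 × Fin 2) (Fin 2 × Fin 2 × Fin 2) ℂ :=
  of fun p r => (starRingEnd ℂ) (M (p.2.2, p.2.1, p.1) (r.2.2, r.2.1, r.1))

theorem revConj_mul (M N : Matrix (Fin 2 × Fin 2 × Fin 2) (Fin 2 × Fin 2 × Fin 2) ℂ) :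
    revConj (M * N) = revConj M * revConj N := by
  ext ⟨a, b, c⟩ ⟨d, e, f⟩
  simp only [revConj, of_apply, mul_apply, Fintype.sum_prod_type, Fin.sum_univ_two, map_add,
    map_mul]
  ring

theorem revConj_leg12 (M : Matrix (Fin 2 × Fin 2) (Fin 2 × Fin 2) ℂ) :
    revConj (leg12 M) = leg23 (flipConj M) := by
  ext ⟨a, b, c⟩ ⟨d, e, f⟩
  simp only [revConj, leg12, leg23, flipConj, of_apply, Prod.swap_prod_mk]
  split_ifs <;> simp

theorem revConj_leg23 (M : Matrix (Fin 2 × Fin 2) (Fin 2 × Fin 2) ℂ) :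
    revConj (leg23 M) = leg12 (flipConj M) := by
  ext ⟨a, b, c⟩ ⟨d, e, f⟩
  simp only [revConj, leg12, leg23, flipConj, of_apply, Prod.swap_prod_mk]
  split_ifs <;> simp

theorem leg12_smul (c : ℂ) (M : Matrix (Fin 2 × Fin 2) (Fin 2 × Fin 2) ℂ) :
    leg12 (c • M) = c • leg12 M := by
  ext p r; simp [leg12]

theorem leg23_smul (c : ℂ) (M : Matrix (Fin 2 × Fin 2) (Fin 2 × Fin 2) ℂ) :
    leg23 (c • M) = c • leg23 M := by
  ext p r; simp [leg23]

theorem leg12_add (M N : Matrix (Fin 2 × Fin 2) (Fin 2 × Fin 2) ℂ) :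
    leg12 (M + N) = leg12 M + leg12 N := by
  ext p r; simp only [leg12, of_apply, Matrix.add_apply]; split_ifs <;> simp

theorem leg23_add (M N : Matrix (Fin 2 × Fin 2) (Fin 2 × Fin 2) ℂ) :
    leg23 (M + N) = leg23 M + leg23 N := by
  ext p r; simp only [leg23, of_apply, Matrix.add_apply]; split_ifs <;> simp

theorem LorentzCase.flipConj_X (L : LorentzCase) : flipConj L.X = L.q • L.X := by
  ext p r
  simp [flipConj, L.conj_X]

namespace PoincareData

variable (D : PoincareData)

theorem Lm_eq : D.Lm = (((D.s : ℤ) : ℂ) * D.lor.qHalf) • (1 + D.lor.q • D.lor.EE) := rfl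

theorem s_mul_s : ((D.s : ℤ) : ℂ) * ((D.s : ℤ) : ℂ) = 1 := by
  rcases Int.units_eq_one_or D.s with h | h <;> simp [h]

/-- `(1 + q E E')² = 1`, because `E' E = -2q`. -/
theorem Lm_mul_Lm : D.Lm * D.Lm = D.lor.q • 1 := by
  have h1 := D.s_mul_s
  have h2 := D.lor.qHalf_mul_qHalf
  have h3 := D.lor.q_mul_q
  rw [Lm_eq, smul_mul_smul_comm, add_mul, mul_add, mul_add, one_mul, mul_one, one_mul,
    smul_mul_smul_comm, LorentzCase.EE_mul_EE, smul_smul]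
  have : (((D.s : ℤ) : ℂ) * D.lor.qHalf * (((D.s : ℤ) : ℂ) * D.lor.qHalf)) = D.lor.q := by
    linear_combination (D.lor.qHalf * D.lor.qHalf) * h1 + h2
  rw [this]
  have h4 : D.lor.q * D.lor.q * (-2 * D.lor.q) = -2 * D.lor.q := by
    linear_combination (-2 * D.lor.q) * h3
  rw [h4]
  congr 1
  module

theorem conj_Lm (p r : Fin 2 × Fin 2) :
    (starRingEnd ℂ) (D.Lm p r) = D.lor.q * D.Lm p r := by
  have h1 : (starRingEnd ℂ) ((1 : Matrix (Fin 2 × Fin 2) (Fin 2 × Fin 2) ℂ) p r) =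
      (1 : Matrix (Fin 2 × Fin 2) (Fin 2 × Fin 2) ℂ) p r := by
    rw [one_apply]; split_ifs <;> simp
  simp only [Lm_eq, Matrix.smul_apply, Matrix.add_apply, smul_eq_mul, map_mul, map_add,
    LorentzCase.EE, of_apply, D.lor.conj_q, D.lor.conj_qHalf, D.lor.conj_E, D.lor.conj_E',
    map_intCast, h1]
  ring

theorem flipConj_Lm : flipConj D.Lm = D.Lt := by
  ext p r
  simp [flipConj, Lt, D.conj_Lm]

theorem Lt_mul_Lt : D.Lt * D.Lt = D.lor.q • 1 := by
  have h := D.Lm_mul_Lm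
  have e : D.Lt = D.lor.q • D.Lm.submatrix (Equiv.prodComm _ _) (Equiv.prodComm _ _) := rfl
  rw [e, smul_mul_smul_comm, submatrix_mul_equiv, h, D.lor.q_mul_q, one_smul]
  ext p r
  simp only [submatrix_apply, Matrix.smul_apply, one_apply, EmbeddingLike.apply_eq_iff_eq]

theorem leg23_Lm_mul_X : leg23 D.Lm * (leg12 D.Xm * leg23 D.Xm) =
    leg12 D.Xm * leg23 D.Xm * leg12 D.Lm := by
  have h := D.lor.leg23_EE_mul_X
  simp only [Lm_eq, Xm, leg12_smul, leg23_smul, leg12_add, leg23_add, leg12_one, leg23_one,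
    Matrix.smul_mul, Matrix.mul_smul, Matrix.add_mul, Matrix.mul_add, Matrix.one_mul,
    Matrix.mul_one, h]

/-- The mixed relation for `w ↦ L`, `w̄ ↦ X⁻¹`: `L`, a polynomial in `E E'`, can be moved through
`X`. -/
theorem X_rel_Lm_Xinv : D.Xm.map (algebraMap ℂ _) * (blk D.Lm ⊗ₖ blk D.Xm⁻¹) =
    (blk D.Xm⁻¹ ⊗ₖ blk D.Lm) * D.Xm.map (algebraMap ℂ _) := by
  rw [X_rel_blk_iff]
  have h12 : leg12 D.Xm⁻¹ * leg12 D.Xm = 1 := by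
    rw [← leg12_mul]; exact (congrArg leg12 D.lor.X_inv_mul).trans leg12_one
  have h23 : leg23 D.Xm * leg23 D.Xm⁻¹ = 1 := by
    rw [← leg23_mul]; exact (congrArg leg23 D.lor.X_mul_inv).trans leg23_one
  calc _ = leg12 D.Xm⁻¹ * (leg12 D.Xm * leg23 D.Xm * leg12 D.Lm) * leg23 D.Xm⁻¹ := by
        simp only [← mul_assoc, h12, one_mul]
    _ = _ := by
        rw [← D.leg23_Lm_mul_X]
        simp only [mul_assoc, h23, mul_one]

/-- The mixed relation for `w ↦ X`, `w̄ ↦ L̃`; it is the complex conjugate of the one for `L` and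
`X⁻¹`, with the tensor factors reversed. -/
theorem X_rel_Xm_Lt : D.Xm.map (algebraMap ℂ _) * (blk D.Xm ⊗ₖ blk D.Lt) =
    (blk D.Lt ⊗ₖ blk D.Xm) * D.Xm.map (algebraMap ℂ _) := by
  rw [X_rel_blk_iff]
  have h := congrArg revConj D.leg23_Lm_mul_X
  simp only [revConj_mul, revConj_leg12, revConj_leg23, flipConj_Lm, Xm,
    LorentzCase.flipConj_X, leg12_smul, leg23_smul, Matrix.smul_mul, Matrix.mul_smul, smul_smul,
    D.lor.q_mul_q, one_smul] at h
  rw [← mul_assoc] at h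
  exact h.symm

theorem blk_Lm_E : blk D.Lm * D.lor.E.map (algebraMap ℂ _) * (blk D.Lm)ᵀ =
    D.lor.E.map (algebraMap ℂ _) := by
  rw [blk_E_iff]
  have key : ∀ A C a d, ∑ B, ∑ F, ∑ e, (1 + D.lor.q • D.lor.EE) (a, A) (B, e) * D.lor.E B F *
      (1 + D.lor.q • D.lor.EE) (e, C) (F, d) =
        D.lor.q * (D.lor.E A C * if a = d then 1 else 0) := by
    intro A C a d
    simp only [Matrix.add_apply, Matrix.smul_apply, LorentzCase.EE, of_apply, one_apply,
      Prod.mk.injEq, Fin.sum_univ_two]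
    generalize D.lor = L
    cases L <;> fin_cases A <;> fin_cases C <;> fin_cases a <;> fin_cases d <;>
      simp [LorentzCase.E, LorentzCase.E', LorentzCase.q]
  intro A C a d
  have h := key A C a d
  have h1 := D.s_mul_s
  have h2 := D.lor.qHalf_mul_qHalf
  have h3 := D.lor.q_mul_q
  have : ∀ B F e, D.Lm (a, A) (B, e) * D.lor.E B F * D.Lm (e, C) (F, d) =
      D.lor.q * ((1 + D.lor.q • D.lor.EE) (a, A) (B, e) * D.lor.E B F *
      (1 + D.lor.q • D.lor.EE) (e, C) (F, d)) := fun B F e => by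
    rw [Lm_eq, Matrix.smul_apply, Matrix.smul_apply (_ * _) _ (e, C), smul_eq_mul, smul_eq_mul]
    generalize (1 + D.lor.q • D.lor.EE) (a, A) (B, e) = u
    generalize (1 + D.lor.q • D.lor.EE) (e, C) (F, d) = v
    linear_combination (u * v * D.lor.E B F * D.lor.qHalf * D.lor.qHalf) * h1 +
      (u * v * D.lor.E B F) * h2
  simp only [this, ← Finset.mul_sum]
  rw [h, ← mul_assoc, h3, one_mul]

theorem conj_blk_Lm_mul : conj2 (blk D.Lm) * blk D.Lt = D.lor.q • 1 := by
  ext A B a e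
  have h := congrFun (congrFun D.Lm_mul_Lm (a, A)) (e, B)
  have hq := D.lor.q_mul_q
  simp only [mul_apply, Fintype.sum_prod_type] at h
  simp only [mul_apply, Matrix.sum_apply, conj2, map_apply, RingHom.mapMatrix_apply, blk, of_apply,
    conj_Lm, Lt, Matrix.smul_apply, smul_eq_mul, Prod.swap_prod_mk]
  have h1 : (1 : Matrix (Fin 2) (Fin 2) (Matrix (Fin 2) (Fin 2) ℂ)) A B a e =
      (1 : Matrix (Fin 2 × Fin 2) (Fin 2 × Fin 2) ℂ) (a, A) (e, B) := by
    simp only [one_apply, Prod.mk.injEq]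
    by_cases hA : A = B <;> by_cases ha : a = e <;> simp [hA, ha, one_apply]
  rw [h1, ← smul_eq_mul (a := D.lor.q), ← Matrix.smul_apply, ← h]
  simp only [Fin.sum_univ_two]
  linear_combination (D.Lm (a, A) (0, 0) * D.Lm (0, 0) (e, B) +
    D.Lm (a, A) (0, 1) * D.Lm (0, 1) (e, B) + D.Lm (a, A) (1, 0) * D.Lm (1, 0) (e, B) +
    D.Lm (a, A) (1, 1) * D.Lm (1, 1) (e, B)) * hq

theorem conj_blk_Xm_mul : conj2 (blk D.Xm) * blk D.Xm⁻¹ = D.lor.q • 1 := by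
  ext A B a e
  have h := congrFun (congrFun D.lor.X_mul_inv (A, a)) (B, e)
  simp only [mul_apply, Fintype.sum_prod_type] at h
  simp only [mul_apply, Matrix.sum_apply, conj2, map_apply, RingHom.mapMatrix_apply, blk, of_apply,
    Xm, D.lor.conj_X, Matrix.smul_apply, smul_eq_mul, Prod.swap_prod_mk]
  have h1 : (1 : Matrix (Fin 2) (Fin 2) (Matrix (Fin 2) (Fin 2) ℂ)) A B a e =
      (1 : Matrix (Fin 2 × Fin 2) (Fin 2 × Fin 2) ℂ) (A, a) (B, e) := by
    simp only [one_apply, Prod.mk.injEq]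
    by_cases hA : A = B <;> by_cases ha : a = e <;> simp [hA, ha, one_apply]
  rw [h1, ← h]
  simp only [Fin.sum_univ_two]
  ring

end PoincareData

end QuantumMinkowski

noncomputable section

namespace QuantumMinkowski

open Matrix
open scoped Kronecker

/-! ### Vectors as pairs of spinors -/

/-- `V` as a matrix. -/
def Vm : Matrix (Fin 2 × Fin 2) (Fin 4) ℂ := of fun p i => V p.1 p.2 i

/-- `V⁻¹` as a matrix. -/
def Vim : Matrix (Fin 4) (Fin 2 × Fin 2) ℂ := of fun i p => Vinv i p.1 p.2

theorem Vim_mul_Vm : Vim * Vm = 1 := by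
  ext i j
  simp only [Vim, Vm, mul_apply, Fintype.sum_prod_type, of_apply, Fin.sum_univ_two, V, Vinv, pauli]
  fin_cases i <;> fin_cases j <;> simp <;> ring_nf
  simp

theorem Vm_mul_Vim : Vm * Vim = 1 := by
  ext ⟨a, b⟩ ⟨c, d⟩
  simp only [Vim, Vm, mul_apply, of_apply, Fin.sum_univ_four, V, Vinv, pauli]
  fin_cases a <;> fin_cases b <;> fin_cases c <;> fin_cases d <;> simp <;> ring_nf <;> norm_num

theorem conj_V (A B : Fin 2) (i : Fin 4) : (starRingEnd ℂ) (V A B i) = V B A i := by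
  fin_cases A <;> fin_cases B <;> fin_cases i <;> simp [V, pauli]

theorem conj_Vinv (A B : Fin 2) (i : Fin 4) : (starRingEnd ℂ) (Vinv i A B) = Vinv i B A := by
  fin_cases A <;> fin_cases B <;> fin_cases i <;> simp [Vinv, pauli, map_ofNat]

section conjV

variable (S : Type) [Ring S] [Algebra ℂ S]

theorem Vim_mul_Vm_map : Vim.map (algebraMap ℂ S) * Vm.map (algebraMap ℂ S) = 1 := by
  rw [← map_algebraMap_mul, Vim_mul_Vm, Matrix.map_one _ (map_zero _) (map_one _)]

theorem Vm_mul_Vim_map : Vm.map (algebraMap ℂ S) * Vim.map (algebraMap ℂ S) = 1 := by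
  rw [← map_algebraMap_mul, Vm_mul_Vim, Matrix.map_one _ (map_zero _) (map_one _)]

/-- `M ↦ V⁻¹ M V`. -/
def conjV : Matrix (Fin 2 × Fin 2) (Fin 2 × Fin 2) S →ₐ[ℂ] Matrix (Fin 4) (Fin 4) S :=
  AlgHom.ofLinearMap
    { toFun := fun M => Vim.map (algebraMap ℂ S) * M * Vm.map (algebraMap ℂ S)
      map_add' := fun M N => by rw [Matrix.mul_add, Matrix.add_mul]
      map_smul' := fun c M => by rw [Matrix.mul_smul, Matrix.smul_mul, RingHom.id_apply] }
    (by simp only [LinearMap.coe_mk, AddHom.coe_mk, Matrix.mul_one, Vim_mul_Vm_map])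
    (fun M N => by
      simp only [LinearMap.coe_mk, AddHom.coe_mk]
      calc _ = Vim.map (algebraMap ℂ S) * M * (Vm.map (algebraMap ℂ S) * Vim.map (algebraMap ℂ S)) *
            N * Vm.map (algebraMap ℂ S) := by
              rw [Vm_mul_Vim_map, Matrix.mul_one]; simp only [Matrix.mul_assoc]
        _ = _ := by simp only [Matrix.mul_assoc])

variable {S}

theorem conjV_eq (M : Matrix (Fin 2 × Fin 2) (Fin 2 × Fin 2) S) :
    conjV S M = Vim.map (algebraMap ℂ S) * M * Vm.map (algebraMap ℂ S) := rfl

theorem conjV_apply (M : Matrix (Fin 2 × Fin 2) (Fin 2 × Fin 2) S) (i j : Fin 4) :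
    conjV S M i j = ∑ A, ∑ B, ∑ C, ∑ D, (Vinv i A B * V C D j) • M (A, B) (C, D) := by
  simp only [conjV_eq, mul_apply, map_apply, Fintype.sum_prod_type, Finset.sum_mul, Vim, Vm,
    of_apply]
  rw [Finset.sum_congr rfl fun C _ => Finset.sum_congr rfl fun D _ => Finset.sum_congr rfl
    fun A _ => Finset.sum_congr rfl fun B _ => show _ = (Vinv i A B * V C D j) • M (A, B) (C, D) by
      rw [mul_assoc, ← Algebra.commutes, ← Algebra.smul_def, ← Algebra.smul_def, smul_smul]]
  simp only [Fin.sum_univ_two]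
  abel

/-- The matrix `Λ = V⁻¹ (w ⊗ w̄) V`. -/
def lamM (w wb : Matrix (Fin 2) (Fin 2) S) : Matrix (Fin 4) (Fin 4) S := conjV S (w ⊗ₖ wb)

theorem lamM_apply (w wb : Matrix (Fin 2) (Fin 2) S) (i j : Fin 4) :
    lamM w wb i j = ∑ A, ∑ B, ∑ C, ∑ D, (Vinv i A B * V C D j) • (w A C * wb B D) :=
  conjV_apply _ _ _

theorem LambdaOf_eq_lamM (w wb : Fin 2 → Fin 2 → S) (i j : Fin 4) :
    LambdaOf w wb i j = lamM (of w) (of wb) i j := by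
  rw [lamM_apply]; rfl

theorem lamM_mul (u ub v vb : Matrix (Fin 2) (Fin 2) S)
    (h : ∀ i j k k', Commute (ub i j) (v k k')) :
    lamM (u * v) (ub * vb) = lamM u ub * lamM v vb := by
  rw [lamM, kronecker_mul_of_commute _ _ _ _ h, map_mul]; rfl

theorem lamM_map {S' : Type} [Ring S'] [Algebra ℂ S'] (φ : S →ₐ[ℂ] S')
    (w wb : Matrix (Fin 2) (Fin 2) S) : (lamM w wb).map φ = lamM (w.map φ) (wb.map φ) := by
  ext i j : 1
  simp only [map_apply, lamM_apply, map_sum, map_smul, map_mul]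

theorem lamM_one : lamM (1 : Matrix (Fin 2) (Fin 2) S) 1 = 1 := by
  have : (1 : Matrix (Fin 2) (Fin 2) S) ⊗ₖ (1 : Matrix (Fin 2) (Fin 2) S) = 1 := by
    rw [← legL_mul_legR, map_one, map_one, one_mul]
  rw [lamM, this, map_one]

end conjV

theorem map_conj_conjV (M : Matrix (Fin 2 × Fin 2) (Fin 2 × Fin 2) ℂ) :
    (starRingEnd ℂ).mapMatrix (conjV ℂ M) = conjV ℂ (flipConj M) := by
  ext i j
  rw [RingHom.mapMatrix_apply, map_apply, conjV_apply, conjV_apply]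
  simp only [map_sum, smul_eq_mul, map_mul, conj_V, conj_Vinv, flipConj, of_apply,
    Prod.swap_prod_mk]
  simp only [Fin.sum_univ_two]
  ring

theorem flipConj_mul (M N : Matrix (Fin 2 × Fin 2) (Fin 2 × Fin 2) ℂ) :
    flipConj (M * N) = flipConj M * flipConj N := by
  ext ⟨a, b⟩ ⟨d, e⟩
  simp only [flipConj, of_apply, mul_apply, Fintype.sum_prod_type, Fin.sum_univ_two, map_add,
    map_mul, Prod.swap_prod_mk]
  ring

theorem flipConj_legL (M : Matrix (Fin 2) (Fin 2) ℂ) :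
    flipConj (legL (Fin 2) (Fin 2) M) = legR (Fin 2) (Fin 2) ((starRingEnd ℂ).mapMatrix M) := by
  ext ⟨a, b⟩ ⟨d, e⟩
  simp only [flipConj, of_apply, legL_apply, legR_apply, Prod.swap_prod_mk,
    RingHom.mapMatrix_apply, map_apply]
  split_ifs <;> simp

theorem flipConj_legR (M : Matrix (Fin 2) (Fin 2) ℂ) :
    flipConj (legR (Fin 2) (Fin 2) M) = legL (Fin 2) (Fin 2) ((starRingEnd ℂ).mapMatrix M) := by
  ext ⟨a, b⟩ ⟨d, e⟩
  simp only [flipConj, of_apply, legL_apply, legR_apply, Prod.swap_prod_mk,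
    RingHom.mapMatrix_apply, map_apply]
  split_ifs <;> simp

/-! ### The homomorphism `f` -/

namespace PoincareData

variable (D : PoincareData)

/-- The image of `w` in the endomorphisms of two spinors. -/
def sw : Matrix (Fin 2) (Fin 2) (Matrix (Fin 2 × Fin 2) (Fin 2 × Fin 2) ℂ) :=
  (blk D.Xm).map (legR (Fin 2) (Fin 2)) * (blk D.Lm).map (legL (Fin 2) (Fin 2))

/-- The image of `w̄` in the endomorphisms of two spinors. -/
def swb : Matrix (Fin 2) (Fin 2) (Matrix (Fin 2 × Fin 2) (Fin 2 × Fin 2) ℂ) :=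
  (blk D.Lt).map (legR (Fin 2) (Fin 2)) * (blk D.Xm⁻¹).map (legL (Fin 2) (Fin 2))

/-- `f(w)`. -/
def fw : Matrix (Fin 2) (Fin 2) (Matrix (Fin 4) (Fin 4) ℂ) := D.sw.map (conjV ℂ)

/-- `f(w̄)`. -/
def fwb : Matrix (Fin 2) (Fin 2) (Matrix (Fin 4) (Fin 4) ℂ) := D.swb.map (conjV ℂ)

theorem fw_apply (A B : Fin 2) (i j : Fin 4) : D.fw A B i j = D.G (i, A) (j, B) := by
  simp only [fw, sw, map_apply, conjV_apply, mul_apply, Fin.sum_univ_two, Matrix.add_apply,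
    Fintype.sum_prod_type, legR_apply, legL_apply, G, of_apply, smul_eq_mul, blk]
  simp
  ring

theorem fwb_apply (A B : Fin 2) (i j : Fin 4) : D.fwb A B i j = D.Gt (i, A) (j, B) := by
  simp only [fwb, swb, map_apply, conjV_apply, mul_apply, Fin.sum_univ_two, Matrix.add_apply,
    Fintype.sum_prod_type, legR_apply, legL_apply, Gt, of_apply, smul_eq_mul, blk]
  simp
  ring

/-- `f(w̄)` is the inverse of the complex conjugate of `f(w)`. -/
theorem conj_fw_mul_fwb : conj2 D.fw * D.fwb = 1 := by
  have h1 : conj2 D.fw = ((conj2 (blk D.Xm)).map (legL (Fin 2) (Fin 2)) *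
      (conj2 (blk D.Lm)).map (legR (Fin 2) (Fin 2))).map (conjV ℂ) := by
    ext A B : 1
    simp only [conj2, fw, map_apply, map_conj_conjV]
    congr 1
    simp only [sw, mul_apply, map_apply, Fin.sum_univ_two]
    rw [← flipConj_legR, ← flipConj_legR, ← flipConj_legL, ← flipConj_legL, ← flipConj_mul,
      ← flipConj_mul]
    ext p r
    simp only [flipConj, of_apply, Matrix.add_apply, map_add]
  have h2 : (conj2 (blk D.Lm)).map (legR (Fin 2) (Fin 2)) * (blk D.Lt).map (legR (Fin 2) (Fin 2)) =
      D.lor.q • (1 : Matrix (Fin 2) (Fin 2) (Matrix (Fin 2 × Fin 2) (Fin 2 × Fin 2) ℂ)) := by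
    rw [← Matrix.map_mul, conj_blk_Lm_mul]
    ext A B : 1
    simp only [map_apply, Matrix.smul_apply, map_smul, one_apply]
    split_ifs <;> simp
  have h3 : (conj2 (blk D.Xm)).map (legL (Fin 2) (Fin 2)) *
      (blk D.Xm⁻¹).map (legL (Fin 2) (Fin 2)) =
      D.lor.q • (1 : Matrix (Fin 2) (Fin 2) (Matrix (Fin 2 × Fin 2) (Fin 2 × Fin 2) ℂ)) := by
    rw [← Matrix.map_mul, conj_blk_Xm_mul]
    ext A B : 1
    simp only [map_apply, Matrix.smul_apply, map_smul, one_apply]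
    split_ifs <;> simp
  rw [h1, fwb, ← Matrix.map_mul, swb]
  rw [Matrix.mul_assoc, ← Matrix.mul_assoc (_ : Matrix (Fin 2) (Fin 2) _)
    ((blk D.Lt).map (legR (Fin 2) (Fin 2))), h2, Matrix.smul_mul, Matrix.one_mul, Matrix.mul_smul,
    h3, smul_smul, D.lor.q_mul_q, one_smul, Matrix.map_one _ (map_zero _) (map_one _)]

/-- The defining relations of `𝒜` are compatible with `w ↦ G`, `w̄ ↦ G̃`: these come from the
two spinor representations `w ↦ X`, `w̄ ↦ L̃` and `w ↦ L`, `w̄ ↦ X⁻¹`. -/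
theorem isLorentzPair_f : IsLorentzPair D.lor D.fw D.fwb := by
  have hmap : ∀ (n n' : Type) [Fintype n] [DecidableEq n] [Fintype n'] [DecidableEq n']
      (φ : Matrix n n ℂ →ₐ[ℂ] Matrix n' n' ℂ) {l m : Type} (M : Matrix l m ℂ),
      (M.map (algebraMap ℂ (Matrix n n ℂ))).map φ = M.map (algebraMap ℂ _) := by
    intro n n' _ _ _ _ φ l m M
    ext i j : 1
    simp
  have hkr : ∀ (n n' : Type) [Fintype n] [DecidableEq n] [Fintype n'] [DecidableEq n']
      (φ : Matrix n n ℂ →ₐ[ℂ] Matrix n' n' ℂ) (u v : Matrix (Fin 2) (Fin 2) (Matrix n n ℂ)),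
      (u ⊗ₖ v).map φ = (u.map φ) ⊗ₖ (v.map φ) := by
    intro n n' _ _ _ _ φ u v
    ext i j : 1
    simp
  have hE : ∀ (n n' : Type) [Fintype n] [DecidableEq n] [Fintype n'] [DecidableEq n']
      (φ : Matrix n n ℂ →ₐ[ℂ] Matrix n' n' ℂ) {u : Matrix (Fin 2) (Fin 2) (Matrix n n ℂ)},
      u * D.lor.E.map (algebraMap ℂ (Matrix n n ℂ)) * uᵀ = D.lor.E.map (algebraMap ℂ _) →
      u.map φ * D.lor.E.map (algebraMap ℂ (Matrix n' n' ℂ)) * (u.map φ)ᵀ =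
        D.lor.E.map (algebraMap ℂ _) := by
    intro n n' _ _ _ _ φ u h
    have := congrArg (fun M => M.map φ) h
    simpa only [Matrix.map_mul, hmap, transpose_map] using this
  have hX : ∀ (n n' : Type) [Fintype n] [DecidableEq n] [Fintype n'] [DecidableEq n']
      (φ : Matrix n n ℂ →ₐ[ℂ] Matrix n' n' ℂ) {u v : Matrix (Fin 2) (Fin 2) (Matrix n n ℂ)},
      D.lor.X.map (algebraMap ℂ (Matrix n n ℂ)) * (u ⊗ₖ v) =
        (v ⊗ₖ u) * D.lor.X.map (algebraMap ℂ (Matrix n n ℂ)) →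
      D.lor.X.map (algebraMap ℂ (Matrix n' n' ℂ)) * (u.map φ ⊗ₖ v.map φ) =
        (v.map φ ⊗ₖ u.map φ) * D.lor.X.map (algebraMap ℂ (Matrix n' n' ℂ)) := by
    intro n n' _ _ _ _ φ u v h
    have := congrArg (fun M => M.map φ) h
    simpa only [Matrix.map_mul, hmap, hkr] using this
  have hcom : ∀ (u v : Matrix (Fin 2) (Fin 2) (Matrix (Fin 2) (Fin 2) ℂ)) (i j k k' : Fin 2),
      Commute ((u.map (legR (Fin 2) (Fin 2))) i j) ((v.map (legL (Fin 2) (Fin 2))) k k') :=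
    fun u v i j k k' => (legL_commute_legR _ _ fun _ _ _ _ => Commute.all _ _).symm
  refine isLorentzPair_of_conj D.lor ?_ ?_ D.conj_fw_mul_fwb
  · refine hE _ _ _ ?_
    rw [sw, mul_E_of_commute _ _ _ (hcom _ _), hE _ _ _ D.blk_Lm_E]
    exact hE _ _ _ D.lor.blk_X_E
  · refine hX _ _ _ ?_
    exact X_rel_mul D.lor.X (hX _ _ _ D.X_rel_Xm_Lt) (hX _ _ _ D.X_rel_Lm_Xinv)
      (hcom _ _) (hcom _ _)

end PoincareData

end QuantumMinkowski

end

noncomputable section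

namespace QuantumMinkowski

open Matrix
open scoped Kronecker

/-! ### The matrix `R` -/

theorem sum_reorder {M : Type} [AddCommMonoid M]
    (F : Fin 2 → Fin 2 → Fin 2 → Fin 2 → Fin 2 → Fin 2 → Fin 2 → Fin 2 → Fin 2 → Fin 2 → M) :
    ∑ a3, ∑ a4, ∑ b2, ∑ b3, ∑ c2, ∑ c3, ∑ d1, ∑ d2, ∑ d3, ∑ d4,
      F a3 a4 b2 b3 c2 c3 d1 d2 d3 d4 =
    ∑ d3, ∑ d4, ∑ a3, ∑ a4, ∑ d1, ∑ d2, ∑ b2, ∑ b3, ∑ c2, ∑ c3,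
      F a3 a4 b2 b3 c2 c3 d1 d2 d3 d4 := by
  simp only [← Fintype.sum_prod_type']
  exact Fintype.sum_equiv
    { toFun := fun (a3, a4, b2, b3, c2, c3, d1, d2, d3, d4) =>
        (d3, d4, a3, a4, d1, d2, b2, b3, c2, c3)
      invFun := fun (d3, d4, a3, a4, d1, d2, b2, b3, c2, c3) =>
        (a3, a4, b2, b3, c2, c3, d1, d2, d3, d4)
      left_inv := fun _ => rfl
      right_inv := fun _ => rfl } _ _ fun _ => rfl

namespace PoincareData

variable (D : PoincareData)

theorem sw_mul_swb_apply (a1 a2 a3 a4 d1 d2 d3 d4 : Fin 2) :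
    (D.sw a3 d1 * D.swb a4 d2) (a1, a2) (d3, d4) = ∑ b2, ∑ b3, ∑ c2, ∑ c3,
      D.Xm (a2, a3) (b2, b3) * (D.Lm (a1, b2) (d1, c2) * D.Lt (b3, a4) (c3, d4)) *
        D.Xm⁻¹ (c2, c3) (d2, d3) := by
  have h1 : ∀ p1 p2, D.sw a3 d1 (a1, a2) (p1, p2) =
      ∑ M, D.Xm (a2, a3) (M, p2) * D.Lm (a1, M) (d1, p1) := fun p1 p2 => by
    simp [sw, mul_apply, Matrix.sum_apply, Fintype.sum_prod_type, legR_apply, legL_apply, blk]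
  have h2 : ∀ p1 p2, D.swb a4 d2 (p1, p2) (d3, d4) =
      ∑ N, D.Lt (p2, a4) (N, d4) * D.Xm⁻¹ (p1, N) (d2, d3) := fun p1 p2 => by
    simp [swb, mul_apply, Matrix.sum_apply, Fintype.sum_prod_type, legR_apply, legL_apply, blk]
  simp only [mul_apply, Fintype.sum_prod_type, h1, h2, Fin.sum_univ_two]
  ring

/-- `f^i_l(Λ^j_k) = R^{ij}_{kl}`. -/
theorem lamM_f_apply (i j k l : Fin 4) : lamM D.fw D.fwb j k i l = D.R i j k l := by
  have h : lamM D.fw D.fwb = (lamM D.sw D.swb).map (conjV ℂ) := (lamM_map _ _ _).symm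
  rw [h, map_apply, conjV_apply, R]
  refine Finset.sum_congr rfl fun a1 _ => Finset.sum_congr rfl fun a2 _ => ?_
  rw [sum_reorder]
  refine Finset.sum_congr rfl fun d3 _ => Finset.sum_congr rfl fun d4 _ => ?_
  rw [lamM_apply]
  simp only [Matrix.sum_apply, Matrix.smul_apply, sw_mul_swb_apply, smul_eq_mul, Finset.mul_sum]
  refine Finset.sum_congr rfl fun a3 _ => Finset.sum_congr rfl fun a4 _ =>
    Finset.sum_congr rfl fun d1 _ => Finset.sum_congr rfl fun d2 _ =>
    Finset.sum_congr rfl fun b2 _ => Finset.sum_congr rfl fun b3 _ =>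
    Finset.sum_congr rfl fun c2 _ => Finset.sum_congr rfl fun c3 _ => ?_
  ring

end PoincareData

section sums

variable {M : Type} [AddCommMonoid M]

theorem sum_reverse (F : Fin 2 → Fin 2 → Fin 2 → Fin 2 → Fin 2 → Fin 2 → Fin 2 → Fin 2 → Fin 2 →
      Fin 2 → Fin 2 → Fin 2 → M) :
    ∑ a1, ∑ a2, ∑ a3, ∑ a4, ∑ b2, ∑ b3, ∑ c2, ∑ c3, ∑ d1, ∑ d2, ∑ d3, ∑ d4,
      F a1 a2 a3 a4 b2 b3 c2 c3 d1 d2 d3 d4 =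
    ∑ a1, ∑ a2, ∑ a3, ∑ a4, ∑ b2, ∑ b3, ∑ c2, ∑ c3, ∑ d1, ∑ d2, ∑ d3, ∑ d4,
      F a4 a3 a2 a1 b3 b2 c3 c2 d4 d3 d2 d1 := by
  simp only [← Fintype.sum_prod_type']
  exact Fintype.sum_equiv
    { toFun := fun (a1, a2, a3, a4, b2, b3, c2, c3, d1, d2, d3, d4) =>
        (a4, a3, a2, a1, b3, b2, c3, c2, d4, d3, d2, d1)
      invFun := fun (a1, a2, a3, a4, b2, b3, c2, c3, d1, d2, d3, d4) =>
        (a4, a3, a2, a1, b3, b2, c3, c2, d4, d3, d2, d1)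
      left_inv := fun _ => rfl
      right_inv := fun _ => rfl } _ _ fun _ => rfl

theorem sum_rotate (F : Fin 2 → Fin 2 → Fin 2 → Fin 2 → Fin 2 → Fin 2 → Fin 2 → Fin 2 → Fin 2 →
      Fin 2 → Fin 2 → Fin 2 → M) :
    ∑ a1, ∑ a2, ∑ a3, ∑ a4, ∑ b2, ∑ b3, ∑ c2, ∑ c3, ∑ d1, ∑ d2, ∑ d3, ∑ d4,
      F a1 a2 a3 a4 b2 b3 c2 c3 d1 d2 d3 d4 =
    ∑ d1, ∑ d2, ∑ d3, ∑ d4, ∑ a1, ∑ a2, ∑ a3, ∑ a4, ∑ b2, ∑ b3, ∑ c2, ∑ c3,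
      F a1 a2 a3 a4 b2 b3 c2 c3 d1 d2 d3 d4 := by
  simp only [← Fintype.sum_prod_type']
  exact Fintype.sum_equiv
    { toFun := fun (a1, a2, a3, a4, b2, b3, c2, c3, d1, d2, d3, d4) =>
        (d1, d2, d3, d4, a1, a2, a3, a4, b2, b3, c2, c3)
      invFun := fun (d1, d2, d3, d4, a1, a2, a3, a4, b2, b3, c2, c3) =>
        (a1, a2, a3, a4, b2, b3, c2, c3, d1, d2, d3, d4)
      left_inv := fun _ => rfl
      right_inv := fun _ => rfl } _ _ fun _ => rfl

end sums

/-- `1 ⊗ M ⊗ 1` on four tensor factors, grouped in two pairs. -/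
def midLeg (M : Matrix (Fin 2 × Fin 2) (Fin 2 × Fin 2) ℂ) :
    Matrix ((Fin 2 × Fin 2) × Fin 2 × Fin 2) ((Fin 2 × Fin 2) × Fin 2 × Fin 2) ℂ :=
  of fun p r => if p.1.1 = r.1.1 then if p.2.2 = r.2.2 then M (p.1.2, p.2.1) (r.1.2, r.2.1)
    else 0 else 0

theorem midLeg_mul (M N : Matrix (Fin 2 × Fin 2) (Fin 2 × Fin 2) ℂ) :
    midLeg (M * N) = midLeg M * midLeg N := by
  ext ⟨⟨a, b⟩, c, d⟩ ⟨⟨e, f⟩, g, h⟩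
  simp only [midLeg, of_apply, mul_apply, Fintype.sum_prod_type, ite_mul, mul_ite, zero_mul,
    mul_zero, Finset.sum_ite_irrel, Finset.sum_const_zero, Finset.sum_ite_eq', Finset.mem_univ,
    if_true]

theorem midLeg_one : midLeg 1 = 1 := by
  ext ⟨⟨a, b⟩, c, d⟩ ⟨⟨e, f⟩, g, h⟩
  simp only [midLeg, of_apply, one_apply, Prod.mk.injEq]
  split_ifs <;> tauto

namespace PoincareData

variable (D : PoincareData)

/-- `R` in the basis of spinors. -/
def Rspin : Matrix ((Fin 2 × Fin 2) × Fin 2 × Fin 2) ((Fin 2 × Fin 2) × Fin 2 × Fin 2) ℂ :=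
  midLeg D.Xm * (D.Lm ⊗ₖ D.Lt) * midLeg D.Xm⁻¹

theorem Rspin_apply (a1 a2 a3 a4 d1 d2 d3 d4 : Fin 2) :
    D.Rspin ((a1, a2), a3, a4) ((d1, d2), d3, d4) = ∑ b2, ∑ b3, ∑ c2, ∑ c3,
      D.Xm (a2, a3) (b2, b3) * (D.Lm (a1, b2) (d1, c2) * D.Lt (b3, a4) (c3, d4)) *
        D.Xm⁻¹ (c2, c3) (d2, d3) := by
  simp only [Rspin, midLeg, of_apply, mul_apply, Fintype.sum_prod_type, ite_mul, mul_ite, zero_mul,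
    mul_zero, Finset.sum_ite_irrel, Finset.sum_const_zero, Finset.sum_ite_eq, Finset.sum_ite_eq',
    Finset.mem_univ, if_true, kroneckerMap_apply]
  simp only [Fin.sum_univ_two]
  ring

/-- `R` as a matrix. -/
def Rm : Matrix (Fin 4 × Fin 4) (Fin 4 × Fin 4) ℂ := of fun p r => D.R p.1 p.2 r.1 r.2

theorem Rm_eq : D.Rm = (Vim ⊗ₖ Vim) * D.Rspin * (Vm ⊗ₖ Vm) := by
  ext ⟨i, j⟩ ⟨k, l⟩
  simp only [Rm, of_apply, mul_apply, Fintype.sum_prod_type, kroneckerMap_apply]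
  rw [R, sum_rotate]
  refine Finset.sum_congr rfl fun d1 _ => Finset.sum_congr rfl fun d2 _ =>
    Finset.sum_congr rfl fun d3 _ => Finset.sum_congr rfl fun d4 _ => ?_
  simp only [Finset.sum_mul]
  refine Finset.sum_congr rfl fun a1 _ => Finset.sum_congr rfl fun a2 _ =>
    Finset.sum_congr rfl fun a3 _ => Finset.sum_congr rfl fun a4 _ => ?_
  rw [Rspin_apply]
  simp only [Vim, Vm, of_apply, Finset.mul_sum, Finset.sum_mul]
  refine Finset.sum_congr rfl fun b2 _ => Finset.sum_congr rfl fun b3 _ =>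
    Finset.sum_congr rfl fun c2 _ => Finset.sum_congr rfl fun c3 _ => ?_
  ring

theorem Rspin_mul_Rspin : D.Rspin * D.Rspin = 1 := by
  have h1 : midLeg D.Xm⁻¹ * midLeg D.Xm = 1 := by
    rw [← midLeg_mul]; exact (congrArg midLeg D.lor.X_inv_mul).trans midLeg_one
  have h2 : midLeg D.Xm * midLeg D.Xm⁻¹ = 1 := by
    rw [← midLeg_mul]; exact (congrArg midLeg D.lor.X_mul_inv).trans midLeg_one
  have h3 : (D.Lm ⊗ₖ D.Lt) * (D.Lm ⊗ₖ D.Lt) = 1 := by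
    rw [← mul_kronecker_mul, Lm_mul_Lm, Lt_mul_Lt, smul_kronecker, kronecker_smul, smul_smul,
      D.lor.q_mul_q, one_smul, one_kronecker_one]
  calc _ = midLeg D.Xm * ((D.Lm ⊗ₖ D.Lt) * (midLeg D.Xm⁻¹ * midLeg D.Xm) * (D.Lm ⊗ₖ D.Lt)) *
        midLeg D.Xm⁻¹ := by simp only [Rspin, mul_assoc]
    _ = 1 := by rw [h1, mul_one, h3, mul_one, h2]

/-- `R` is an involution: it is conjugate to `L ⊗ L̃`, and `L² = L̃² = q` with `q² = 1`. -/
theorem Rm_mul_Rm : D.Rm * D.Rm = 1 := by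
  have h1 : (Vm ⊗ₖ Vm) * (Vim ⊗ₖ Vim) = 1 := by
    rw [← mul_kronecker_mul, Vm_mul_Vim, one_kronecker_one]
  have h2 : (Vim ⊗ₖ Vim) * (Vm ⊗ₖ Vm) = 1 := by
    rw [← mul_kronecker_mul, Vim_mul_Vm, one_kronecker_one]
  calc _ = (Vim ⊗ₖ Vim) * (D.Rspin * ((Vm ⊗ₖ Vm) * (Vim ⊗ₖ Vim)) * D.Rspin) * (Vm ⊗ₖ Vm) := by
        rw [Rm_eq]; simp only [Matrix.mul_assoc]
    _ = 1 := by rw [h1, mul_one, Rspin_mul_Rspin, Matrix.mul_one, h2]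

theorem conj_Lt (p r : Fin 2 × Fin 2) :
    (starRingEnd ℂ) (D.Lt p r) = D.Lm p.swap r.swap := by
  have hq := D.lor.q_mul_q
  simp only [Lt, Matrix.smul_apply, of_apply, smul_eq_mul, map_mul, D.lor.conj_q, conj_Lm]
  linear_combination (D.Lm p.swap r.swap) * hq

theorem conj_Xinv (p r : Fin 2 × Fin 2) :
    (starRingEnd ℂ) (D.Xm⁻¹ p r) = D.lor.q * D.Xm⁻¹ p.swap r.swap := by
  have h1 : flipConj (1 : Matrix (Fin 2 × Fin 2) (Fin 2 × Fin 2) ℂ) = 1 := by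
    ext p r
    simp only [flipConj, of_apply, one_apply, Prod.swap_inj]
    split_ifs <;> simp
  have h2 : D.Xm * (D.lor.q • flipConj D.Xm⁻¹) = 1 := by
    have h := congrArg flipConj D.lor.X_mul_inv
    rw [flipConj_mul, h1, D.lor.flipConj_X, Matrix.smul_mul] at h
    rw [Matrix.mul_smul]
    exact h
  have h3 := congrFun (congrFun (inv_eq_right_inv h2) p.swap) r.swap
  rw [Matrix.smul_apply, smul_eq_mul, flipConj, of_apply, Prod.swap_swap, Prod.swap_swap] at h3
  rw [h3, ← mul_assoc, D.lor.q_mul_q, one_mul]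

/-- The reality of `R`. -/
theorem conj_R (i j k l : Fin 4) : (starRingEnd ℂ) (D.R i j k l) = D.R j i l k := by
  have hq := D.lor.q_mul_q
  unfold R
  rw [sum_reverse]
  refine (map_sum _ _ _).trans (Finset.sum_congr rfl fun a1 _ =>
    (map_sum _ _ _).trans (Finset.sum_congr rfl fun a2 _ =>
    (map_sum _ _ _).trans (Finset.sum_congr rfl fun a3 _ =>
    (map_sum _ _ _).trans (Finset.sum_congr rfl fun a4 _ =>
    (map_sum _ _ _).trans (Finset.sum_congr rfl fun b2 _ =>
    (map_sum _ _ _).trans (Finset.sum_congr rfl fun b3 _ =>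
    (map_sum _ _ _).trans (Finset.sum_congr rfl fun c2 _ =>
    (map_sum _ _ _).trans (Finset.sum_congr rfl fun c3 _ =>
    (map_sum _ _ _).trans (Finset.sum_congr rfl fun d1 _ =>
    (map_sum _ _ _).trans (Finset.sum_congr rfl fun d2 _ =>
    (map_sum _ _ _).trans (Finset.sum_congr rfl fun d3 _ =>
    (map_sum _ _ _).trans (Finset.sum_congr rfl fun d4 _ =>
    ?_))))))))))))
  simp only [map_mul, conj_V, conj_Vinv, conj_Lm, conj_Lt, conj_Xinv, Prod.swap_prod_mk]
  have h : (starRingEnd ℂ) (D.Xm (a3, a2) (b3, b2)) = D.lor.q * D.Xm (a2, a3) (b2, b3) :=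
    D.lor.conj_X _ _
  rw [h]
  have h' : D.Lt (b3, a4) (c3, d4) = D.lor.q * D.Lm (a4, b3) (d4, c3) := rfl
  rw [h']
  linear_combination (Vinv j a1 a2 * Vinv i a3 a4 * D.Xm (a2, a3) (b2, b3) * D.lor.q *
    D.Lm (a4, b3) (d4, c3) * D.Lm (a1, b2) (d1, c2) * D.Xm⁻¹ (c2, c3) (d2, d3) * V d3 d4 k *
    V d1 d2 l) * hq

end PoincareData

end QuantumMinkowski

end

noncomputable section

namespace QuantumMinkowski

open Matrix
open scoped Kronecker

/-! ### Exchange relations -/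

section exchange

variable {S : Type} [Ring S] [Algebra ℂ S] {m n : Type} [Fintype m] [DecidableEq m] [Fintype n]
  [DecidableEq n]

/-- The constant matrices in `M_n(S)`. -/
def cst (S n : Type) [Ring S] [Algebra ℂ S] [Fintype n] [DecidableEq n] :
    Matrix n n ℂ →ₐ[ℂ] Matrix n n S :=
  (Algebra.ofId ℂ S).mapMatrix

theorem cst_apply (M : Matrix n n ℂ) (i j : n) : cst S n M i j = algebraMap ℂ S (M i j) := rfl

theorem commute_scalar_cst (a : S) (M : Matrix n n ℂ) : Commute (scalar n a) (cst S n M) := by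
  rw [commute_iff_eq]
  ext i j
  simp [cst_apply, Algebra.commutes]

theorem map_scalar_commute_map_cst (w : Matrix (Fin 2) (Fin 2) S)
    (g : Matrix (Fin 2) (Fin 2) (Matrix n n ℂ)) (A B C E : Fin 2) :
    Commute (w.map (scalar n) A B) (g.map (cst S n) C E) :=
  commute_scalar_cst _ _

/-- `u w g = g w u` as matrices of matrices. -/
def Exch (u : Matrix n n S) (w : Matrix (Fin 2) (Fin 2) S)
    (g : Matrix (Fin 2) (Fin 2) (Matrix n n ℂ)) : Prop :=
  scalar (Fin 2) u * (w.map (scalar n) * g.map (cst S n)) =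
    g.map (cst S n) * w.map (scalar n) * scalar (Fin 2) u

theorem mul_scalar_mul_cst_apply (u : Matrix n n S) (a : S) (M : Matrix n n ℂ) (i j : n) :
    (u * (scalar n a * cst S n M)) i j = ∑ l, M l j • (u i l * a) := by
  rw [mul_apply]
  refine Finset.sum_congr rfl fun l _ => ?_
  rw [scalar_apply, diagonal_mul, cst_apply, ← mul_assoc, ← Algebra.commutes, Algebra.smul_def]

theorem cst_mul_scalar_mul_apply (u : Matrix n n S) (a : S) (M : Matrix n n ℂ) (i j : n) :
    (cst S n M * scalar n a * u) i j = ∑ l, M i l • (a * u l j) := by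
  rw [mul_apply]
  refine Finset.sum_congr rfl fun l _ => ?_
  rw [scalar_apply, mul_diagonal, cst_apply, mul_assoc, Algebra.smul_def]

theorem mul_mul_entry {R k l : Type} [Ring R] [Fintype l] (u : R) (M : Matrix k l R)
    (N : Matrix l k R) (A B : k) : u * (M * N) A B = ∑ C, u * (M A C * N C B) := by
  rw [mul_apply, Finset.mul_sum]

theorem mul_entry_mul {R k l : Type} [Ring R] [Fintype l] (u : R) (M : Matrix k l R)
    (N : Matrix l k R) (A B : k) : (M * N) A B * u = ∑ C, M A C * N C B * u := by
  rw [mul_apply, Finset.sum_mul]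

theorem exch_iff {u : Matrix n n S} {w : Matrix (Fin 2) (Fin 2) S}
    {g : Matrix (Fin 2) (Fin 2) (Matrix n n ℂ)} :
    Exch u w g ↔ ∀ A B i j, ∑ C, ∑ l, g C B l j • (u i l * w A C) =
      ∑ C, ∑ l, g A C i l • (w C B * u l j) := by
  rw [Exch, ← Matrix.ext_iff]
  refine forall_congr' fun A => forall_congr' fun B => ?_
  rw [← Matrix.ext_iff]
  refine forall_congr' fun i => forall_congr' fun j => ?_
  rw [scalar_apply, diagonal_mul, mul_diagonal, mul_mul_entry, mul_entry_mul,
    Matrix.sum_apply, Matrix.sum_apply]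
  simp only [map_apply, mul_scalar_mul_cst_apply, cst_mul_scalar_mul_apply]

theorem exch_blk_iff {u w : Matrix (Fin 2) (Fin 2) S}
    (P : Matrix (Fin 2 × Fin 2) (Fin 2 × Fin 2) ℂ) :
    Exch u w (blk P) ↔
      (u ⊗ₖ w) * P.map (algebraMap ℂ S) = P.map (algebraMap ℂ S) * (w ⊗ₖ u) := by
  rw [exch_iff, ← Matrix.ext_iff]
  simp only [Prod.forall, mul_apply, map_apply, kroneckerMap_apply, Fintype.sum_prod_type, blk,
    of_apply]
  constructor
  · intro h i A B j
    have := h A B i j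
    rw [Finset.sum_comm] at this
    simpa only [Algebra.smul_def, ← Algebra.commutes] using this
  · intro h A B i j
    rw [Finset.sum_comm]
    simpa only [Algebra.smul_def, ← Algebra.commutes] using h i A B j

theorem legL_scalar (a : S) : legL m n (scalar m a) = scalar (m × n) a := by
  ext ⟨a, b⟩ ⟨c, d⟩
  simp only [legL_apply, scalar_apply, diagonal_apply, Prod.mk.injEq]
  split_ifs <;> tauto

theorem legR_scalar (a : S) : legR m n (scalar n a) = scalar (m × n) a := by
  ext ⟨a, b⟩ ⟨c, d⟩
  simp only [legR_apply, scalar_apply, diagonal_apply, Prod.mk.injEq]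
  split_ifs <;> tauto

theorem legL_cst (M : Matrix m m ℂ) : legL m n (cst S m M) = cst S (m × n) (legL m n M) := by
  ext ⟨a, b⟩ ⟨c, d⟩
  simp only [legL_apply, cst_apply]
  split_ifs <;> simp

theorem legR_cst (M : Matrix n n ℂ) : legR m n (cst S n M) = cst S (m × n) (legR m n M) := by
  ext ⟨a, b⟩ ⟨c, d⟩
  simp only [legR_apply, cst_apply]
  split_ifs <;> simp

theorem commute_scalar_map_of_forall {R : Type} [Ring R] {u : R} {h : Matrix (Fin 2) (Fin 2) R}
    (hc : ∀ A B, Commute u (h A B)) : Commute (scalar (Fin 2) u) h := by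
  rw [commute_iff_eq]
  ext A B : 1
  simpa [scalar_apply] using (hc A B).eq

theorem Exch.map {u : Matrix m m S} {w : Matrix (Fin 2) (Fin 2) S}
    {g : Matrix (Fin 2) (Fin 2) (Matrix m m ℂ)} (h : Exch u w g)
    {φ : Matrix m m S →ₐ[ℂ] Matrix n n S} {φ' : Matrix m m ℂ →ₐ[ℂ] Matrix n n ℂ}
    (hs : ∀ a, φ (scalar m a) = scalar n a) (hc : ∀ M, φ (cst S m M) = cst S n (φ' M)) :
    Exch (φ u) w (g.map φ') := by
  have h1 := congrArg (fun M => M.map φ) h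
  have hu : (scalar (Fin 2) u).map φ = scalar (Fin 2) (φ u) := by
    simp [scalar_apply, Matrix.diagonal_map]
  have hw : (w.map (scalar m)).map φ = w.map (scalar n) := by
    ext A B : 1
    simp only [map_apply, hs]
  have hg : (g.map (cst S m)).map φ = (g.map φ').map (cst S n) := by
    ext A B : 1
    simp only [map_apply, hc]
  rw [Exch]
  simpa only [Matrix.map_mul, hu, hw, hg] using h1

/-- Exchange relations are compatible with tensor products. -/
theorem Exch.kronecker {u : Matrix m m S} {v : Matrix n n S} {w : Matrix (Fin 2) (Fin 2) S}
    {g : Matrix (Fin 2) (Fin 2) (Matrix m m ℂ)} {h : Matrix (Fin 2) (Fin 2) (Matrix n n ℂ)}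
    (hu : Exch u w g) (hv : Exch v w h) :
    Exch (u ⊗ₖ v) w (h.map (legR m n) * g.map (legL m n)) := by
  have h1 := hu.map (φ := legL m n) (φ' := legL m n) legL_scalar legL_cst
  have h2 := hv.map (φ := legR m n) (φ' := legR m n) legR_scalar legR_cst
  have c1 : Commute (scalar (Fin 2) (legL m n u)) ((h.map (legR m n)).map (cst S (m × n))) :=
    commute_scalar_map_of_forall fun A B => by
      rw [map_apply, map_apply, ← legR_cst]
      exact legL_commute_legR _ _ fun i j k l => Algebra.commute_algebraMap_right _ _
  have c2 : Commute (scalar (Fin 2) (legR m n v)) ((g.map (legL m n)).map (cst S (m × n))) :=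
    commute_scalar_map_of_forall fun A B => by
      rw [map_apply, map_apply, ← legL_cst]
      exact (legL_commute_legR _ _ fun i j k l => Algebra.commute_algebraMap_left _ _).symm
  unfold Exch at h1 h2 ⊢
  rw [← legL_mul_legR, map_mul, Matrix.map_mul]
  set W := w.map (scalar (m × n))
  set U := scalar (Fin 2) (legL m n u)
  set V := scalar (Fin 2) (legR m n v)
  set G := (g.map (legL m n)).map (cst S (m × n))
  set H := (h.map (legR m n)).map (cst S (m × n))
  calc _ = U * (V * (W * H)) * G := by simp only [mul_assoc]
    _ = U * H * W * (V * G) := by rw [h2]; simp only [mul_assoc]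
    _ = H * (U * (W * G)) * V := by rw [c1.eq, c2.eq]; simp only [mul_assoc]
    _ = _ := by rw [h1]; simp only [mul_assoc]

/-- If `u` can be exchanged with `w` and with `w̄`, then it can be exchanged with `Λ`. -/
theorem Exch.lamM_apply {u : Matrix n n S} {w wb : Matrix (Fin 2) (Fin 2) S}
    {g gb : Matrix (Fin 2) (Fin 2) (Matrix n n ℂ)} (h : Exch u w g) (hb : Exch u wb gb)
    (j k : Fin 4) :
    u * ((lamM w wb).map (scalar n) * (lamM g gb).map (cst S n)) j k =
      ((lamM g gb).map (cst S n) * (lamM w wb).map (scalar n)) j k * u := by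
  have e1 : (lamM w wb).map (scalar n) * (lamM g gb).map (cst S n) =
      lamM (w.map (scalar n) * g.map (cst S n)) (wb.map (scalar n) * gb.map (cst S n)) := by
    rw [lamM_mul _ _ _ _ fun A B C E => map_scalar_commute_map_cst wb g A B C E]
    congr 1
    · exact lamM_map (scalarAlgHom n ℂ) w wb
    · exact lamM_map (cst S n) g gb
  have e2 : (lamM g gb).map (cst S n) * (lamM w wb).map (scalar n) =
      lamM (g.map (cst S n) * w.map (scalar n)) (gb.map (cst S n) * wb.map (scalar n)) := by
    rw [lamM_mul _ _ _ _ fun A B C E => (map_scalar_commute_map_cst w gb C E A B).symm]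
    congr 1
    · exact lamM_map (cst S n) g gb
    · exact lamM_map (scalarAlgHom n ℂ) w wb
  have h' : ∀ A B, u * (w.map (scalar n) * g.map (cst S n)) A B =
      (g.map (cst S n) * w.map (scalar n)) A B * u := fun A B => by
    have := congrFun (congrFun h A) B
    simpa only [scalar_apply, diagonal_mul, mul_diagonal] using this
  have hb' : ∀ A B, u * (wb.map (scalar n) * gb.map (cst S n)) A B =
      (gb.map (cst S n) * wb.map (scalar n)) A B * u := fun A B => by
    have := congrFun (congrFun hb A) B
    simpa only [scalar_apply, diagonal_mul, mul_diagonal] using this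
  rw [e1, e2, QuantumMinkowski.lamM_apply, QuantumMinkowski.lamM_apply]
  simp only [Finset.mul_sum, Finset.sum_mul, mul_smul_comm, smul_mul_assoc, mul_assoc, ← hb']
  simp only [← mul_assoc, h']

/-- The exchange relation with `Λ` in components. -/
theorem Exch.lamM_component {u : Matrix n n S} {w wb : Matrix (Fin 2) (Fin 2) S}
    {g gb : Matrix (Fin 2) (Fin 2) (Matrix n n ℂ)} (h : Exch u w g) (hb : Exch u wb gb)
    (j k : Fin 4) (a b : n) :
    ∑ c, ∑ l, lamM g gb c k l b • (u a l * lamM w wb j c) =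
      ∑ c, ∑ l, lamM g gb j c a l • (lamM w wb c k * u l b) := by
  have := congrFun (congrFun (h.lamM_apply hb j k) a) b
  rw [mul_mul_entry, mul_entry_mul, Matrix.sum_apply, Matrix.sum_apply] at this
  simpa only [map_apply, mul_scalar_mul_cst_apply, cst_mul_scalar_mul_apply] using this

end exchange

section pair

variable {S : Type} [Ring S] [Algebra ℂ S]

/-- `w ⊗ w` commutes with `E E'`, since it fixes `E` and `E'`. -/
theorem kronecker_mul_rankOne {w : Matrix (Fin 2) (Fin 2) S} {E E' : Matrix (Fin 2) (Fin 2) ℂ}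
    (hE : w * E.map (algebraMap ℂ S) * wᵀ = E.map (algebraMap ℂ S))
    (hE' : wᵀ * E'.map (algebraMap ℂ S) * w = E'.map (algebraMap ℂ S)) :
    Commute (w ⊗ₖ w) ((of fun p r : Fin 2 × Fin 2 => E p.1 p.2 * E' r.1 r.2).map
      (algebraMap ℂ S)) := by
  have h1 : ∀ A C, ∑ B, ∑ D, E B D • (w A B * w C D) = algebraMap ℂ S (E A C) := fun A C => by
    rw [← mul_map_mul_transpose_apply, hE, map_apply]
  have h2 : ∀ A C, ∑ B, ∑ D, E' B D • (w B A * w D C) = algebraMap ℂ S (E' A C) := fun A C => by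
    rw [← transpose_mul_map_mul_apply, hE', map_apply]
  rw [commute_iff_eq]
  ext ⟨a, b⟩ ⟨c, d⟩
  trans algebraMap ℂ S (E a b * E' c d)
  · rw [map_mul, ← h1, mul_apply, Fintype.sum_prod_type]
    simp only [Finset.sum_mul, kroneckerMap_apply, map_apply, of_apply, map_mul]
    refine Finset.sum_congr rfl fun B _ => Finset.sum_congr rfl fun D _ => ?_
    rw [Algebra.smul_def, ← mul_assoc, Algebra.commutes]
  · rw [map_mul, ← h2 c d, mul_apply, Fintype.sum_prod_type]
    simp only [Finset.mul_sum, kroneckerMap_apply, map_apply, of_apply, map_mul]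
    refine Finset.sum_congr rfl fun B _ => Finset.sum_congr rfl fun D _ => ?_
    rw [Algebra.smul_def, ← mul_assoc]

theorem conjV_scalar (a : S) : conjV S (scalar (Fin 2 × Fin 2) a) = scalar (Fin 4) a := by
  rw [conjV_eq]
  have : scalar (Fin 2 × Fin 2) a * Vm.map (algebraMap ℂ S) =
      Vm.map (algebraMap ℂ S) * scalar (Fin 4) a := by
    ext i j
    simp [scalar_apply, Algebra.commutes]
  rw [Matrix.mul_assoc, this, ← Matrix.mul_assoc, Vim_mul_Vm_map, one_mul]

theorem conjV_cst (M : Matrix (Fin 2 × Fin 2) (Fin 2 × Fin 2) ℂ) :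
    conjV S (cst S _ M) = cst S _ (conjV ℂ M) := by
  ext i j
  simp only [conjV_apply, cst_apply, map_sum, smul_eq_mul, map_mul, Algebra.smul_def]

end pair

namespace IsLorentzPair

variable {D : PoincareData} {S : Type} [Ring S] [Algebra ℂ S] {w wb : Matrix (Fin 2) (Fin 2) S}

theorem exch_w_w (h : IsLorentzPair D.lor w wb) : Exch w w (blk D.Lm) := by
  rw [exch_blk_iff, D.Lm_eq]
  have h1 := kronecker_mul_rankOne h.w_E h.E'_w
  have h2 : ((((D.s : ℤ) : ℂ) * D.lor.qHalf) • (1 + D.lor.q • D.lor.EE)).map (algebraMap ℂ S) =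
      algebraMap ℂ _ (((D.s : ℤ) : ℂ) * D.lor.qHalf) *
        (1 + algebraMap ℂ _ D.lor.q * D.lor.EE.map (algebraMap ℂ S)) := by
    rw [← Algebra.smul_def, ← Algebra.smul_def]
    ext p r
    simp only [map_apply, Matrix.smul_apply, Matrix.add_apply, smul_eq_mul, map_mul, map_add,
      one_apply, apply_ite (algebraMap ℂ S), map_one, map_zero, Algebra.smul_def (A := S)]
  rw [h2]
  exact ((Algebra.commute_algebraMap_right _ _).mul_right
    ((Commute.one_right _).add_right ((Algebra.commute_algebraMap_right _ _).mul_right h1))).eq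

theorem exch_wb_wb (h : IsLorentzPair D.lor w wb) : Exch wb wb (blk D.Lt) := by
  rw [exch_blk_iff, PoincareData.Lt, D.Lm_eq]
  have h1 := kronecker_mul_rankOne h.wb_E h.E'_wb
  have h2 : (D.lor.q • of fun p r : Fin 2 × Fin 2 => ((((D.s : ℤ) : ℂ) * D.lor.qHalf) •
        (1 + D.lor.q • D.lor.EE)) p.swap r.swap).map (algebraMap ℂ S) =
      algebraMap ℂ _ (D.lor.q * (((D.s : ℤ) : ℂ) * D.lor.qHalf)) *
        (1 + algebraMap ℂ _ D.lor.q * (of fun p r : Fin 2 × Fin 2 => D.lor.Eᵀ p.1 p.2 *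
          D.lor.E'ᵀ r.1 r.2).map (algebraMap ℂ S)) := by
    rw [← Algebra.smul_def, ← Algebra.smul_def]
    ext p r
    simp only [map_apply, Matrix.smul_apply, Matrix.add_apply, smul_eq_mul, map_mul, map_add,
      one_apply, apply_ite (algebraMap ℂ S), map_one, map_zero, Algebra.smul_def (A := S), of_apply,
      LorentzCase.EE, transpose_apply, Prod.fst_swap, Prod.snd_swap, Prod.swap_inj, mul_assoc]
  rw [h2]
  exact ((Algebra.commute_algebraMap_right _ _).mul_right
    ((Commute.one_right _).add_right ((Algebra.commute_algebraMap_right _ _).mul_right h1))).eq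

theorem exch_wb_w (h : IsLorentzPair D.lor w wb) : Exch wb w (blk D.Xm) := by
  rw [exch_blk_iff]
  exact ((X_rel_iff _ _ _).mp h.X_rel).symm

theorem exch_w_wb (h : IsLorentzPair D.lor w wb) : Exch w wb (blk D.Xm⁻¹) := by
  rw [exch_blk_iff]
  have h1 := (X_rel_iff _ _ _).mp h.X_rel
  have h2 : (D.Xm⁻¹).map (algebraMap ℂ S) * D.Xm.map (algebraMap ℂ S) = 1 := by
    rw [← map_algebraMap_mul]
    exact (congrArg (fun M => M.map (algebraMap ℂ S)) D.lor.X_inv_mul).trans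
      (Matrix.map_one _ (map_zero _) (map_one _))
  have h3 : D.Xm.map (algebraMap ℂ S) * (D.Xm⁻¹).map (algebraMap ℂ S) = 1 := by
    rw [← map_algebraMap_mul]
    exact (congrArg (fun M => M.map (algebraMap ℂ S)) D.lor.X_mul_inv).trans
      (Matrix.map_one _ (map_zero _) (map_one _))
  calc _ = (D.Xm⁻¹).map (algebraMap ℂ S) * (D.Xm.map (algebraMap ℂ S) * (w ⊗ₖ wb)) *
        (D.Xm⁻¹).map (algebraMap ℂ S) := by
        rw [← Matrix.mul_assoc, h2, Matrix.one_mul]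
    _ = (D.Xm⁻¹).map (algebraMap ℂ S) * ((wb ⊗ₖ w) * D.Xm.map (algebraMap ℂ S)) *
        (D.Xm⁻¹).map (algebraMap ℂ S) := congrArg (fun M => (D.Xm⁻¹).map (algebraMap ℂ S) * M *
          (D.Xm⁻¹).map (algebraMap ℂ S)) h1
    _ = _ := by
      rw [Matrix.mul_assoc, Matrix.mul_assoc (wb ⊗ₖ w), h3, Matrix.mul_one]

/-- `Λ w f(w) = f(w) w Λ`. -/
theorem exch_lamM_w (h : IsLorentzPair D.lor w wb) : Exch (lamM w wb) w D.fw :=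
  (h.exch_w_w.kronecker h.exch_wb_w).map conjV_scalar conjV_cst

/-- `Λ w̄ f(w̄) = f(w̄) w̄ Λ`. -/
theorem exch_lamM_wb (h : IsLorentzPair D.lor w wb) : Exch (lamM w wb) wb D.fwb :=
  (h.exch_w_wb.kronecker h.exch_wb_wb).map conjV_scalar conjV_cst

/-- `ΛΛR = RΛΛ`. -/
theorem lamM_lamM_R (h : IsLorentzPair D.lor w wb) (i j k l : Fin 4) :
    ∑ a, ∑ b, D.R a b k l • (lamM w wb i a * lamM w wb j b) =
      ∑ a, ∑ b, D.R i j a b • (lamM w wb a k * lamM w wb b l) := by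
  have := h.exch_lamM_w.lamM_component h.exch_lamM_wb j k i l
  simp only [D.lamM_f_apply] at this
  rw [Finset.sum_comm, this]

end IsLorentzPair

end QuantumMinkowski

end

noncomputable section

namespace QuantumMinkowski

open Matrix
open scoped Kronecker

/-! ### The inhomogeneous part -/

/-- Scalar multiples of the trivial Lorentz pair by signs of `w`. -/
theorem isLorentzPair_smul_one (L : LorentzCase) {s : ℂ} (hs : s * s = 1) :
    IsLorentzPair L (s • (1 : Matrix (Fin 2) (Fin 2) ℂ)) 1 where
  w_E := by simp [smul_smul, hs]
  E'_w := by simp [smul_smul, hs]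
  wb_E := by simp
  E'_wb := by simp
  X_rel := by
    rw [X_rel_iff, smul_kronecker, kronecker_smul, one_kronecker_one, Matrix.mul_smul, mul_one,
      Matrix.smul_mul, one_mul]

section affine

variable {S : Type} [Ring S]

/-- The matrix of an inhomogeneous transformation with the linear part `a`, the translation `h`
and the scale `d`. -/
def affine (a : Matrix (Fin 4) (Fin 4) S) (h : Fin 4 → S) (d : S) :
    Matrix (Fin 4 ⊕ Unit) (Fin 4 ⊕ Unit) S :=
  fromBlocks a (of fun i _ => h i) 0 (of fun _ _ => d)

variable (a a' : Matrix (Fin 4) (Fin 4) S) (h h' : Fin 4 → S) (d d' : S)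

theorem affine_inl_inl (i j : Fin 4) : affine a h d (Sum.inl i) (Sum.inl j) = a i j := rfl

theorem affine_inl_inr (i : Fin 4) (u : Unit) : affine a h d (Sum.inl i) (Sum.inr u) = h i := rfl

theorem affine_inr_inl (j : Fin 4) (u : Unit) : affine a h d (Sum.inr u) (Sum.inl j) = 0 := rfl

theorem affine_inr_inr (u v : Unit) : affine a h d (Sum.inr u) (Sum.inr v) = d := rfl

theorem affine_mul : affine a h d * affine a' h' d' =
    affine (a * a') (fun i => ∑ k, a i k * h' k + h i * d') (d * d') := by
  rw [affine, affine, fromBlocks_multiply, affine]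
  congr 1
  · simp
  · ext i u
    simp [mul_apply]
  · simp
  · ext u v
    simp [mul_apply]

theorem affine_one : affine (1 : Matrix (Fin 4) (Fin 4) S) 0 1 = 1 := by
  ext (i | i) (j | j) <;> simp [affine, one_apply]

end affine

section star

variable {S n : Type} [Ring S] [Algebra ℂ S] [Fintype n] [DecidableEq n]

/-- The exchange relation with the inverse of a complex conjugate. -/
theorem exch_conj_iff {u : Matrix n n S} {wb : Matrix (Fin 2) (Fin 2) S}
    {g gb : Matrix (Fin 2) (Fin 2) (Matrix n n ℂ)} (hg : conj2 g * gb = 1) :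
    Exch u wb gb ↔ ∀ A B i j, ∑ C, ∑ l, star (g C B l j) • (wb A C * u i l) =
      ∑ C, ∑ l, star (g A C i l) • (u l j * wb C B) := by
  set W := wb.map (scalar n) with hW
  set U := scalar (Fin 2) u with hU
  set G := (conj2 g).map (cst S n) with hG
  set Gb := gb.map (cst S n) with hGb
  have h1 : G * Gb = 1 := by
    rw [hG, hGb, ← Matrix.map_mul, hg, Matrix.map_one _ (map_zero _) (map_one _)]
  have h1' : Gb * G = 1 := by
    rw [hG, hGb, ← Matrix.map_mul, mul_eq_one_comm.mp hg,
      Matrix.map_one _ (map_zero _) (map_one _)]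
  have h2 : Exch u wb gb ↔ W * U * G = G * U * W := by
    rw [Exch]
    constructor
    · intro h
      calc W * U * G = G * (Gb * W * U) * G := by
            rw [mul_assoc Gb, ← mul_assoc G, h1, one_mul]
        _ = G * (U * (W * Gb)) * G := by rw [← h]
        _ = G * U * W * (Gb * G) := by simp only [mul_assoc]
        _ = G * U * W := by rw [h1', mul_one]
    · intro h
      calc U * (W * Gb) = Gb * G * (U * (W * Gb)) := by rw [h1', one_mul]
        _ = Gb * (G * U * W) * Gb := by simp only [mul_assoc]
        _ = Gb * W * U * (G * Gb) := by rw [← h]; simp only [mul_assoc]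
        _ = Gb * W * U := by rw [h1, mul_one]
  rw [h2, ← Matrix.ext_iff]
  refine forall_congr' fun A => forall_congr' fun B => ?_
  rw [← Matrix.ext_iff]
  refine forall_congr' fun i => forall_congr' fun j => ?_
  have e1 : (W * U * G) A B i j = ∑ C, ∑ l, star (g C B l j) • (wb A C * u i l) := by
    rw [mul_apply, Matrix.sum_apply]
    refine Finset.sum_congr rfl fun C _ => ?_
    rw [mul_apply]
    refine Finset.sum_congr rfl fun l _ => ?_
    simp only [hU, hW, hG, scalar_apply, mul_diagonal, map_apply, diagonal_mul, cst_apply, conj2,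
      RingHom.mapMatrix_apply]
    rw [← Algebra.commutes, Algebra.smul_def]
    rfl
  have e2 : (G * U * W) A B i j = ∑ C, ∑ l, star (g A C i l) • (u l j * wb C B) := by
    rw [mul_apply, Matrix.sum_apply]
    refine Finset.sum_congr rfl fun C _ => ?_
    have h4 : (G * U) A C = G A C * u := by rw [hU, scalar_apply, mul_diagonal]
    rw [h4, hW, map_apply, scalar_apply, mul_diagonal, mul_apply, Finset.sum_mul]
    refine Finset.sum_congr rfl fun l _ => ?_
    rw [mul_assoc, Algebra.smul_def]
    rfl
  rw [e1, e2]

/-- The adjoint of an exchange relation. -/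
theorem Exch.of_star [StarRing S] [StarModule ℂ S] {u : Matrix n n S}
    {w wb : Matrix (Fin 2) (Fin 2) S}
    {g gb : Matrix (Fin 2) (Fin 2) (Matrix n n ℂ)} (h : Exch u w g)
    (hu : ∀ i j, star (u i j) = u i j) (hw : ∀ A B, star (w A B) = wb A B)
    (hg : conj2 g * gb = 1) : Exch u wb gb := by
  refine (exch_conj_iff hg).mpr fun A B i j => ?_
  have h3 := congrArg star (exch_iff.mp h A B i j)
  simpa only [star_sum, star_smul, star_mul, hu, hw] using h3

end star

namespace PoincareData

variable (D : PoincareData)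

/-- `w` acting on inhomogeneous vectors. -/
def aw : Matrix (Fin 2) (Fin 2) (Matrix (Fin 4 ⊕ Unit) (Fin 4 ⊕ Unit) ℂ) :=
  of fun A B => affine (D.fw A B) (fun i => D.HV (i, A) B) (if A = B then 1 else 0)

/-- `w̄` acting on inhomogeneous vectors. -/
def awb : Matrix (Fin 2) (Fin 2) (Matrix (Fin 4 ⊕ Unit) (Fin 4 ⊕ Unit) ℂ) :=
  of fun A B => affine (D.fwb A B) (fun i => D.HVt (i, A) B) (if A = B then 1 else 0)

theorem conj_G_mul_Gt : D.G.map (starRingEnd ℂ) * D.Gt = 1 := by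
  ext ⟨i, A⟩ ⟨j, B⟩
  have := congrFun (congrFun (congrFun (congrFun D.conj_fw_mul_fwb A) B) i) j
  rw [mul_apply, Matrix.sum_apply] at this
  simp only [mul_apply, conj2, map_apply, RingHom.mapMatrix_apply, fw_apply, fwb_apply] at this
  rw [mul_apply, Fintype.sum_prod_type, Finset.sum_comm]
  simp only [map_apply]
  rw [this, one_apply, one_apply]
  simp only [Prod.mk.injEq]
  split_ifs <;> simp_all [one_apply]

theorem G_mul_conj_Gt : D.G * D.Gt.map (starRingEnd ℂ) = 1 := by
  have h := congrArg (starRingEnd ℂ).mapMatrix D.conj_G_mul_Gt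
  rw [map_mul, map_one] at h
  have h' : D.G = (starRingEnd ℂ).mapMatrix (D.G.map (starRingEnd ℂ)) := by
    ext i j
    simp
  rw [h']
  exact h

theorem G_mul_inv : D.G * D.G⁻¹ = 1 := by
  rw [inv_eq_right_inv D.G_mul_conj_Gt, G_mul_conj_Gt]

/-- The affine maps for `w̄` are inverse to the complex conjugates of those for `w`: for the
translation parts this is the formula `H̃_V = -τ conj(G⁻¹ H_V)`. -/
theorem conj_aw_mul_awb : conj2 D.aw * D.awb = 1 := by
  have hH : D.G.map (starRingEnd ℂ) * D.HVt = -D.HV.map (starRingEnd ℂ) := by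
    rw [HVt, Matrix.mul_neg, ← Matrix.map_mul, ← Matrix.mul_assoc, G_mul_inv, Matrix.one_mul]
  ext A B : 1
  have h1 : ∀ A C, conj2 D.aw A C = affine (conj2 D.fw A C)
      (fun i => (starRingEnd ℂ) (D.HV (i, A) C)) (if A = C then 1 else 0) := fun A C => by
    ext (i | i) (j | j)
    · rfl
    · rfl
    · exact map_zero (starRingEnd ℂ)
    · simp only [conj2, aw, map_apply, of_apply, RingHom.mapMatrix_apply, affine_inr_inr]
      split_ifs <;> simp
  have h2 := congrFun (congrFun D.conj_fw_mul_fwb A) B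
  rw [mul_apply] at h2 ⊢
  simp only [h1, awb, of_apply, affine_mul]
  ext (i | i) (j | j)
  · simp only [Matrix.sum_apply, affine_inl_inl]
    rw [← Matrix.sum_apply, h2, one_apply, one_apply]
    split_ifs <;> simp [one_apply]
  · simp only [Matrix.sum_apply, affine_inl_inr, mul_ite, mul_one, mul_zero]
    have h3 := congrFun (congrFun hH (i, A)) B
    rw [mul_apply, Fintype.sum_prod_type, Finset.sum_comm] at h3
    simp only [map_apply, Matrix.neg_apply] at h3
    rw [Finset.sum_add_distrib, Finset.sum_ite_eq' Finset.univ B, if_pos (Finset.mem_univ _)]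
    simp only [conj2, map_apply, RingHom.mapMatrix_apply, fw_apply]
    rw [h3, neg_add_cancel, one_apply]
    split_ifs <;> simp
  · simp only [Matrix.sum_apply, affine_inr_inl, Finset.sum_const_zero, one_apply]
    split_ifs <;> simp
  · simp only [Matrix.sum_apply, affine_inr_inr, one_apply]
    fin_cases A <;> fin_cases B <;> simp

/-! #### Inhomogeneous transformations in `ℬ` -/

theorem star_w (A B : Fin 2) : star (D.w A B) = D.wbar A B := StarPres.star_gen _ _

theorem star_y (i : Fin 4) : star (D.y i) = D.y i := StarPres.star_gen _ _

theorem star_lamM {S : Type} [Ring S] [StarRing S] [Algebra ℂ S] [StarModule ℂ S]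
    (w wb : Matrix (Fin 2) (Fin 2) S) (h : ∀ A B, star (w A B) = wb A B) (i j : Fin 4) :
    star (lamM w wb i j) = lamM w wb i j := by
  have h' : ∀ A B, star (wb A B) = w A B := fun A B => by rw [← h, star_star]
  have hV : ∀ A B C E, star (Vinv i A B * V C E j) = Vinv i B A * V E C j := fun A B C E => by
    rw [star_mul', ← conj_V, ← conj_Vinv]; simp
  simp only [lamM_apply, star_sum, star_smul, star_mul, h, h', hV]
  rw [Finset.sum_comm]
  refine Finset.sum_congr rfl fun A _ => Finset.sum_congr rfl fun B _ => Finset.sum_comm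

/-- `w` in `ℬ` as a matrix. -/
abbrev wB : Matrix (Fin 2) (Fin 2) D.Poin := of D.w

/-- `w̄` in `ℬ` as a matrix. -/
abbrev wbB : Matrix (Fin 2) (Fin 2) D.Poin := of D.wbar

theorem Lam_eq (i j : Fin 4) : D.Lam i j = lamM D.wB D.wbB i j := LambdaOf_eq_lamM _ _ _ _

theorem star_Lam (i j : Fin 4) : star (D.Lam i j) = D.Lam i j := by
  rw [Lam_eq]
  exact star_lamM _ _ D.star_w i j

/-- The generic inhomogeneous transformation. -/
def Pm : Matrix (Fin 4 ⊕ Unit) (Fin 4 ⊕ Unit) D.Poin := affine (of D.Lam) D.y 1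

theorem star_Pm (p r : Fin 4 ⊕ Unit) : star (D.Pm p r) = D.Pm p r := by
  rcases p with p | p <;> rcases r with r | r
  · exact D.star_Lam p r
  · exact D.star_y p
  · exact star_zero _
  · exact star_one _

theorem y_mul_w (i : Fin 4) (A B : Fin 2) : D.y i * D.w A B =
    (∑ C, ∑ j, D.G (i, A) (j, C) • (D.w C B * D.y j)) + (∑ C, D.HV (i, A) C • D.w C B) -
      ∑ j, ∑ C, D.HV (j, C) B • (D.Lam i j * D.w A C) := by
  have h := StarPres.mk_eq_zero D.poincareRelators (Or.inr ⟨i, A, B, rfl⟩)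
  simp only [map_sub, map_add, map_sum, map_smul, map_mul, LambdaOf] at h
  rw [sub_eq_zero] at h
  exact h

/-- The exchange relation of the inhomogeneous transformation with `w`: its linear part is the
exchange of `Λ` and `w`, its translation part is the defining relation between `y` and `w`. -/
theorem exch_Pm_w : Exch D.Pm D.wB D.aw := by
  rw [exch_iff]
  have hL := exch_iff.mp D.isLorentzPair_B.exch_lamM_w
  rintro A B (i | i) (j | j)
  · simp only [Fintype.sum_sum_type, aw, of_apply, affine_inl_inl, affine_inr_inl, zero_smul,
      Finset.sum_const_zero, add_zero, Pm, Lam_eq, mul_zero, smul_zero]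
    exact hL A B i j
  · have := D.y_mul_w i A B
    simp only [Fintype.sum_sum_type, aw, of_apply, affine_inl_inl, affine_inl_inr, affine_inr_inr,
      Pm, Finset.sum_add_distrib, ite_smul, one_smul, zero_smul, Finset.univ_unique,
      Finset.sum_singleton, Finset.sum_ite_eq', Finset.mem_univ, if_true, mul_one]
    rw [this]
    simp only [fw_apply]
    rw [Finset.sum_comm, add_sub_cancel]
  · simp [Fintype.sum_sum_type, aw, affine_inr_inl, Pm]
  · simp [Fintype.sum_sum_type, aw, affine_inr_inr, affine_inr_inl, Pm]

theorem exch_Pm_wb : Exch D.Pm D.wbB D.awb :=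
  D.exch_Pm_w.of_star D.star_Pm D.star_w D.conj_aw_mul_awb

end PoincareData

end QuantumMinkowski

end

noncomputable section

namespace QuantumMinkowski

open Matrix
open scoped Kronecker

/-! ### Consistency of the inhomogeneous part -/

section defect

variable {S : Type} [Ring S] [Algebra ℂ S] {n : Type} [Fintype n] [DecidableEq n]

/-- An exchange relation forces the failure of `g E gᵀ = E` to be itself exchanged. -/
theorem Exch.E_defect {u : Matrix n n S} {w : Matrix (Fin 2) (Fin 2) S}
    {g : Matrix (Fin 2) (Fin 2) (Matrix n n ℂ)} (h : Exch u w g) {E : Matrix (Fin 2) (Fin 2) ℂ}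
    (hw : w * E.map (algebraMap ℂ S) * wᵀ = E.map (algebraMap ℂ S))
    {K : Matrix (Fin 2) (Fin 2) (Matrix n n ℂ)}
    (hK : K = g * E.map (algebraMap ℂ (Matrix n n ℂ)) * gᵀ - E.map (algebraMap ℂ _))
    (A C : Fin 2) :
    u * ∑ B, ∑ D, scalar n (w A B * w C D) * cst S n (K B D) = cst S n (K A C) * u := by
  set W := w.map (scalar n) with hW
  set G := g.map (cst S n) with hG
  have h' : ∀ A B, u * (W * G) A B = (G * W) A B * u := fun A B => by
    have := congrFun (congrFun h A) B
    simpa only [scalar_apply, diagonal_mul, mul_diagonal] using this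
  have hc : ∀ A B C E, Commute (W A B) (G C E) := map_scalar_commute_map_cst w g
  have hE : ∀ φ : S →ₐ[ℂ] Matrix n n S,
      (E.map (algebraMap ℂ S)).map φ = E.map (algebraMap ℂ _) := fun φ => by
    ext A B : 1
    simp only [map_apply, AlgHom.commutes]
  have hWE : W * E.map (algebraMap ℂ _) * Wᵀ = E.map (algebraMap ℂ (Matrix n n S)) := by
    have := congrArg (fun M => M.map (scalarAlgHom n ℂ)) hw
    simp only [Matrix.map_mul, hE, transpose_map] at this
    exact this
  have hGE : G * E.map (algebraMap ℂ _) * Gᵀ = K.map (cst S n) + E.map (algebraMap ℂ _) := by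
    have e : ∀ A B, cst S n (algebraMap ℂ (Matrix n n ℂ) (E A B)) = algebraMap ℂ _ (E A B) :=
      fun A B => AlgHom.commutes _ _
    have e' : (E.map (algebraMap ℂ (Matrix n n ℂ))).map (cst S n) = E.map (algebraMap ℂ _) := by
      ext A B : 1
      exact e A B
    have := congrArg (fun M => M.map (cst S n)) (sub_add_cancel
      (g * E.map (algebraMap ℂ (Matrix n n ℂ)) * gᵀ) (E.map (algebraMap ℂ _))).symm
    simp only [Matrix.map_mul, transpose_map, e', Matrix.map_add _ (map_add (cst S n))] at this
    rw [hG, hK]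
    exact this
  have h1 : u * ((W * G) * E.map (algebraMap ℂ (Matrix n n S)) * (W * G)ᵀ) A C =
      ((G * W) * E.map (algebraMap ℂ (Matrix n n S)) * (G * W)ᵀ) A C * u := by
    rw [mul_map_mul_transpose_apply, mul_map_mul_transpose_apply]
    simp only [Finset.mul_sum, Finset.sum_mul, mul_smul_comm, smul_mul_assoc]
    refine Finset.sum_congr rfl fun B _ => Finset.sum_congr rfl fun D _ => ?_
    rw [← mul_assoc, h', mul_assoc, h', mul_assoc]
  rw [mul_E_of_commute _ _ _ hc, mul_E_of_commute _ _ _ fun A B C E => (hc C E A B).symm, hWE,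
    hGE, mul_add, add_mul, hWE, Matrix.add_apply, Matrix.add_apply, mul_add, add_mul, map_apply,
    ← Algebra.commutes, add_left_inj, map_apply] at h1
  rw [← h1]
  congr 1
  rw [mul_apply]
  simp only [mul_apply, Finset.sum_mul]
  rw [Finset.sum_comm]
  refine Finset.sum_congr rfl fun D _ => Finset.sum_congr rfl fun B _ => ?_
  rw [map_apply, transpose_apply, mul_assoc, hW, map_apply, map_apply,
    (commute_scalar_cst _ _).symm.eq, ← mul_assoc, ← map_mul]

/-- An exchange relation forces the failure of the mixed relation to be itself exchanged. -/
theorem Exch.X_defect {u : Matrix n n S} {w wb : Matrix (Fin 2) (Fin 2) S}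
    {g gb : Matrix (Fin 2) (Fin 2) (Matrix n n ℂ)} (h : Exch u w g) (hb : Exch u wb gb)
    {X : Matrix (Fin 2 × Fin 2) (Fin 2 × Fin 2) ℂ}
    (hw : X.map (algebraMap ℂ S) * (w ⊗ₖ wb) = (wb ⊗ₖ w) * X.map (algebraMap ℂ S))
    {K : Matrix (Fin 2 × Fin 2) (Fin 2 × Fin 2) (Matrix n n ℂ)}
    (hK : K = X.map (algebraMap ℂ (Matrix n n ℂ)) * (g ⊗ₖ gb) -
      (gb ⊗ₖ g) * X.map (algebraMap ℂ _))
    (p r : Fin 2 × Fin 2) :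
    u * ∑ t, scalar n ((wb ⊗ₖ w) p t) * cst S n (K t r) =
      (∑ t, cst S n (K p t) * scalar n ((w ⊗ₖ wb) t r)) * u := by
  set W := w.map (scalar n) with hW
  set Wb := wb.map (scalar n) with hWb
  set G := g.map (cst S n) with hG
  set Gb := gb.map (cst S n) with hGb
  set XX := X.map (algebraMap ℂ (Matrix n n S))
  have hXX : ∀ p r, XX p r = algebraMap ℂ _ (X p r) := fun _ _ => rfl
  have h' : ∀ A B, u * (W * G) A B = (G * W) A B * u := fun A B => by
    have := congrFun (congrFun h A) B
    simpa only [scalar_apply, diagonal_mul, mul_diagonal] using this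
  have hb' : ∀ A B, u * (Wb * Gb) A B = (Gb * Wb) A B * u := fun A B => by
    have := congrFun (congrFun hb A) B
    simpa only [scalar_apply, diagonal_mul, mul_diagonal] using this
  have hX : XX * (W ⊗ₖ Wb) = (Wb ⊗ₖ W) * XX := by
    refine (X_rel_iff X W Wb).mp fun A B K M => ?_
    have := congrArg (scalarAlgHom n ℂ) ((X_rel_iff X w wb).mpr hw A B K M)
    simp only [map_sum, map_smul, map_mul] at this
    exact this
  have hKm : K.map (cst S n) = XX * (G ⊗ₖ Gb) - (Gb ⊗ₖ G) * XX := by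
    ext p r : 1
    simp only [hK, XX, map_apply, Matrix.sub_apply, mul_apply, map_sub, map_sum, map_mul,
      kroneckerMap_apply, AlgHom.commutes, hG, hGb]
  have h1 : u * (XX * ((W * G) ⊗ₖ (Wb * Gb)) - ((Wb * Gb) ⊗ₖ (W * G)) * XX) p r =
      (XX * ((G * W) ⊗ₖ (Gb * Wb)) - ((Gb * Wb) ⊗ₖ (G * W)) * XX) p r * u := by
    have e1 : ∀ A B C E, u * ((W * G) A B * (Wb * Gb) C E) = (G * W) A B * (Gb * Wb) C E * u :=
      fun A B C E => by rw [← mul_assoc, h', mul_assoc, hb', mul_assoc]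
    have e2 : ∀ A B C E, u * ((Wb * Gb) A B * (W * G) C E) = (Gb * Wb) A B * (G * W) C E * u :=
      fun A B C E => by rw [← mul_assoc, hb', mul_assoc, h', mul_assoc]
    rw [Matrix.sub_apply, Matrix.sub_apply, mul_sub, sub_mul, mul_mul_entry, mul_entry_mul,
      mul_mul_entry, mul_entry_mul]
    congr 1 <;> refine Finset.sum_congr rfl fun t _ => ?_
    · rw [hXX, ← mul_assoc, ← Algebra.commutes, mul_assoc, kroneckerMap_apply, e1,
        kroneckerMap_apply, ← mul_assoc]
    · rw [hXX, ← mul_assoc, kroneckerMap_apply, e2, kroneckerMap_apply, mul_assoc,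
        ← Algebra.commutes, ← mul_assoc]
  have c : ∀ A B C E, Commute (Wb A B) (G C E) := map_scalar_commute_map_cst wb g
  have c' : ∀ A B C E, Commute (W A B) (Gb C E) := map_scalar_commute_map_cst w gb
  rw [kronecker_mul_of_commute _ _ _ _ c, kronecker_mul_of_commute _ _ _ _ c',
    kronecker_mul_of_commute _ _ _ _ fun A B C E => (c' C E A B).symm,
    kronecker_mul_of_commute _ _ _ _ fun A B C E => (c C E A B).symm, ← Matrix.mul_assoc, hX,
    Matrix.mul_assoc, Matrix.mul_assoc, ← Matrix.mul_sub, ← Matrix.mul_assoc XX,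
    Matrix.mul_assoc (Gb ⊗ₖ G), ← hX, ← Matrix.mul_assoc (Gb ⊗ₖ G), ← Matrix.sub_mul, ← hKm] at h1
  rw [mul_apply, mul_apply] at h1
  simp only [map_apply, kroneckerMap_apply, hW, hWb] at h1
  simp only [kroneckerMap_apply, map_mul]
  exact h1

end defect

namespace PoincareData

variable (D : PoincareData)

theorem incl_wA (A B : Fin 2) : D.incl (D.wA A B) = D.w A B := StarPres.lift_gen _ _ _ _ _

theorem incl_wbarA (A B : Fin 2) : D.incl (D.wbarA A B) = D.wbar A B := StarPres.lift_gen _ _ _ _ _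

/-- `Λ` in `𝒜`. -/
abbrev LamA : Matrix (Fin 4) (Fin 4) D.Lor := lamM (of D.wA) (of D.wbarA)

theorem incl_LamA (i j : Fin 4) : D.incl (D.LamA i j) = D.Lam i j := by
  have h := congrFun (congrFun (lamM_map D.incl (of D.wA) (of D.wbarA)) i) j
  have h1 : (of D.wA).map D.incl = of D.w := by ext A B; exact D.incl_wA A B
  have h2 : (of D.wbarA).map D.incl = of D.wbar := by ext A B; exact D.incl_wbarA A B
  rw [h1, h2] at h
  rw [Lam_eq]
  exact h

/-- The part of the freeness hypothesis that concerns `I` says that `𝒜` embeds in `ℬ`. -/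
theorem eq_zero_of_incl_eq_zero {D : PoincareData} (hD : D.IsQuantumPoincareGroup) {a : D.Lor}
    (h : D.incl a = 0) : a = 0 := by
  obtain ⟨u, -, -, h3⟩ := hD
  exact (h3 0 0 a (by simp [h])).2.2

/-- The character `w ↦ -1`, `w̄ ↦ 1` of `𝒜`. -/
def signChar : D.Lor →ₐ[ℂ] ℂ :=
  lorLift (isLorentzPair_smul_one D.lor (s := -1) (by norm_num))

theorem signChar_wA (A B : Fin 2) : D.signChar (D.wA A B) = if A = B then -1 else 0 := by
  rw [signChar, lorLift_wA]
  simp [one_apply, apply_ite]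

theorem signChar_wbarA (A B : Fin 2) : D.signChar (D.wbarA A B) = if A = B then 1 else 0 := by
  rw [signChar, lorLift_wbarA, one_apply]

theorem signChar_LamA (i j : Fin 4) : D.signChar (D.LamA i j) = if i = j then -1 else 0 := by
  have h := congrFun (congrFun (lamM_map D.signChar (of D.wA) (of D.wbarA)) i) j
  have h2 : (of D.wA).map D.signChar = (-1 : ℂ) • (1 : Matrix (Fin 2) (Fin 2) ℂ) := by
    ext A C
    rw [map_apply, of_apply, signChar_wA, Matrix.smul_apply, one_apply]
    split_ifs <;> simp
  have h3 : (of D.wbarA).map D.signChar = (1 : Matrix (Fin 2) (Fin 2) ℂ) := by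
    ext A C
    rw [map_apply, of_apply, signChar_wbarA, one_apply]
  have h4 : lamM ((-1 : ℂ) • (1 : Matrix (Fin 2) (Fin 2) ℂ)) 1 = (-1 : ℂ) • 1 := by
    rw [← lamM_one, lamM, lamM, smul_kronecker, map_smul]
  rw [map_apply, h2, h3, h4, Matrix.smul_apply, one_apply] at h
  rw [h]
  split_ifs <;> simp

theorem sum_entry_mul_affine {S : Type} [Ring S] [Algebra ℂ S] {ι : Type} [Fintype ι]
    (P : Matrix (Fin 4 ⊕ Unit) (Fin 4 ⊕ Unit) S) (a : ι → S) (k : ι → Fin 4 → ℂ) (i : Fin 4) :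
    (P * ∑ t, scalar (Fin 4 ⊕ Unit) (a t) * cst S _ (affine 0 (k t) 0)) (Sum.inl i) (Sum.inr ()) =
      ∑ l, P (Sum.inl i) (Sum.inl l) * ∑ t, k t l • a t := by
  rw [mul_apply, Fintype.sum_sum_type]
  simp [Matrix.sum_apply, cst_apply, affine_inl_inr, affine_inr_inr, Algebra.smul_def,
    Algebra.commutes]

/-- Since the linear part `f` respects `(w ⊗ w) E = E`, the failure of the inhomogeneous
transformations to do so is a translation. -/
theorem exists_affine_E_defect : ∃ k : Fin 2 → Fin 2 → Fin 4 → ℂ,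
    D.aw * D.lor.E.map (algebraMap ℂ (Matrix (Fin 4 ⊕ Unit) (Fin 4 ⊕ Unit) ℂ)) * D.awᵀ -
      D.lor.E.map (algebraMap ℂ (Matrix (Fin 4 ⊕ Unit) (Fin 4 ⊕ Unit) ℂ)) =
        of fun A C => affine 0 (k A C) 0 := by
  refine ⟨fun A C i => (D.aw * D.lor.E.map (algebraMap ℂ (Matrix (Fin 4 ⊕ Unit) (Fin 4 ⊕ Unit) ℂ)) *
    D.awᵀ - D.lor.E.map (algebraMap ℂ (Matrix (Fin 4 ⊕ Unit) (Fin 4 ⊕ Unit) ℂ))) A C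
      (Sum.inl i) (Sum.inr ()), ?_⟩
  ext A C (i | i) (j | j)
  · have h := congrFun (congrFun (congrFun (congrFun D.isLorentzPair_f.w_E A) C) i) j
    rw [mul_map_mul_transpose_apply, map_apply, algebraMap_matrix_apply] at h
    rw [Matrix.sub_apply, mul_map_mul_transpose_apply, Matrix.sub_apply, of_apply, affine_inl_inl,
      map_apply, algebraMap_matrix_apply, Matrix.zero_apply, sub_eq_zero]
    simp only [Matrix.sum_apply, Matrix.smul_apply, aw, of_apply, affine_mul, affine_inl_inl] at h ⊢
    rw [h]
    simp
  · rfl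
  · rw [Matrix.sub_apply, mul_map_mul_transpose_apply, Matrix.sub_apply, of_apply, affine_inr_inl,
      map_apply, algebraMap_matrix_apply]
    simp [Matrix.sum_apply, aw, affine_mul, affine_inr_inl]
  · rw [Matrix.sub_apply, mul_map_mul_transpose_apply, Matrix.sub_apply, of_apply, affine_inr_inr,
      map_apply, algebraMap_matrix_apply]
    simp only [Matrix.sum_apply, aw, of_apply, affine_mul, Fin.sum_univ_two]
    fin_cases A <;> fin_cases C <;> simp [affine_inr_inr]

/-- The failure of the inhomogeneous transformations to satisfy the mixed relation is a
translation. -/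
theorem exists_affine_X_defect : ∃ k : Fin 2 × Fin 2 → Fin 2 × Fin 2 → Fin 4 → ℂ,
    D.lor.X.map (algebraMap ℂ (Matrix (Fin 4 ⊕ Unit) (Fin 4 ⊕ Unit) ℂ)) * (D.aw ⊗ₖ D.awb) -
      (D.awb ⊗ₖ D.aw) * D.lor.X.map (algebraMap ℂ (Matrix (Fin 4 ⊕ Unit) (Fin 4 ⊕ Unit) ℂ)) =
        of fun p r => affine 0 (k p r) 0 := by
  refine ⟨fun p r i => (D.lor.X.map (algebraMap ℂ (Matrix (Fin 4 ⊕ Unit) (Fin 4 ⊕ Unit) ℂ)) *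
    (D.aw ⊗ₖ D.awb) - (D.awb ⊗ₖ D.aw) *
      D.lor.X.map (algebraMap ℂ (Matrix (Fin 4 ⊕ Unit) (Fin 4 ⊕ Unit) ℂ))) p r
      (Sum.inl i) (Sum.inr ()), ?_⟩
  have e1 : ∀ p r x y, (D.lor.X.map (algebraMap ℂ (Matrix (Fin 4 ⊕ Unit) (Fin 4 ⊕ Unit) ℂ)) *
      (D.aw ⊗ₖ D.awb)) p r x y =
      ∑ C, ∑ E, D.lor.X p (C, E) • (D.aw C r.1 * D.awb E r.2) x y := fun p r x y => by
    rw [mul_apply, Fintype.sum_prod_type]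
    simp only [map_apply, ← Algebra.smul_def, kroneckerMap_apply, Matrix.sum_apply,
      Matrix.smul_apply]
  have e2 : ∀ p r x y, ((D.awb ⊗ₖ D.aw) *
      D.lor.X.map (algebraMap ℂ (Matrix (Fin 4 ⊕ Unit) (Fin 4 ⊕ Unit) ℂ))) p r x y =
      ∑ C, ∑ E, D.lor.X (C, E) r • (D.awb p.1 C * D.aw p.2 E) x y := fun p r x y => by
    rw [mul_apply, Fintype.sum_prod_type]
    simp only [map_apply, ← Algebra.commutes, ← Algebra.smul_def, kroneckerMap_apply,
      Matrix.sum_apply, Matrix.smul_apply]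
  ext ⟨A, B⟩ ⟨K, M⟩ (i | i) (j | j)
  · have h := congrFun (congrFun (D.isLorentzPair_f.X_rel A B K M) i) j
    rw [Matrix.sub_apply, Matrix.sub_apply, e1, e2, of_apply, affine_inl_inl, Matrix.zero_apply,
      sub_eq_zero]
    simp only [Matrix.sum_apply, Matrix.smul_apply, aw, awb, of_apply, affine_mul,
      affine_inl_inl] at h ⊢
    exact h
  · rfl
  · rw [Matrix.sub_apply, Matrix.sub_apply, e1, e2]
    simp [aw, awb, affine_mul, affine_inr_inl]
  · rw [Matrix.sub_apply, Matrix.sub_apply, e1, e2]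
    simp [aw, awb, affine_mul, affine_inr_inr]

variable {D}

/-- The inhomogeneous transformations form a Lorentz pair. The failure of the relations is a
translation which is covariant under `𝒜`; applied to it, the character `w ↦ -1`, `w̄ ↦ 1` gives
that it is equal to its negative. -/
theorem isLorentzPair_aw (hD : D.IsQuantumPoincareGroup) :
    IsLorentzPair D.lor D.aw D.awb := by
  refine isLorentzPair_of_conj D.lor ?_ ?_ D.conj_aw_mul_awb
  · obtain ⟨k, hk⟩ := D.exists_affine_E_defect
    rw [← sub_eq_zero, hk]
    suffices k = 0 by
      subst this
      ext A C (i | i) (j | j) <;> rfl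
    ext A C i
    have h1 := congrFun (congrFun (D.exch_Pm_w.E_defect D.isLorentzPair_B.w_E hk.symm A C)
      (Sum.inl i)) (Sum.inr ())
    have h2 : D.incl (∑ l, D.LamA i l * ∑ t : Fin 2 × Fin 2,
        k t.1 t.2 l • (D.wA A t.1 * D.wA C t.2) - algebraMap ℂ _ (k A C i)) = 0 := by
      simp only [map_sub, map_sum, map_mul, map_smul, incl_LamA, incl_wA, AlgHom.commutes]
      rw [sub_eq_zero]
      refine Eq.trans ?_ (h1.trans ?_)
      · refine (sum_entry_mul_affine D.Pm (fun t : Fin 2 × Fin 2 => D.w A t.1 * D.w C t.2)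
          (fun t => k t.1 t.2) i).symm.trans ?_
        rw [Fintype.sum_prod_type]
        rfl
      · rw [mul_apply, Fintype.sum_sum_type]
        simp [cst_apply, affine_inl_inr, affine_inl_inl, Pm, affine_inr_inr]
    -- The character maps `Λ` to `-1` and `w ⊗ w` to `1`, so the covariance of `k` becomes `-k = k`.
    have h3 := congrArg D.signChar (eq_zero_of_incl_eq_zero hD h2)
    simp only [map_sub, map_sum, map_mul, map_smul, signChar_LamA, signChar_wA, AlgHom.commutes,
      map_zero, ite_mul, mul_ite, zero_mul, mul_zero, Finset.sum_ite_eq, Finset.mem_univ, if_true,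
      smul_eq_mul, Fintype.sum_prod_type] at h3
    have h4 : -(k A C i) - k A C i = 0 := by simpa using h3
    rw [Pi.zero_apply, Pi.zero_apply, Pi.zero_apply]
    linear_combination (-1 / 2 : ℂ) * h4
  · obtain ⟨k, hk⟩ := D.exists_affine_X_defect
    rw [← sub_eq_zero, hk]
    suffices k = 0 by
      subst this
      ext A C (i | i) (j | j) <;> rfl
    ext p r i
    have h1 := congrFun (congrFun (D.exch_Pm_w.X_defect D.exch_Pm_wb
      ((X_rel_iff _ _ _).mp D.isLorentzPair_B.X_rel) hk.symm p r) (Sum.inl i)) (Sum.inr ())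
    have h2 : D.incl (∑ l, D.LamA i l * ∑ t : Fin 2 × Fin 2,
        k t r l • (D.wbarA p.1 t.1 * D.wA p.2 t.2) -
          ∑ t : Fin 2 × Fin 2, k p t i • (D.wA t.1 r.1 * D.wbarA t.2 r.2)) = 0 := by
      simp only [map_sub, map_sum, map_mul, map_smul, incl_LamA, incl_wA, incl_wbarA]
      rw [sub_eq_zero]
      refine Eq.trans ?_ (h1.trans ?_)
      · simp only [of_apply]
        rw [sum_entry_mul_affine]
        rfl
      · rw [mul_apply, Fintype.sum_sum_type]
        simp [cst_apply, affine_inl_inr, affine_inl_inl, Pm, affine_inr_inr, Matrix.sum_apply,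
          Algebra.smul_def]
    -- Here `Λ`, `w̄ ⊗ w` and `w ⊗ w̄` are all mapped to `-1`, and the covariance becomes `k = -k`.
    have h3 := congrArg D.signChar (eq_zero_of_incl_eq_zero hD h2)
    simp only [map_sub, map_sum, map_mul, map_smul, signChar_LamA, signChar_wA, signChar_wbarA,
      map_zero, ite_mul, mul_ite, zero_mul, mul_zero, Finset.sum_ite_eq, Finset.sum_ite_eq',
      Finset.mem_univ, if_true,
      smul_eq_mul, Fintype.sum_prod_type] at h3
    have h4 : k p r i + k p r i = 0 := by simpa using h3
    rw [Pi.zero_apply, Pi.zero_apply, Pi.zero_apply]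
    linear_combination (1 / 2 : ℂ) * h4

end PoincareData

end QuantumMinkowski

end

noncomputable section

namespace QuantumMinkowski

open Matrix
open scoped Kronecker

/-! ### Vectors acted on by inhomogeneous transformations -/

namespace PoincareData

variable (D : PoincareData)

/-- `Z^{ij}_k` is the translation part of `Λ^j_k`. -/
theorem lamM_aw_apply_inr (i j k : Fin 4) (u : Unit) :
    lamM D.aw D.awb j k (Sum.inl i) (Sum.inr u) = D.Z i j k := by
  rw [lamM_apply, Z]
  simp only [Matrix.sum_apply, Matrix.smul_apply, aw, awb, of_apply, affine_mul, affine_inl_inr,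
    fw_apply, smul_eq_mul]
  refine Finset.sum_congr rfl fun A _ => Finset.sum_congr rfl fun B _ =>
    Finset.sum_congr rfl fun C _ => Finset.sum_congr rfl fun E _ => ?_
  ring

theorem lamM_aw_apply_inl (i j k l : Fin 4) :
    lamM D.aw D.awb j k (Sum.inl i) (Sum.inl l) = D.R i j k l := by
  rw [← lamM_f_apply, lamM_apply, lamM_apply]
  simp only [Matrix.sum_apply, Matrix.smul_apply, aw, awb, of_apply, affine_mul, affine_inl_inl]

theorem lamM_aw_apply_inr_inr (j k : Fin 4) (u v : Unit) :
    lamM D.aw D.awb j k (Sum.inr u) (Sum.inr v) = if j = k then 1 else 0 := by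
  have h := congrFun (congrFun (lamM_one (S := ℂ)) j) k
  rw [lamM_apply, one_apply] at h
  rw [lamM_apply, ← h]
  simp only [Matrix.sum_apply, Matrix.smul_apply, aw, awb, of_apply, affine_mul, affine_inr_inr,
    one_apply]

variable {S : Type} [Ring S] [Algebra ℂ S] {w wb : Matrix (Fin 2) (Fin 2) S} {y : Fin 4 → S}

/-- The commutation rule of the translations with `Λ`. -/
theorem y_mul_lamM (hw : Exch (affine (lamM w wb) y 1) w D.aw)
    (hwb : Exch (affine (lamM w wb) y 1) wb D.awb) (i j k : Fin 4) :
    y i * lamM w wb j k + ∑ c, ∑ l, D.Z l c k • (lamM w wb i l * lamM w wb j c) =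
      ∑ c, ∑ l, D.R i j c l • (lamM w wb c k * y l) + ∑ c, D.Z i j c • lamM w wb c k := by
  have h := hw.lamM_component hwb j k (Sum.inl i) (Sum.inr ())
  simp only [Fintype.sum_sum_type, lamM_aw_apply_inl, lamM_aw_apply_inr, lamM_aw_apply_inr_inr,
    affine_inl_inl, affine_inl_inr, affine_inr_inr, Finset.sum_add_distrib, Finset.univ_unique,
    Finset.sum_singleton, ite_smul, one_smul, zero_smul, Finset.sum_ite_eq', Finset.mem_univ,
    if_true, mul_one] at h
  rw [← h, add_comm]

end PoincareData

/-! ### The counit, the antipode and `f` -/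

/-- The inverse of `v ⊗ u` has the entries `u' v'`, with the order of the factors reversed. -/
theorem kronecker_mul_reversed {S : Type} [Ring S]
    {v v' u u' : Matrix (Fin 2) (Fin 2) S} (hv : v * v' = 1)
    (hu : u * u' = 1) : (v ⊗ₖ u) * (of fun p r : Fin 2 × Fin 2 => u' p.2 r.2 * v' p.1 r.1) = 1 := by
  ext ⟨a, b⟩ ⟨c, d⟩
  rw [mul_apply, Fintype.sum_prod_type]
  simp only [kroneckerMap_apply, of_apply]
  have h1 : ∀ x, ∑ y, v a x * u b y * (u' y d * v' x c) = v a x * (u * u') b d * v' x c :=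
    fun x => by
      rw [mul_apply, Finset.mul_sum, Finset.sum_mul]
      exact Finset.sum_congr rfl fun y _ => by simp only [mul_assoc]
  simp only [h1, hu]
  have h2 : ∑ x, v a x * (1 : Matrix (Fin 2) (Fin 2) S) b d * v' x c =
      (v * v') a c * (1 : Matrix (Fin 2) (Fin 2) S) b d := by
    rw [mul_apply, Finset.sum_mul]
    refine Finset.sum_congr rfl fun x _ => ?_
    rw [one_apply]; split_ifs <;> simp
  rw [h2, hv, one_apply, one_apply, one_apply]
  simp only [Prod.mk.injEq]
  split_ifs <;> simp_all

theorem reversed_mul_kronecker {S : Type} [Ring S]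
    {v v' u u' : Matrix (Fin 2) (Fin 2) S} (hv : v' * v = 1)
    (hu : u' * u = 1) : (of fun p r : Fin 2 × Fin 2 => u' p.2 r.2 * v' p.1 r.1) * (v ⊗ₖ u) = 1 := by
  ext ⟨a, b⟩ ⟨c, d⟩
  rw [mul_apply, Fintype.sum_prod_type_right]
  simp only [kroneckerMap_apply, of_apply]
  have h1 : ∀ y, ∑ x, u' b y * v' a x * (v x c * u y d) = u' b y * (v' * v) a c * u y d :=
    fun x => by
      rw [mul_apply, Finset.mul_sum, Finset.sum_mul]
      exact Finset.sum_congr rfl fun y _ => by simp only [mul_assoc]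
  simp only [h1, hv]
  have h2 : ∑ y, u' b y * (1 : Matrix (Fin 2) (Fin 2) S) a c * u y d =
      (u' * u) b d * (1 : Matrix (Fin 2) (Fin 2) S) a c := by
    rw [mul_apply, Finset.sum_mul]
    refine Finset.sum_congr rfl fun x _ => ?_
    rw [one_apply]; split_ifs <;> simp
  rw [h2, hu, one_apply, one_apply, one_apply]
  simp only [Prod.mk.injEq]
  split_ifs <;> simp_all

section antipode

variable {S : Type} [Ring S] [Algebra ℂ S] {w wb : Matrix (Fin 2) (Fin 2) S}

/-- The inverse of `w`. -/
def winv (E E' : Matrix (Fin 2) (Fin 2) ℂ) (w : Matrix (Fin 2) (Fin 2) S) :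
    Matrix (Fin 2) (Fin 2) S :=
  E.map (algebraMap ℂ S) * wᵀ * E'.map (algebraMap ℂ S)

variable {E E' : Matrix (Fin 2) (Fin 2) ℂ}

theorem mul_winv (h : E * E' = 1) (hw : w * E.map (algebraMap ℂ S) * wᵀ = E.map (algebraMap ℂ S)) :
    w * winv E E' w = 1 := by
  rw [winv, ← Matrix.mul_assoc, ← Matrix.mul_assoc, hw, ← map_algebraMap_mul, h,
    Matrix.map_one _ (map_zero _) (map_one _)]

theorem winv_mul (h : E * E' = 1)
    (hw : wᵀ * E'.map (algebraMap ℂ S) * w = E'.map (algebraMap ℂ S)) :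
    winv E E' w * w = 1 := by
  rw [winv, Matrix.mul_assoc, Matrix.mul_assoc, ← Matrix.mul_assoc wᵀ, hw, ← map_algebraMap_mul, h,
    Matrix.map_one _ (map_zero _) (map_one _)]

theorem transpose_winv : (winv E E' w)ᵀ =
    E'ᵀ.map (algebraMap ℂ S) * w * Eᵀ.map (algebraMap ℂ S) := by
  rw [winv, transpose_mul_map, transpose_map_mul, transpose_transpose, Matrix.mul_assoc]

theorem winv_rel (h : E * E' = 1)
    (hw : wᵀ * E'.map (algebraMap ℂ S) * w = E'.map (algebraMap ℂ S)) :
    winv E E' w * Eᵀ.map (algebraMap ℂ S) * (winv E E' w)ᵀ = Eᵀ.map (algebraMap ℂ S) := by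
  have h' : Eᵀ * E'ᵀ = 1 := by
    rw [← transpose_mul, mul_eq_one_comm.mp h, transpose_one]
  have e : Eᵀ.map (algebraMap ℂ S) * E'ᵀ.map (algebraMap ℂ S) = 1 := by
    rw [← map_algebraMap_mul, h', Matrix.map_one _ (map_zero _) (map_one _)]
  calc _ = winv E E' w * (Eᵀ.map (algebraMap ℂ S) * E'ᵀ.map (algebraMap ℂ S)) * w *
        Eᵀ.map (algebraMap ℂ S) := by rw [transpose_winv]; simp only [Matrix.mul_assoc]
    _ = _ := by rw [e, Matrix.mul_one, winv_mul h hw, Matrix.one_mul]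

theorem winv_rel' (h : E * E' = 1)
    (hw : w * E.map (algebraMap ℂ S) * wᵀ = E.map (algebraMap ℂ S)) :
    (winv E E' w)ᵀ * E'ᵀ.map (algebraMap ℂ S) * winv E E' w = E'ᵀ.map (algebraMap ℂ S) := by
  have h' : Eᵀ * E'ᵀ = 1 := by
    rw [← transpose_mul, mul_eq_one_comm.mp h, transpose_one]
  have e : Eᵀ.map (algebraMap ℂ S) * E'ᵀ.map (algebraMap ℂ S) = 1 := by
    rw [← map_algebraMap_mul, h', Matrix.map_one _ (map_zero _) (map_one _)]
  calc _ = E'ᵀ.map (algebraMap ℂ S) * w * (Eᵀ.map (algebraMap ℂ S) * E'ᵀ.map (algebraMap ℂ S)) *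
        winv E E' w := by rw [transpose_winv]; simp only [Matrix.mul_assoc]
    _ = _ := by rw [e, Matrix.mul_one, Matrix.mul_assoc, mul_winv h hw, Matrix.mul_one]

theorem op_E_rel {v : Matrix (Fin 2) (Fin 2) S}
    (h : v * Eᵀ.map (algebraMap ℂ S) * vᵀ = Eᵀ.map (algebraMap ℂ S)) :
    v.map MulOpposite.op * E.map (algebraMap ℂ Sᵐᵒᵖ) * (v.map MulOpposite.op)ᵀ =
      E.map (algebraMap ℂ Sᵐᵒᵖ) := by
  ext A C : 1
  have h1 := congrArg MulOpposite.op (congrFun (congrFun h C) A)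
  rw [mul_map_mul_transpose_apply] at h1 ⊢
  rw [Finset.sum_comm]
  simp only [map_apply, transpose_apply, Finset.op_sum, MulOpposite.op_smul,
    MulOpposite.op_mul] at h1 ⊢
  exact h1

theorem op_E'_rel {v : Matrix (Fin 2) (Fin 2) S}
    (h : vᵀ * E'ᵀ.map (algebraMap ℂ S) * v = E'ᵀ.map (algebraMap ℂ S)) :
    (v.map MulOpposite.op)ᵀ * E'.map (algebraMap ℂ Sᵐᵒᵖ) * v.map MulOpposite.op =
      E'.map (algebraMap ℂ Sᵐᵒᵖ) := by
  ext A C : 1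
  have h1 := congrArg MulOpposite.op (congrFun (congrFun h C) A)
  rw [transpose_mul_map_mul_apply] at h1 ⊢
  rw [Finset.sum_comm]
  simp only [map_apply, transpose_apply, Finset.op_sum, MulOpposite.op_smul,
    MulOpposite.op_mul] at h1 ⊢
  exact h1

variable {L : LorentzCase}

/-- The inverses of `w` and `w̄` form a Lorentz pair in the opposite algebra. -/
theorem IsLorentzPair.op_inv (h : IsLorentzPair L w wb) :
    IsLorentzPair L ((winv L.E L.E' w).map MulOpposite.op)
      ((winv L.Eᵀ L.E'ᵀ wb).map MulOpposite.op) := by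
  have hT : L.Eᵀ * L.E'ᵀ = 1 := by rw [← transpose_mul, L.E'_mul_E, transpose_one]
  refine ⟨op_E_rel (winv_rel L.E_mul_E' h.E'_w), op_E'_rel (winv_rel' L.E_mul_E' h.w_E),
    op_E_rel (winv_rel hT h.E'_wb), op_E'_rel (winv_rel' hT h.wb_E), ?_⟩
  intro A B K M
  set s := winv L.E L.E' w
  set sb := winv L.Eᵀ L.E'ᵀ wb
  have h1 := (X_rel_iff _ _ _).mp h.X_rel
  set N := of fun p r : Fin 2 × Fin 2 => sb p.2 r.2 * s p.1 r.1
  set N' := of fun p r : Fin 2 × Fin 2 => s p.2 r.2 * sb p.1 r.1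
  have hN : (w ⊗ₖ wb) * N = 1 :=
    kronecker_mul_reversed (mul_winv L.E_mul_E' h.w_E) (mul_winv hT h.wb_E)
  have hN' : N' * (wb ⊗ₖ w) = 1 :=
    reversed_mul_kronecker (winv_mul hT h.E'_wb) (winv_mul L.E_mul_E' h.E'_w)
  have h2 : L.X.map (algebraMap ℂ S) * N = N' * L.X.map (algebraMap ℂ S) := by
    calc _ = N' * ((wb ⊗ₖ w) * L.X.map (algebraMap ℂ S)) * N := by
          rw [← Matrix.mul_assoc, hN', Matrix.one_mul]
      _ = N' * (L.X.map (algebraMap ℂ S) * ((w ⊗ₖ wb) * N)) := by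
          rw [← h1]; simp only [Matrix.mul_assoc]
      _ = _ := by rw [hN, Matrix.mul_one]
  have h3 := congrArg MulOpposite.op (congrFun (congrFun h2 (A, B)) (K, M))
  simp only [mul_apply, Fintype.sum_prod_type, map_apply, N, N', of_apply, ← Algebra.commutes,
    ← Algebra.smul_def, Finset.op_sum, MulOpposite.op_smul, MulOpposite.op_mul] at h3
  exact h3

end antipode

namespace PoincareData

variable (D : PoincareData)

/-- The counit of `𝒜`. -/
def eps : D.Lor →ₐ[ℂ] ℂ := lorLift (isLorentzPair_smul_one D.lor (s := 1) (one_mul 1))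

theorem eps_wA (A B : Fin 2) : D.eps (D.wA A B) = if A = B then 1 else 0 := by
  rw [eps, lorLift_wA, one_smul, one_apply]

theorem eps_wbarA (A B : Fin 2) : D.eps (D.wbarA A B) = if A = B then 1 else 0 := by
  rw [eps, lorLift_wbarA, one_apply]

theorem eps_LamA (i j : Fin 4) : D.eps (D.LamA i j) = if i = j then 1 else 0 := by
  have h := congrFun (congrFun (lamM_map D.eps (of D.wA) (of D.wbarA)) i) j
  have h2 : (of D.wA).map D.eps = 1 := by
    ext A C
    rw [map_apply, of_apply, eps_wA, one_apply]
  have h3 : (of D.wbarA).map D.eps = 1 := by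
    ext A C
    rw [map_apply, of_apply, eps_wbarA, one_apply]
  rw [h2, h3, lamM_one, one_apply] at h
  exact h

/-- The inverse of `w` in `𝒜`. -/
abbrev wAinv : Matrix (Fin 2) (Fin 2) D.Lor := winv D.lor.E D.lor.E' (of D.wA)

/-- The inverse of `w̄` in `𝒜`. -/
abbrev wbarAinv : Matrix (Fin 2) (Fin 2) D.Lor := winv D.lor.Eᵀ D.lor.E'ᵀ (of D.wbarA)

theorem Et_mul_E't : D.lor.Eᵀ * D.lor.E'ᵀ = 1 := by
  rw [← transpose_mul, D.lor.E'_mul_E, transpose_one]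

theorem wA_mul_inv : of D.wA * D.wAinv = 1 := mul_winv D.lor.E_mul_E' D.isLorentzPair_A.w_E

theorem inv_mul_wA : D.wAinv * of D.wA = 1 := winv_mul D.lor.E_mul_E' D.isLorentzPair_A.E'_w

theorem wbarA_mul_inv : of D.wbarA * D.wbarAinv = 1 :=
  mul_winv D.Et_mul_E't D.isLorentzPair_A.wb_E

theorem inv_mul_wbarA : D.wbarAinv * of D.wbarA = 1 :=
  winv_mul D.Et_mul_E't D.isLorentzPair_A.E'_wb

/-- The antipode of `𝒜`. -/
def anti : D.Lor →ₐ[ℂ] D.Lorᵐᵒᵖ := lorLift D.isLorentzPair_A.op_inv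

theorem anti_wA (A B : Fin 2) : (D.anti (D.wA A B)).unop = D.wAinv A B := by
  rw [anti, lorLift_wA]; rfl

theorem anti_wbarA (A B : Fin 2) : (D.anti (D.wbarA A B)).unop = D.wbarAinv A B := by
  rw [anti, lorLift_wbarA]; rfl

/-- The homomorphism `f`. -/
def fhom : D.Lor →ₐ[ℂ] Matrix (Fin 4) (Fin 4) ℂ := lorLift D.isLorentzPair_f

theorem fhom_wA (A B : Fin 2) : D.fhom (D.wA A B) = D.fw A B := lorLift_wA _ _ _

theorem fhom_wbarA (A B : Fin 2) : D.fhom (D.wbarA A B) = D.fwb A B := lorLift_wbarA _ _ _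

theorem fhom_LamA (i j k l : Fin 4) : D.fhom (D.LamA j k) i l = D.R i j k l := by
  have h := congrFun (congrFun (lamM_map D.fhom (of D.wA) (of D.wbarA)) j) k
  have h2 : (of D.wA).map D.fhom = D.fw := by
    ext A C : 1
    exact D.fhom_wA A C
  have h3 : (of D.wbarA).map D.fhom = D.fwb := by
    ext A C : 1
    exact D.fhom_wbarA A C
  rw [h2, h3, map_apply] at h
  rw [h, lamM_f_apply]

/-- `a ↦ f(S(a))ᵀ`. -/
def fS : D.Lor →ₐ[ℂ] Matrix (Fin 4) (Fin 4) ℂ :=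
  AlgHom.ofLinearMap
    { toFun := fun a => (D.fhom (D.anti a).unop)ᵀ
      map_add' := fun a b => by simp
      map_smul' := fun c a => by simp }
    (by simp) (fun a b => by simp)

theorem fS_apply (a : D.Lor) : D.fS a = (D.fhom (D.anti a).unop)ᵀ := rfl

/-- The restriction of `𝐗` to `𝒜`. -/
def XA : D.Lor →ₐ[ℂ] Matrix (Fin 4 ⊕ Unit) (Fin 4 ⊕ Unit) ℂ :=
  AlgHom.ofLinearMap
    { toFun := fun a => affine (D.fS a) 0 (D.eps a)
      map_add' := fun a b => by ext (i | i) (j | j) <;> simp [affine]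
      map_smul' := fun c a => by ext (i | i) (j | j) <;> simp [affine] }
    (by simp [affine_one]) (fun a b => by
      simp only [LinearMap.coe_mk, AddHom.coe_mk, map_mul, affine_mul]
      congr 1
      ext i
      simp)

theorem XA_apply (a : D.Lor) : D.XA a = affine (D.fS a) 0 (D.eps a) := rfl

end PoincareData

end QuantumMinkowski

end

noncomputable section

namespace QuantumMinkowski

open Matrix
open scoped Kronecker

namespace PoincareData

variable (D : PoincareData)

/-! ### Homomorphisms defined on `ℬ` -/

theorem conj_R1 (i j k l : Fin 4) : star (D.R1 i j k l) = D.R1 j i l k := by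
  have h := D.conj_R i j k l
  rw [starRingEnd_apply] at h
  rw [R1, R1, star_sub, h]
  congr 1
  simp only [and_comm (a := i = k)]
  split_ifs <;> simp

section quadratic

variable {S : Type} [Ring S] [Algebra ℂ S]

/-- The quadratic expression of the relations between the `y^i`, with arbitrary coefficients. -/
def quadratic (Z : Fin 4 → Fin 4 → Fin 4 → ℂ) (T : Fin 4 → Fin 4 → ℂ) (L : Fin 4 → Fin 4 → S)
    (y : Fin 4 → S) (i j : Fin 4) : S :=
  ∑ k, ∑ l, D.R1 i j k l • (y k * y l - (∑ m, Z k l m • y m) + algebraMap ℂ S (T k l) -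
    ∑ m, ∑ n, T m n • (L k m * L l n))

theorem map_quadratic {S' : Type} [Ring S'] [Algebra ℂ S'] (φ : S →ₐ[ℂ] S')
    (Z : Fin 4 → Fin 4 → Fin 4 → ℂ) (T : Fin 4 → Fin 4 → ℂ) (L : Fin 4 → Fin 4 → S)
    (y : Fin 4 → S) (i j : Fin 4) : φ (D.quadratic Z T L y i j) =
      D.quadratic Z T (fun i j => φ (L i j)) (fun i => φ (y i)) i j := by
  simp only [quadratic, map_sum, map_smul, map_sub, map_add, map_mul, AlgHom.commutes]

theorem star_quadratic [StarRing S] [StarModule ℂ S] (Z : Fin 4 → Fin 4 → Fin 4 → ℂ)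
    (T : Fin 4 → Fin 4 → ℂ) {L : Fin 4 → Fin 4 → S} {y : Fin 4 → S}
    (hL : ∀ i j, star (L i j) = L i j) (hy : ∀ i, star (y i) = y i) (i j : Fin 4) :
    star (D.quadratic Z T L y j i) =
      D.quadratic (fun k l m => star (Z l k m)) (fun k l => star (T l k)) L y i j := by
  have h : ∀ c : ℂ, star (algebraMap ℂ S c) = algebraMap ℂ S (star c) := fun c =>
    (algebraMap_star_comm c).symm
  simp only [quadratic, star_sum, star_smul, star_sub, star_add, star_mul, hL, hy, h, conj_R1]
  rw [Finset.sum_comm]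
  refine Finset.sum_congr rfl fun k _ => Finset.sum_congr rfl fun l _ => ?_
  congr 2
  exact Finset.sum_comm

theorem quadratic_sub (Z Z' : Fin 4 → Fin 4 → Fin 4 → ℂ) (T T' : Fin 4 → Fin 4 → ℂ)
    (L : Fin 4 → Fin 4 → S) (y : Fin 4 → S) (i j : Fin 4) :
    D.quadratic Z T L y i j - D.quadratic Z' T' L y i j =
      (∑ m, (∑ k, ∑ l, D.R1 i j k l * (Z' k l m - Z k l m)) • y m) +
        ∑ k, ∑ l, D.R1 i j k l • (algebraMap ℂ S (T k l - T' k l) -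
          ∑ m, ∑ n, (T m n - T' m n) • (L k m * L l n)) := by
  have h : ∑ m, (∑ k, ∑ l, D.R1 i j k l * (Z' k l m - Z k l m)) • y m =
      ∑ k, ∑ l, D.R1 i j k l • ∑ m, (Z' k l m - Z k l m) • y m := by
    simp only [Finset.sum_smul, Finset.smul_sum, smul_smul]
    rw [Finset.sum_comm]
    exact Finset.sum_congr rfl fun k _ => Finset.sum_comm
  rw [h]
  simp only [quadratic, ← Finset.sum_sub_distrib, ← Finset.sum_add_distrib, ← smul_sub, ← smul_add]
  refine Finset.sum_congr rfl fun k _ => Finset.sum_congr rfl fun l _ => ?_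
  simp only [sub_smul, map_sub, Finset.sum_sub_distrib]
  congr 1
  abel

end quadratic

theorem quadratic_y (i j : Fin 4) : D.quadratic D.Z D.TV D.Lam D.y i j = 0 := by
  have h := StarPres.mk_eq_zero D.poincareRelators (Or.inl (Or.inr ⟨i, j, rfl⟩))
  simp only [map_sub, map_add, map_sum, map_smul, map_mul, LambdaOf, AlgHom.commutes] at h
  exact h

variable {D}

/-- The difference of a quadratic relation and its adjoint is of degree one in the `y^i`, with
coefficients in `𝒜`; by freeness its linear and constant parts vanish separately. -/
theorem R1_mul_Z_sub_conj (hD : D.IsQuantumPoincareGroup) (i j m : Fin 4) :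
    ∑ k, ∑ l, D.R1 i j k l * (star (D.Z l k m) - D.Z k l m) = 0 ∧
    ∑ k, ∑ l, D.R1 i j k l • (algebraMap ℂ D.Lor (D.TV k l - star (D.TV l k)) -
      ∑ m, ∑ n, (D.TV m n - star (D.TV n m)) • (D.LamA k m * D.LamA l n)) = 0 := by
  have h1 := D.quadratic_sub D.Z (fun k l m => star (D.Z l k m)) D.TV
    (fun k l => star (D.TV l k)) D.Lam D.y i j
  rw [← D.star_quadratic D.Z D.TV D.star_Lam D.star_y, quadratic_y, quadratic_y, star_zero,
    sub_zero] at h1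
  obtain ⟨u, -, -, hu⟩ := hD
  have h2 := hu 0 (fun m => algebraMap ℂ _ (∑ k, ∑ l, D.R1 i j k l *
    (star (D.Z l k m) - D.Z k l m))) (∑ k, ∑ l, D.R1 i j k l •
      (algebraMap ℂ D.Lor (D.TV k l - star (D.TV l k)) -
        ∑ m, ∑ n, (D.TV m n - star (D.TV n m)) • (D.LamA k m * D.LamA l n))) (by
    rw [h1]
    simp only [Pi.zero_apply, map_zero, zero_mul, Finset.sum_const_zero, zero_add,
      AlgHom.commutes, ← Algebra.smul_def]
    simp only [map_sum, map_smul, map_sub, map_mul, incl_LamA, AlgHom.commutes])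
  refine ⟨?_, h2.2.2⟩
  have h3 := congrArg D.eps (congrFun h2.2.1 m)
  rw [AlgHom.commutes, Pi.zero_apply, map_zero] at h3
  exact h3

variable {S : Type} [Ring S] [Algebra ℂ S] {w wb : Matrix (Fin 2) (Fin 2) S} {y : Fin 4 → S}

theorem lorLift_LamA (h : IsLorentzPair D.lor w wb) (i j : Fin 4) :
    lorLift h (D.LamA i j) = lamM w wb i j := by
  have h1 := congrFun (congrFun (lamM_map (lorLift h) (of D.wA) (of D.wbarA)) i) j
  have h2 : (of D.wA).map (lorLift h) = w := by
    ext A C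
    exact lorLift_wA h A C
  have h3 : (of D.wbarA).map (lorLift h) = wb := by
    ext A C
    exact lorLift_wbarA h A C
  rwa [h2, h3] at h1

/-- The images of the generators of `ℬ`. -/
def poinGen (w wb : Matrix (Fin 2) (Fin 2) S) (y : Fin 4 → S) : PoincareGen → S
  | .w A B => w A B
  | .wbar A B => wb A B
  | .y i => y i

theorem lift_LambdaOf_gen (φ : PoincareGen → S) (i j : Fin 4) :
    FreeStar.lift φ (LambdaOf (fun A B => FreeStar.gen (PoincareGen.w A B))
      (fun A B => FreeStar.gen (PoincareGen.wbar A B)) i j) =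
      lamM (of fun A B => φ (.w A B)) (of fun A B => φ (.wbar A B)) i j := by
  rw [lamM_apply]
  simp only [LambdaOf, map_sum, map_smul, map_mul, FreeStar.lift_gen, of_apply]

theorem star_LambdaOf_gen (i j : Fin 4) :
    star (LambdaOf (fun A B => FreeStar.gen (PoincareGen.w A B))
      (fun A B => FreeStar.gen (PoincareGen.wbar A B)) i j) =
      LambdaOf (fun A B => FreeStar.gen (PoincareGen.w A B))
      (fun A B => FreeStar.gen (PoincareGen.wbar A B)) i j := by
  rw [LambdaOf_eq_lamM]
  exact star_lamM _ _ (fun A B => FreeStar.star_gen _) i j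

/-- The homomorphism `ℬ → S` of a Lorentz pair and a translation vector in `S`. The relations
adjoint to the quadratic ones need not be checked. -/
def poinLift (hD : D.IsQuantumPoincareGroup) (h : IsLorentzPair D.lor w wb)
    (hw : Exch (affine (lamM w wb) y 1) w D.aw) (hwb : Exch (affine (lamM w wb) y 1) wb D.awb)
    (hy : ∀ i j, D.quadratic D.Z D.TV (lamM w wb) y i j = 0) : D.Poin →ₐ[ℂ] S :=
  StarPres.liftOfRel D.poincareRelators (poinGen w wb y)
    (by
      rintro p ((hp | ⟨i, j, rfl⟩) | ⟨i, A, B, rfl⟩)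
      · refine h.relator_eq_zero ?_
        have := D.lor.map_relators (FreeStar.lift (poinGen w wb y)) hp
        simp only [FreeStar.lift_gen] at this
        exact this
      · refine Eq.trans (D.map_quadratic (FreeStar.lift (poinGen w wb y)) D.Z D.TV _ _ i j) ?_
        simp only [lift_LambdaOf_gen, FreeStar.lift_gen]
        exact hy i j
      · have := exch_iff.mp hw A B (Sum.inl i) (Sum.inr ())
        simp only [Fintype.sum_sum_type, aw, of_apply, affine_inl_inl, affine_inl_inr,
          affine_inr_inr, Finset.sum_add_distrib, ite_smul, one_smul, zero_smul,
          Finset.univ_unique, Finset.sum_singleton, Finset.sum_ite_eq', Finset.mem_univ, if_true,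
          mul_one, fw_apply] at this
        simp only [map_sub, map_add, map_sum, map_smul, map_mul, FreeStar.lift_gen,
          lift_LambdaOf_gen]
        rw [sub_eq_zero, eq_sub_iff_add_eq, Finset.sum_comm (s := (Finset.univ : Finset (Fin 4))),
          add_comm]
        exact this)
    (by
      rintro p ((hp | ⟨i, j, rfl⟩) | ⟨i, A, B, rfl⟩)
      · exact IsLorentzPair.lift_star_relator (G := PoincareGen) (φ := poinGen w wb y)
          (g := PoincareGen.w) (gb := PoincareGen.wbar) (fun _ _ => rfl) (show _ from h) hp
      · have h1 := D.star_quadratic D.Z D.TV (S := FreeStar PoincareGen) (y := fun i =>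
          FreeStar.gen (.y i)) star_LambdaOf_gen (fun i => FreeStar.star_gen _) j i
        refine (congrArg (FreeStar.lift (poinGen w wb y)) h1).trans ?_
        rw [map_quadratic]
        simp only [lift_LambdaOf_gen, FreeStar.lift_gen]
        have h2 := D.quadratic_sub D.Z (fun k l m => star (D.Z l k m)) D.TV
          (fun k l => star (D.TV l k)) (lamM w wb) y j i
        have h3 := congrArg (lorLift h) (R1_mul_Z_sub_conj hD j i 0).2
        simp only [map_sum, map_smul, map_sub, map_mul, lorLift_LamA, AlgHom.commutes,
          map_zero] at h3
        simp only [hy, zero_sub, (R1_mul_Z_sub_conj hD j i _).1, zero_smul, Finset.sum_const_zero,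
          zero_add, map_sub] at h2
        rw [h3, neg_eq_zero] at h2
        exact h2
      · have := (exch_conj_iff D.conj_aw_mul_awb).mp hwb A B (Sum.inl i) (Sum.inr ())
        simp only [Fintype.sum_sum_type, aw, of_apply, affine_inl_inl, affine_inl_inr,
          affine_inr_inr, Finset.sum_add_distrib, apply_ite star, star_one, star_zero, ite_smul,
          one_smul, zero_smul,
          Finset.univ_unique, Finset.sum_singleton, Finset.sum_ite_eq', Finset.mem_univ, if_true,
          one_mul, fw_apply] at this
        simp only [star_sub, star_add, star_sum, star_smul, star_mul, FreeStar.star_gen,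
          star_LambdaOf_gen, map_sub, map_add, map_sum, map_smul, map_mul, FreeStar.lift_gen,
          lift_LambdaOf_gen]
        rw [sub_eq_zero, eq_sub_iff_add_eq, Finset.sum_comm (s := (Finset.univ : Finset (Fin 4))),
          add_comm]
        exact this)

theorem poinLift_w (hD : D.IsQuantumPoincareGroup) (h : IsLorentzPair D.lor w wb)
    (hw : Exch (affine (lamM w wb) y 1) w D.aw) (hwb : Exch (affine (lamM w wb) y 1) wb D.awb)
    (hy : ∀ i j, D.quadratic D.Z D.TV (lamM w wb) y i j = 0) (A B : Fin 2) :
    poinLift hD h hw hwb hy (D.w A B) = w A B :=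
  StarPres.liftOfRel_gen _ _ _ _ _

theorem poinLift_wbar (hD : D.IsQuantumPoincareGroup) (h : IsLorentzPair D.lor w wb)
    (hw : Exch (affine (lamM w wb) y 1) w D.aw) (hwb : Exch (affine (lamM w wb) y 1) wb D.awb)
    (hy : ∀ i j, D.quadratic D.Z D.TV (lamM w wb) y i j = 0) (A B : Fin 2) :
    poinLift hD h hw hwb hy (D.wbar A B) = wb A B :=
  StarPres.liftOfRel_gen _ _ _ _ _

theorem poinLift_y (hD : D.IsQuantumPoincareGroup) (h : IsLorentzPair D.lor w wb)
    (hw : Exch (affine (lamM w wb) y 1) w D.aw) (hwb : Exch (affine (lamM w wb) y 1) wb D.awb)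
    (hy : ∀ i j, D.quadratic D.Z D.TV (lamM w wb) y i j = 0) (i : Fin 4) :
    poinLift hD h hw hwb hy (D.y i) = y i :=
  StarPres.liftOfRel_gen _ _ _ _ _

end PoincareData

end QuantumMinkowski

end

noncomputable section

namespace QuantumMinkowski

open Matrix
open scoped Kronecker

/-! ### The homomorphism `𝐗` -/

section affg

/-- The linear parts `g A B` with the translations `H (i, A) B`. -/
def affg (g : Matrix (Fin 2) (Fin 2) (Matrix (Fin 4) (Fin 4) ℂ))
    (H : Matrix (Fin 4 × Fin 2) (Fin 2) ℂ) :
    Matrix (Fin 2) (Fin 2) (Matrix (Fin 4 ⊕ Unit) (Fin 4 ⊕ Unit) ℂ) :=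
  of fun A B => affine (g A B) (fun i => H (i, A) B) (if A = B then 1 else 0)

variable {S : Type} [Ring S] [Algebra ℂ S] {L : Matrix (Fin 4) (Fin 4) S}
  {v : Matrix (Fin 2) (Fin 2) S} {y : Fin 4 → S}
  {g : Matrix (Fin 2) (Fin 2) (Matrix (Fin 4) (Fin 4) ℂ)} {H : Matrix (Fin 4 × Fin 2) (Fin 2) ℂ}

/-- An exchange relation for the linear part, together with a commutation rule for the
translations, is an exchange relation for the affine transformation. -/
theorem Exch.affine (h : Exch L v g) (hy : ∀ i A B,
    y i * v A B + ∑ C, ∑ l, H (l, C) B • (L i l * v A C) =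
      (∑ C, ∑ l, g A C i l • (v C B * y l)) + ∑ C, H (i, A) C • v C B) :
    Exch (affine L y 1) v (affg g H) := by
  rw [exch_iff] at h ⊢
  rintro A B (i | i) (j | j)
  · simp only [Fintype.sum_sum_type, affg, of_apply, affine_inl_inl, affine_inr_inl, zero_smul,
      Finset.sum_const_zero, add_zero, mul_zero, smul_zero]
    exact h A B i j
  · simp only [Fintype.sum_sum_type, affg, of_apply, affine_inl_inl, affine_inl_inr,
      affine_inr_inr, Finset.sum_add_distrib, ite_smul, one_smul, zero_smul, Finset.univ_unique,
      Finset.sum_singleton, Finset.sum_ite_eq', Finset.mem_univ, if_true, mul_one]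
    rw [← hy i A B, add_comm]
  · simp [Fintype.sum_sum_type, affg, affine_inr_inl]
  · simp [Fintype.sum_sum_type, affg, affine_inr_inr, affine_inr_inl]

end affg

namespace PoincareData

variable (D : PoincareData)

section

variable {D} {g s : Matrix (Fin 2) (Fin 2) (Matrix (Fin 4) (Fin 4) ℂ)}
  {H : Matrix (Fin 4 × Fin 2) (Fin 2) ℂ}

/-- The translation part of the exchange relation between `Λ` and `w`, in the Lorentz pair of the
inhomogeneous transformations. -/
theorem translation_of_exch (h : Exch (lamM D.aw D.awb) (affg g H) g) (p : Fin 4) :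
    (of fun A B => of fun i l => (if A = B then D.Z p i l else 0) + ∑ q, H (q, A) B * D.R p i l q) *
      g = g * of fun A B => of fun l n => (∑ q, g A B p q * D.Z q l n) +
        if l = n then H (p, A) B else 0 := by
  ext A B i j
  have h1 := congrFun (congrFun (exch_iff.mp h A B i j) (Sum.inl p)) (Sum.inr ())
  rw [mul_apply, mul_apply, Matrix.sum_apply, Matrix.sum_apply]
  simp only [Matrix.sum_apply, Matrix.smul_apply, smul_eq_mul] at h1
  refine Eq.trans ?_ (h1.trans ?_)
  · refine Finset.sum_congr rfl fun C _ => ?_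
    rw [mul_apply]
    refine Finset.sum_congr rfl fun l _ => ?_
    rw [mul_comm, mul_apply, Fintype.sum_sum_type]
    simp only [of_apply, lamM_aw_apply_inl, lamM_aw_apply_inr, affg, affine_inl_inr,
      affine_inr_inr, Finset.univ_unique, Finset.sum_singleton, mul_ite, mul_one, mul_zero]
    rw [add_comm]
    congr 2
    exact Finset.sum_congr rfl fun q _ => mul_comm _ _
  · refine Finset.sum_congr rfl fun C _ => ?_
    rw [mul_apply]
    refine Finset.sum_congr rfl fun l _ => ?_
    rw [mul_apply, Fintype.sum_sum_type]
    simp only [of_apply, lamM_aw_apply_inr, affg, affine_inl_inr, affine_inl_inl,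
      lamM_aw_apply_inr_inr, Finset.univ_unique, Finset.sum_singleton, mul_ite, mul_one, mul_zero]

/-- The value of `𝐗` on `y^i`. -/
def Ymat (D : PoincareData) (i : Fin 4) : Matrix (Fin 4 ⊕ Unit) (Fin 4 ⊕ Unit) ℂ :=
  affine (of fun j l => D.Z i l j) (fun j => if i = j then 1 else 0) 0

/-- The value of `𝐗` on `Λ^i_l`. -/
def Lmat (D : PoincareData) : Matrix (Fin 4) (Fin 4) (Matrix (Fin 4 ⊕ Unit) (Fin 4 ⊕ Unit) ℂ) :=
  of fun i l => affine (of fun j p => D.R i p j l) 0 (if i = l then 1 else 0)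

/-- The matrices `𝐗(y^i)` obey the commutation rule of `y^i` with `w` (or `w̄`), where `s = f(S(w))`
is the inverse of `g = f(w)`: the linear part is `translation_of_exch`, multiplied by `s` on both
sides. -/
theorem Ymat_exch (h : Exch (lamM D.aw D.awb) (affg g H) g) (hs : s * g = 1) (i : Fin 4)
    (A B : Fin 2) :
    D.Ymat i * affine (s A B)ᵀ 0 (if A = B then 1 else 0) +
        ∑ C, ∑ l, H (l, C) B • (D.Lmat i l * affine (s A C)ᵀ 0 (if A = C then 1 else 0)) =
      (∑ C, ∑ l, g A C i l • (affine (s C B)ᵀ 0 (if C = B then 1 else 0) * D.Ymat l)) +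
        ∑ C, H (i, A) C • affine (s C B)ᵀ 0 (if C = B then 1 else 0) := by
  have hs' : g * s = 1 := mul_eq_one_comm.mp hs
  have key : s * (of fun A B => of fun m l =>
      (if A = B then D.Z i m l else 0) + ∑ q, H (q, A) B * D.R i m l q) =
      (of fun A B => of fun l n => (∑ q, g A B i q * D.Z q l n) +
        if l = n then H (i, A) B else 0) * s := by
    have h1 := congrArg (fun M => s * M * s) (translation_of_exch h i)
    simp only [Matrix.mul_assoc] at h1
    rw [hs', Matrix.mul_one, ← Matrix.mul_assoc s g, hs, Matrix.one_mul] at h1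
    exact h1
  ext (j | j) (l | l)
  · have h2 := congrFun (congrFun (congrFun (congrFun key A) B) l) j
    rw [mul_apply, mul_apply, Matrix.sum_apply, Matrix.sum_apply] at h2
    simp only [mul_apply, of_apply, mul_add, add_mul, mul_ite, ite_mul, mul_zero, zero_mul,
      Finset.sum_add_distrib, Finset.sum_ite_irrel, Finset.sum_const_zero, Finset.sum_ite_eq,
      Finset.sum_ite_eq', Finset.mem_univ, if_true] at h2
    simp only [Matrix.add_apply, Matrix.sum_apply, Matrix.smul_apply, smul_eq_mul, Ymat, Lmat,
      of_apply, affine_mul, affine_inl_inl, mul_apply, transpose_apply]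
    refine Eq.trans (congrArg₂ _ ?_ ?_) (h2.trans (congrArg₂ _ ?_ ?_))
    · exact Finset.sum_congr rfl fun p _ => mul_comm _ _
    · refine Finset.sum_congr rfl fun C _ => ?_
      simp only [Finset.mul_sum]
      rw [Finset.sum_comm]
      refine Finset.sum_congr rfl fun p _ => Finset.sum_congr rfl fun q _ => ?_
      ring
    · refine Finset.sum_congr rfl fun C _ => ?_
      simp only [Finset.mul_sum, Finset.sum_mul]
      rw [Finset.sum_comm]
      refine Finset.sum_congr rfl fun p _ => Finset.sum_congr rfl fun q _ => ?_
      ring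
    · rfl
  · have h2 := congrFun (congrFun (congrFun (congrFun hs' A) B) i) j
    rw [mul_apply, Matrix.sum_apply] at h2
    simp only [mul_apply] at h2
    simp only [Matrix.add_apply, Matrix.sum_apply, Matrix.smul_apply, smul_eq_mul, Ymat, Lmat,
      of_apply, affine_mul, affine_inl_inr, transpose_apply, Pi.zero_apply, mul_zero,
      Finset.sum_const_zero, zero_add, add_zero, mul_ite, mul_one, Finset.sum_ite_eq,
      Finset.mem_univ, if_true]
    rw [h2, one_apply]
    split_ifs <;> simp [one_apply]
    all_goals assumption
  · simp [Matrix.sum_apply, Ymat, Lmat, affine_mul, affine_inr_inl]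
  · simp only [Matrix.add_apply, Matrix.sum_apply, Matrix.smul_apply, smul_eq_mul, Ymat, Lmat,
      of_apply, affine_mul, affine_inr_inr]
    fin_cases A <;> fin_cases B <;> simp

end

/-- `S(Λ)` in `𝒜`. -/
def LamS (i j : Fin 4) : D.Lor := (D.anti (D.LamA i j)).unop

theorem LamA_mul_LamS : D.LamA * of D.LamS = 1 := by
  have h : of D.LamS = conjV D.Lor (of fun p r : Fin 2 × Fin 2 =>
      D.wbarAinv p.2 r.2 * D.wAinv p.1 r.1) := by
    ext i j
    simp only [LamS, of_apply, conjV_apply, lamM_apply, map_sum, map_smul, map_mul,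
      MulOpposite.unop_mul, MulOpposite.unop_smul, Finset.unop_sum, anti_wA, anti_wbarA]
  rw [h, LamA, lamM, ← map_mul, kronecker_mul_reversed D.wA_mul_inv D.wbarA_mul_inv, map_one]

/-- `f(S(Λ))` is given by `R`, since `R` is an involution. -/
theorem fS_LamA (i l j p : Fin 4) : D.fS (D.LamA i l) j p = D.R i p j l := by
  rw [fS_apply, transpose_apply]
  set B : Matrix (Fin 4 × Fin 4) (Fin 4 × Fin 4) ℂ :=
    of fun x z => D.fhom (D.LamS x.1 z.2) x.2 z.1 with hB
  have h : D.Rm * B = 1 := by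
    ext ⟨p, i⟩ ⟨r, n⟩
    have h1 := congrArg (fun M => D.fhom (M i n) p r) D.LamA_mul_LamS
    simp only [mul_apply, map_sum, map_mul, Matrix.sum_apply, fhom_LamA, of_apply] at h1
    rw [mul_apply, Fintype.sum_prod_type]
    refine h1.trans ?_
    rw [one_apply, one_apply]
    simp only [Prod.mk.injEq]
    split_ifs <;> simp_all [one_apply]
  have h2 : B = D.Rm := by
    calc B = D.Rm * D.Rm * B := by rw [Rm_mul_Rm, Matrix.one_mul]
      _ = D.Rm := by rw [Matrix.mul_assoc, h, Matrix.mul_one]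
  exact congrFun (congrFun h2 (i, p)) (j, l)

/-- The value of `𝐗` on `w`. -/
abbrev wX : Matrix (Fin 2) (Fin 2) (Matrix (Fin 4 ⊕ Unit) (Fin 4 ⊕ Unit) ℂ) := (of D.wA).map D.XA

/-- The value of `𝐗` on `w̄`. -/
abbrev wbX : Matrix (Fin 2) (Fin 2) (Matrix (Fin 4 ⊕ Unit) (Fin 4 ⊕ Unit) ℂ) :=
  (of D.wbarA).map D.XA

theorem isLorentzPair_X : IsLorentzPair D.lor D.wX D.wbX := D.isLorentzPair_A.map D.XA

theorem lamM_X : lamM D.wX D.wbX = D.Lmat := by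
  rw [wX, wbX, ← lamM_map]
  ext i l : 1
  rw [map_apply, XA_apply, Lmat, of_apply, eps_LamA]
  congr 1
  ext j p
  exact D.fS_LamA i l j p

theorem wX_apply (A B : Fin 2) : D.wX A B =
    affine ((D.wAinv.map D.fhom) A B)ᵀ 0 (if A = B then 1 else 0) := by
  change D.XA (D.wA A B) = affine (D.fhom (D.wAinv A B))ᵀ 0 _
  rw [XA_apply, eps_wA, fS_apply, anti_wA]

theorem wbX_apply (A B : Fin 2) : D.wbX A B =
    affine ((D.wbarAinv.map D.fhom) A B)ᵀ 0 (if A = B then 1 else 0) := by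
  change D.XA (D.wbarA A B) = affine (D.fhom (D.wbarAinv A B))ᵀ 0 _
  rw [XA_apply, eps_wbarA, fS_apply, anti_wbarA]

theorem fhom_inv_mul_fw : D.wAinv.map D.fhom * D.fw = 1 := by
  have h := congrArg (fun M => M.map D.fhom) D.inv_mul_wA
  have h2 : (of D.wA).map D.fhom = D.fw := by
    ext A C : 1
    exact D.fhom_wA A C
  rwa [Matrix.map_mul, h2, Matrix.map_one _ (map_zero _) (map_one _)] at h

theorem fhom_inv_mul_fwb : D.wbarAinv.map D.fhom * D.fwb = 1 := by
  have h := congrArg (fun M => M.map D.fhom) D.inv_mul_wbarA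
  have h2 : (of D.wbarA).map D.fhom = D.fwb := by
    ext A C : 1
    exact D.fhom_wbarA A C
  rwa [Matrix.map_mul, h2, Matrix.map_one _ (map_zero _) (map_one _)] at h

variable {D}

theorem exch_X_w (hD : D.IsQuantumPoincareGroup) :
    Exch (affine (lamM D.wX D.wbX) D.Ymat 1) D.wX D.aw := by
  refine Exch.affine (H := D.HV) D.isLorentzPair_X.exch_lamM_w fun i A B => ?_
  have h := Ymat_exch (isLorentzPair_aw hD).exch_lamM_w D.fhom_inv_mul_fw i A B
  simp only [lamM_X, wX_apply]
  exact h

theorem exch_X_wb (hD : D.IsQuantumPoincareGroup) :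
    Exch (affine (lamM D.wX D.wbX) D.Ymat 1) D.wbX D.awb := by
  refine Exch.affine (H := D.HVt) D.isLorentzPair_X.exch_lamM_wb fun i A B => ?_
  have h := Ymat_exch (isLorentzPair_aw hD).exch_lamM_wb D.fhom_inv_mul_fwb i A B
  simp only [lamM_X, wbX_apply]
  exact h

/-- For the values of `𝐗`, the quadratic relations are the vanishing of `F̃`. -/
theorem quadratic_X (hF : ∀ i j n m, D.Ftilde i j n m = 0) (i j : Fin 4) :
    D.quadratic D.Z D.TV (lamM D.wX D.wbX) D.Ymat i j = 0 := by
  rw [lamM_X]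
  ext (p | p) (q | q)
  · refine Eq.trans ?_ (hF i j q p)
    unfold quadratic Ftilde
    rw [Matrix.sum_apply]
    refine Finset.sum_congr rfl fun k _ => ?_
    rw [Matrix.sum_apply]
    refine Finset.sum_congr rfl fun l _ => ?_
    simp only [Matrix.sub_apply, Matrix.add_apply, Matrix.sum_apply, Matrix.smul_apply,
      smul_eq_mul, Ymat, Lmat, of_apply, affine_mul, affine_inl_inl, mul_apply,
      Algebra.algebraMap_eq_smul_one, one_apply, Sum.inl.injEq]
    refine congrArg (D.R1 i j k l * ·) (congrArg₂ (· - ·) (congrArg₂ (· + ·)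
      (congrArg₂ (· - ·) ?_ rfl) (congrArg (D.TV k l * ·) ?_)) ?_)
    · exact Finset.sum_congr rfl fun r _ => mul_comm _ _
    · simp only [eq_comm]
    · refine Finset.sum_congr rfl fun a _ => Finset.sum_congr rfl fun b _ => ?_
      rw [Finset.mul_sum]
      refine Finset.sum_congr rfl fun r _ => ?_
      ring
  · unfold quadratic
    rw [Matrix.sum_apply]
    refine Finset.sum_eq_zero fun k _ => ?_
    rw [Matrix.sum_apply]
    refine Finset.sum_eq_zero fun l _ => ?_
    simp [Matrix.sum_apply, Ymat, Lmat, affine_mul, affine_inl_inr, algebraMap_matrix_apply]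
  · unfold quadratic
    rw [Matrix.sum_apply]
    refine Finset.sum_eq_zero fun k _ => ?_
    rw [Matrix.sum_apply]
    refine Finset.sum_eq_zero fun l _ => ?_
    simp [Matrix.sum_apply, Ymat, Lmat, affine_mul, affine_inr_inl, algebraMap_matrix_apply]
  · unfold quadratic
    rw [Matrix.sum_apply]
    refine Finset.sum_eq_zero fun k _ => ?_
    rw [Matrix.sum_apply]
    refine Finset.sum_eq_zero fun l _ => ?_
    simp [Matrix.sum_apply, Ymat, Lmat, affine_mul, affine_inr_inr, algebraMap_matrix_apply]

/-- The homomorphism `𝐗`. -/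
def XB (hD : D.IsQuantumPoincareGroup) (hF : ∀ i j n m, D.Ftilde i j n m = 0) :
    D.Poin →ₐ[ℂ] Matrix (Fin 4 ⊕ Unit) (Fin 4 ⊕ Unit) ℂ :=
  poinLift hD D.isLorentzPair_X (exch_X_w hD) (exch_X_wb hD) (quadratic_X hF)

theorem XB_y (hD : D.IsQuantumPoincareGroup) (hF : ∀ i j n m, D.Ftilde i j n m = 0) (i : Fin 4) :
    XB hD hF (D.y i) = D.Ymat i :=
  poinLift_y _ _ _ _ _ _

theorem XB_incl (hD : D.IsQuantumPoincareGroup) (hF : ∀ i j n m, D.Ftilde i j n m = 0)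
    (a : D.Lor) : XB hD hF (D.incl a) = D.XA a := by
  have h : (XB hD hF).comp D.incl = D.XA := by
    refine lor_algHom_ext (fun A B => ?_) fun A B => ?_
    · rw [AlgHom.comp_apply, incl_wA]
      exact poinLift_w _ _ _ _ _ _ _
    · rw [AlgHom.comp_apply, incl_wbarA]
      exact poinLift_wbar _ _ _ _ _ _ _
  exact congrArg (fun φ : D.Lor →ₐ[ℂ] Matrix (Fin 4 ⊕ Unit) (Fin 4 ⊕ Unit) ℂ => φ a) h

end PoincareData

end QuantumMinkowski

end

noncomputable section

namespace QuantumMinkowski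

open Matrix
open scoped Kronecker

/-! ### The action on the quantum Minkowski space -/

section presentation

variable {G : Type} [InvolutiveStar G]

theorem StarPres.lift_star (P : Set (FreeStar G)) {S : Type} [Ring S] [StarRing S] [Algebra ℂ S]
    [StarModule ℂ S] (φ : G → S) (hφ : ∀ g, φ (star g) = star (φ g))
    (hP : ∀ p ∈ P, FreeStar.lift φ p = 0) (a : StarPres P) :
    StarPres.lift P φ hφ hP (star a) = star (StarPres.lift P φ hφ hP a) := by
  obtain ⟨a, rfl⟩ := StarPres.mk_surjective P a
  have h : ∀ a, StarPres.lift P φ hφ hP (StarPres.mk P a) = FreeStar.lift φ a := fun a =>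
    RingQuot.liftAlgHom_mkAlgHom_apply ℂ _ _ _
  rw [StarPres.star_mk, h, h, FreeStar.lift_star φ hφ]

/-- Induction on words, letter by letter from the left. -/
theorem StarPres.induction_left {P : Set (FreeStar G)} {C : StarPres P → Prop} (one : C 1)
    (add : ∀ a b, C a → C b → C (a + b)) (smul : ∀ (c : ℂ) a, C a → C (c • a))
    (gen_mul : ∀ g a, C a → C (StarPres.gen P g * a)) (a : StarPres P) : C a := by
  obtain ⟨a, rfl⟩ := StarPres.mk_surjective P a
  suffices ∀ b, C b → C (StarPres.mk P a * b) by simpa using this 1 one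
  induction a using FreeStar.induction with
  | h1 c =>
    intro b hb
    rw [AlgHom.commutes, ← Algebra.smul_def]
    exact smul c b hb
  | h2 g => exact gen_mul g
  | h3 a b ha hb =>
    intro d hd
    rw [map_mul, mul_assoc]
    exact ha _ (hb _ hd)
  | h4 a b ha hb =>
    intro d hd
    rw [map_add, add_mul]
    exact add _ _ (ha _ hd) (hb _ hd)

end presentation

namespace PoincareData

variable (D : PoincareData)

theorem mink_induction {C : D.Mink → Prop} (one : C 1) (add : ∀ a b, C a → C b → C (a + b))
    (smul : ∀ (c : ℂ) a, C a → C (c • a)) (x_mul : ∀ i a, C a → C (D.x i * a)) (a : D.Mink) :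
    C a :=
  StarPres.induction_left one add smul (fun g => by cases g; exact x_mul _) a

section transformed

variable {S : Type} [Ring S] [Algebra ℂ S]

theorem map_mulVec_apply (M : Matrix (Fin 4 × Fin 4) (Fin 4 × Fin 4) ℂ) (v : Fin 4 × Fin 4 → S)
    (i j : Fin 4) : (M.map (algebraMap ℂ S) *ᵥ v) (i, j) =
      ∑ k, ∑ l, M (i, j) (k, l) • v (k, l) := by
  rw [mulVec, dotProduct, Fintype.sum_prod_type]
  simp only [map_apply, Algebra.smul_def]

theorem R1_eq (i j k l : Fin 4) : D.R1 i j k l = (D.Rm - 1) (i, j) (k, l) := by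
  rw [R1, Matrix.sub_apply, one_apply, Rm, of_apply]
  simp only [Prod.mk.injEq]

/-- The relations of the quantum Minkowski space are covariant. -/
theorem transformed_relation {w wb : Matrix (Fin 2) (Fin 2) S} {η ξ : Fin 4 → S}
    (h : IsLorentzPair D.lor w wb)
    (hw : Exch (affine (lamM w wb) η 1) w D.aw) (hwb : Exch (affine (lamM w wb) η 1) wb D.awb)
    (hη : ∀ i j, D.quadratic D.Z D.TV (lamM w wb) η i j = 0)
    (hξ : ∀ i j, ∑ k, ∑ l, D.R1 i j k l • (ξ k * ξ l - (∑ m, D.Z k l m • ξ m) +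
      algebraMap ℂ S (D.TV k l)) = 0)
    (hc : ∀ i j k, Commute (ξ i) (lamM w wb j k)) (hc' : ∀ i j, Commute (ξ i) (η j)) (i j : Fin 4) :
    ∑ k, ∑ l, D.R1 i j k l • (((∑ a, lamM w wb k a * ξ a) + η k) *
        ((∑ a, lamM w wb l a * ξ a) + η l) -
      (∑ m, D.Z k l m • ((∑ a, lamM w wb m a * ξ a) + η m)) + algebraMap ℂ S (D.TV k l)) = 0 := by
  set L := lamM w wb with hL
  set Rh := D.Rm.map (algebraMap ℂ S) with hRh
  set R1h := (D.Rm - 1).map (algebraMap ℂ S) with hR1h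
  have hR1 : R1h = Rh - 1 := by
    ext p r
    simp only [hR1h, hRh, map_apply, Matrix.sub_apply, map_sub, one_apply]
    split_ifs <;> simp
  have hRR : Rh * Rh = 1 := by
    rw [hRh, ← map_algebraMap_mul, Rm_mul_Rm, Matrix.map_one _ (map_zero _) (map_one _)]
  have hK : Commute Rh (L ⊗ₖ L) := by
    rw [commute_iff_eq]
    ext ⟨i, j⟩ ⟨k, l⟩
    have := h.lamM_lamM_R i j k l
    rw [mul_apply, mul_apply, Fintype.sum_prod_type, Fintype.sum_prod_type]
    simp only [hRh, Rm, map_apply, of_apply, kroneckerMap_apply, ← Algebra.smul_def,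
      ← Algebra.commutes]
    exact this.symm
  set TT : Fin 4 × Fin 4 → S := fun p => algebraMap ℂ S (D.TV p.1 p.2)
  set Zξ : Fin 4 × Fin 4 → S := fun p => ∑ m, D.Z p.1 p.2 m • ξ m
  set Zη : Fin 4 × Fin 4 → S := fun p => ∑ m, D.Z p.1 p.2 m • η m
  set A : Fin 4 × Fin 4 → S := fun p => ∑ a, L p.1 a * η p.2 * ξ a
  set B : Fin 4 × Fin 4 → S := fun p => ∑ a, η p.1 * L p.2 a * ξ a
  set C : Fin 4 × Fin 4 → S := fun p => ∑ m, D.Z p.1 p.2 m • ∑ a, L m a * ξ a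
  have e1 : R1h *ᵥ ((fun p => η p.1 * η p.2) - Zη + TT - (L ⊗ₖ L) *ᵥ TT) = 0 := by
    ext ⟨i, j⟩
    rw [map_mulVec_apply]
    refine Eq.trans ?_ (hη i j)
    refine Finset.sum_congr rfl fun k _ => Finset.sum_congr rfl fun l _ => ?_
    refine congrArg₂ (· • ·) (D.R1_eq i j k l).symm ?_
    rw [Pi.sub_apply]
    refine congrArg₂ (· - ·) rfl ?_
    change (∑ x, (L ⊗ₖ L) (k, l) x * TT x) = _
    rw [Fintype.sum_prod_type]
    simp only [TT, kroneckerMap_apply, ← Algebra.commutes, ← Algebra.smul_def]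
  have e2 : R1h *ᵥ ((fun p => ξ p.1 * ξ p.2) - Zξ + TT) = 0 := by
    ext ⟨i, j⟩
    rw [map_mulVec_apply]
    refine Eq.trans ?_ (hξ i j)
    refine Finset.sum_congr rfl fun k _ => Finset.sum_congr rfl fun l _ => ?_
    rw [R1_eq]
    rfl
  have e3 : B + (L ⊗ₖ L) *ᵥ Zξ = Rh *ᵥ A + C := by
    ext ⟨i, j⟩
    have h1 : ∀ b, η i * L j b * ξ b + ∑ l, ∑ c, D.Z l c b • (L i l * L j c * ξ b) =
        ∑ c, ∑ l, D.R i j c l • (L c b * η l * ξ b) + ∑ c, D.Z i j c • (L c b * ξ b) := fun b => by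
      have := congrArg (· * ξ b) (D.y_mul_lamM hw hwb i j b)
      simp only [add_mul, Finset.sum_mul, smul_mul_assoc] at this
      rw [Finset.sum_comm] at this
      exact this
    have h2 : ((L ⊗ₖ L) *ᵥ Zξ) (i, j) = ∑ b, ∑ l, ∑ c, D.Z l c b • (L i l * L j c * ξ b) := by
      rw [mulVec, dotProduct, Fintype.sum_prod_type, Finset.sum_comm' (t' := Finset.univ)
        (s' := fun _ => Finset.univ) (by simp)]
      simp only [Zξ, kroneckerMap_apply, Finset.mul_sum, mul_smul_comm]
      rw [Finset.sum_comm]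
      conv_rhs => rw [Finset.sum_comm]
      exact Finset.sum_congr rfl fun l _ => Finset.sum_comm
    have h3 : (Rh *ᵥ A) (i, j) = ∑ b, ∑ c, ∑ l, D.R i j c l • (L c b * η l * ξ b) := by
      rw [map_mulVec_apply]
      simp only [A, Finset.smul_sum]
      conv_rhs => rw [Finset.sum_comm]
      exact Finset.sum_congr rfl fun l _ => Finset.sum_comm
    have h4 : C (i, j) = ∑ b, ∑ c, D.Z i j c • (L c b * ξ b) := by
      simp only [C, Finset.smul_sum]
      exact Finset.sum_comm
    rw [Pi.add_apply, Pi.add_apply, h2, h3, h4, ← Finset.sum_add_distrib, ← Finset.sum_add_distrib]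
    exact Finset.sum_congr rfl fun b _ => h1 b
  have e4 : (fun p : Fin 4 × Fin 4 =>
      ((∑ a, L p.1 a * ξ a) + η p.1) * ((∑ a, L p.2 a * ξ a) + η p.2) -
      (∑ m, D.Z p.1 p.2 m • ((∑ a, L m a * ξ a) + η m)) + algebraMap ℂ S (D.TV p.1 p.2)) =
      (L ⊗ₖ L) *ᵥ (fun p => ξ p.1 * ξ p.2) + A + B + (fun p => η p.1 * η p.2) - C - Zη + TT := by
    ext ⟨k, l⟩
    have h1 : ((L ⊗ₖ L) *ᵥ (fun p => ξ p.1 * ξ p.2)) (k, l) =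
        (∑ a, L k a * ξ a) * ∑ a, L l a * ξ a := by
      rw [mulVec, dotProduct, Fintype.sum_prod_type, Finset.sum_mul_sum]
      refine Finset.sum_congr rfl fun a _ => Finset.sum_congr rfl fun b _ => ?_
      rw [kroneckerMap_apply, mul_assoc, mul_assoc, ← mul_assoc (ξ a), (hc a l b).eq]
      simp only [mul_assoc]
    have h2 : A (k, l) = (∑ a, L k a * ξ a) * η l := by
      rw [Finset.sum_mul]
      exact Finset.sum_congr rfl fun a _ => by rw [mul_assoc, mul_assoc, (hc' a l).eq]
    have h3 : B (k, l) = η k * ∑ a, L l a * ξ a := by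
      rw [Finset.mul_sum]
      exact Finset.sum_congr rfl fun a _ => mul_assoc _ _ _
    simp only [Pi.add_apply, Pi.sub_apply, h1, h2, h3, C, Zη, TT, smul_add, Finset.sum_add_distrib,
      add_mul, mul_add]
    abel
  have e5 : (fun p : Fin 4 × Fin 4 =>
      ((∑ a, L p.1 a * ξ a) + η p.1) * ((∑ a, L p.2 a * ξ a) + η p.2) -
      (∑ m, D.Z p.1 p.2 m • ((∑ a, L m a * ξ a) + η m)) + algebraMap ℂ S (D.TV p.1 p.2)) =
      (L ⊗ₖ L) *ᵥ ((fun p => ξ p.1 * ξ p.2) - Zξ + TT) + (Rh + 1) *ᵥ A +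
        ((fun p => η p.1 * η p.2) - Zη + TT - (L ⊗ₖ L) *ᵥ TT) := by
    rw [e4, add_mulVec, one_mulVec, mulVec_add, mulVec_sub]
    have : B = Rh *ᵥ A + C - (L ⊗ₖ L) *ᵥ Zξ := eq_sub_of_add_eq e3
    rw [this]
    abel
  have e6 : R1h *ᵥ (fun p : Fin 4 × Fin 4 => ((∑ a, L p.1 a * ξ a) + η p.1) *
      ((∑ a, L p.2 a * ξ a) + η p.2) - (∑ m, D.Z p.1 p.2 m • ((∑ a, L m a * ξ a) + η m)) +
        algebraMap ℂ S (D.TV p.1 p.2)) = 0 := by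
    have hRK : R1h * (L ⊗ₖ L) = (L ⊗ₖ L) * R1h := by
      rw [hR1, Matrix.sub_mul, Matrix.mul_sub, hK.eq, Matrix.one_mul, Matrix.mul_one]
    have hRR' : R1h * (Rh + 1) = 0 := by
      rw [hR1, Matrix.sub_mul, Matrix.mul_add, hRR, Matrix.mul_one, Matrix.one_mul]
      abel
    rw [e5, mulVec_add, mulVec_add, e1, mulVec_mulVec, mulVec_mulVec, hRK, hRR', ← mulVec_mulVec,
      e2, mulVec_zero, zero_mulVec, add_zero, add_zero]
  have e7 := congrFun e6 (i, j)
  rw [map_mulVec_apply] at e7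
  simpa only [← R1_eq, Pi.zero_apply] using e7

end transformed

end PoincareData

end QuantumMinkowski

end

noncomputable section

namespace QuantumMinkowski

open Matrix
open scoped Kronecker

theorem Exch.mapAlg {S S' n : Type} [Ring S] [Algebra ℂ S] [Ring S'] [Algebra ℂ S'] [Fintype n]
    [DecidableEq n] {u : Matrix n n S} {w : Matrix (Fin 2) (Fin 2) S}
    {g : Matrix (Fin 2) (Fin 2) (Matrix n n ℂ)} (h : Exch u w g) (φ : S →ₐ[ℂ] S') :
    Exch (u.map φ) (w.map φ) g := by
  rw [exch_iff] at h ⊢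
  intro A B i j
  have := congrArg φ (h A B i j)
  simp only [map_sum, map_smul, map_mul] at this
  exact this

theorem affine_map {S S' : Type} [Ring S] [Ring S'] (φ : S →+* S')
    (a : Matrix (Fin 4) (Fin 4) S) (h : Fin 4 → S) (d : S) :
    (affine a h d).map φ = affine (a.map φ) (fun i => φ (h i)) (φ d) := by
  ext (i | i) (j | j)
  · rfl
  · rfl
  · exact map_zero φ
  · rfl

namespace PoincareData

variable (D : PoincareData)

/-- The inclusion of `ℬ` in `ℬ ⊗ 𝒞`. -/
abbrev inB : D.Poin →ₐ[ℂ] D.Poin ⊗[ℂ] D.Mink := Algebra.TensorProduct.includeLeft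

/-- The inclusion of `𝒞` in `ℬ ⊗ 𝒞`. -/
abbrev inC : D.Mink →ₐ[ℂ] D.Poin ⊗[ℂ] D.Mink := Algebra.TensorProduct.includeRight

theorem commute_inC_inB (b : D.Poin) (c : D.Mink) : Commute (D.inC c) (D.inB b) := by
  rw [commute_iff_eq]
  simp [Algebra.TensorProduct.includeLeft_apply, Algebra.TensorProduct.includeRight_apply,
    Algebra.TensorProduct.tmul_mul_tmul]

theorem inB_mul_inC (b : D.Poin) (c : D.Mink) : D.inB b * D.inC c = b ⊗ₜ c := by
  simp [Algebra.TensorProduct.includeLeft_apply, Algebra.TensorProduct.includeRight_apply,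
    Algebra.TensorProduct.tmul_mul_tmul]

/-- The transformed coordinates `Λ^i_j ⊗ x^j + y^i ⊗ 1`. -/
def PsiGen (i : Fin 4) : D.Poin ⊗[ℂ] D.Mink :=
  (∑ j, D.inB (D.Lam i j) * D.inC (D.x j)) + D.inB (D.y i)

theorem relation_x (i j : Fin 4) : ∑ k, ∑ l, D.R1 i j k l • (D.x k * D.x l -
    (∑ m, D.Z k l m • D.x m) + algebraMap ℂ D.Mink (D.TV k l)) = 0 := by
  have h := StarPres.mk_eq_zero D.minkowskiRelators ⟨i, j, rfl⟩
  simp only [map_sub, map_add, map_sum, map_smul, map_mul, AlgHom.commutes] at h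
  exact h

theorem star_x (i : Fin 4) : star (D.x i) = D.x i := StarPres.star_gen _ _

theorem star_PsiGen (i : Fin 4) : star (D.PsiGen i) = D.PsiGen i := by
  have h : star (D.inB (D.y i)) = D.inB (D.y i) := by
    rw [Algebra.TensorProduct.includeLeft_apply, TensorProduct.star_tmul, star_y, star_one]
  rw [PsiGen, star_add, star_sum, h]
  refine congrArg₂ _ (Finset.sum_congr rfl fun j _ => ?_) rfl
  rw [inB_mul_inC, TensorProduct.star_tmul, star_Lam, star_x]

theorem lamM_wB : lamM D.wB D.wbB = of D.Lam := by
  ext i j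
  exact (D.Lam_eq i j).symm

/-- The transformed coordinates satisfy the relations of `𝒞`. -/
theorem relation_PsiGen (i j : Fin 4) : ∑ k, ∑ l, D.R1 i j k l • (D.PsiGen k * D.PsiGen l -
    (∑ m, D.Z k l m • D.PsiGen m) + algebraMap ℂ _ (D.TV k l)) = 0 := by
  have hL : lamM (D.wB.map D.inB) (D.wbB.map D.inB) = (of D.Lam).map D.inB := by
    rw [← lamM_map, lamM_wB]
  have hP : affine (lamM (D.wB.map D.inB) (D.wbB.map D.inB)) (fun i => D.inB (D.y i)) 1 =
      D.Pm.map D.inB := by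
    have := affine_map (D.inB : D.Poin →+* D.Poin ⊗[ℂ] D.Mink) (of D.Lam) D.y 1
    rw [map_one] at this
    rw [hL]
    exact this.symm
  have h := D.transformed_relation (S := D.Poin ⊗[ℂ] D.Mink) (w := D.wB.map D.inB)
    (wb := D.wbB.map D.inB) (η := fun i => D.inB (D.y i)) (ξ := fun i => D.inC (D.x i))
    (D.isLorentzPair_B.map D.inB) (by rw [hP]; exact D.exch_Pm_w.mapAlg D.inB)
    (by rw [hP]; exact D.exch_Pm_wb.mapAlg D.inB)
    (fun i j => by
      rw [hL]
      have := congrArg D.inB (D.quadratic_y i j)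
      rwa [map_quadratic, map_zero] at this)
    (fun i j => by
      have := congrArg D.inC (D.relation_x i j)
      simpa only [map_sub, map_add, map_sum, map_smul, map_mul, map_zero,
        AlgHom.commutes] using this)
    (fun i j k => by rw [hL]; exact D.commute_inC_inB _ _)
    (fun i j => D.commute_inC_inB _ _) i j
  rw [hL] at h
  exact h

/-- The images of the generators under the action. -/
def PsiFun : MinkowskiGen → D.Poin ⊗[ℂ] D.Mink
  | .x i => D.PsiGen i

theorem PsiFun_star (g : MinkowskiGen) : D.PsiFun (star g) = star (D.PsiFun g) := by
  cases g
  exact (D.star_PsiGen _).symm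

theorem lift_PsiFun (p : FreeStar MinkowskiGen) (hp : p ∈ D.minkowskiRelators) :
    FreeStar.lift D.PsiFun p = 0 := by
  obtain ⟨i, j, rfl⟩ := hp
  simp only [map_sub, map_add, map_sum, map_smul, map_mul, FreeStar.lift_gen, AlgHom.commutes]
  exact D.relation_PsiGen i j

/-- The action `Ψ` of the quantum Poincaré group on its quantum Minkowski space. -/
def PsiHom : D.Mink →⋆ₐ[ℂ] D.Poin ⊗[ℂ] D.Mink :=
  { StarPres.lift D.minkowskiRelators D.PsiFun D.PsiFun_star D.lift_PsiFun with
    map_star' := StarPres.lift_star _ _ D.PsiFun_star D.lift_PsiFun }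

theorem PsiHom_x (i : Fin 4) : D.PsiHom (D.x i) = D.PsiGen i :=
  StarPres.lift_gen _ _ D.PsiFun_star D.lift_PsiFun _

variable {D}

/-! ### The partial derivatives -/

section derivatives

variable (X : D.Poin →ₐ[ℂ] Matrix (Fin 4 ⊕ Unit) (Fin 4 ⊕ Unit) ℂ)
  (Ψ : D.Mink →⋆ₐ[ℂ] D.Poin ⊗[ℂ] D.Mink)

/-- `𝐗 ⊗ id`, with values in the `5 × 5` matrices over `𝒞`. -/
def Xid : D.Poin ⊗[ℂ] D.Mink →ₐ[ℂ] Matrix (Fin 4 ⊕ Unit) (Fin 4 ⊕ Unit) D.Mink :=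
  Algebra.TensorProduct.lift ((cst D.Mink (Fin 4 ⊕ Unit)).comp X) (scalarAlgHom (Fin 4 ⊕ Unit) ℂ)
    fun b c => (commute_scalar_cst c (X b)).symm

theorem Xid_tmul_apply (b : D.Poin) (c : D.Mink) (p q : Fin 4 ⊕ Unit) :
    Xid X (b ⊗ₜ c) p q = X b p q • c := by
  have h : Xid X (b ⊗ₜ c) = cst D.Mink (Fin 4 ⊕ Unit) (X b) * diagonal fun _ => c :=
    Algebra.TensorProduct.lift_tmul _ _ _ _ _
  rw [h, mul_diagonal, cst_apply, Algebra.smul_def]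

/-- The partial derivatives, as the derivatives of the action. -/
def pdOf (i : Fin 4) : D.Mink →ₗ[ℂ] D.Mink :=
  (Matrix.entryLinearMap ℂ D.Mink (Sum.inl i) (Sum.inr ())).comp
    ((Xid X).toLinearMap.comp Ψ.toAlgHom.toLinearMap)

theorem pdOf_apply (i : Fin 4) (g : D.Mink) :
    pdOf X Ψ i g = Xid X (Ψ g) (Sum.inl i) (Sum.inr ()) := rfl

end derivatives

end PoincareData

end QuantumMinkowski

end

noncomputable section

namespace QuantumMinkowski

open Matrix
open scoped Kronecker

namespace PoincareData

variable {D : PoincareData} (hD : D.IsQuantumPoincareGroup) (hF : ∀ i j n m, D.Ftilde i j n m = 0)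

theorem XB_Lam (i l : Fin 4) : XB hD hF (D.Lam i l) =
    affine (of fun j p => D.R i p j l) 0 (if i = l then 1 else 0) := by
  rw [← incl_LamA, XB_incl, XA_apply, eps_LamA]
  refine congrArg₂ (fun a d => affine a 0 d) ?_ rfl
  ext j p
  exact D.fS_LamA i l j p

/-- `𝐗 ⊗ id` on the transformed coordinates. -/
theorem Xid_PsiGen (k : Fin 4) : Xid (XB hD hF) (D.PsiGen k) =
    affine (of fun p q => (∑ n, D.R k q p n • D.x n) + algebraMap ℂ D.Mink (D.Z k q p))
      (fun p => if k = p then 1 else 0) (D.x k) := by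
  have h : ∀ p q, Xid (XB hD hF) (D.PsiGen k) p q =
      (∑ n, XB hD hF (D.Lam k n) p q • D.x n) + XB hD hF (D.y k) p q • 1 := fun p q => by
    rw [PsiGen, map_add, map_sum, Matrix.add_apply, Matrix.sum_apply]
    refine congrArg₂ _ (Finset.sum_congr rfl fun n _ => ?_) ?_
    · rw [inB_mul_inC, Xid_tmul_apply]
    · exact Xid_tmul_apply _ _ _ _ _
  ext p q
  rw [h, XB_y]
  simp only [XB_Lam]
  rcases p with p | p <;> rcases q with q | q
  · rw [affine_inl_inl, of_apply, Ymat, affine_inl_inl, of_apply, Algebra.algebraMap_eq_smul_one]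
    rfl
  · rw [affine_inl_inr, Ymat, affine_inl_inr]
    simp only [affine_inl_inr, Pi.zero_apply, zero_smul, Finset.sum_const_zero, zero_add]
    split_ifs <;> simp
  · rw [affine_inr_inl, Ymat, affine_inr_inl]
    simp only [affine_inr_inl, zero_smul, Finset.sum_const_zero, zero_add]
  · rw [affine_inr_inr, Ymat, affine_inr_inr]
    simp only [affine_inr_inr, zero_smul, add_zero, ite_smul, one_smul, Finset.sum_ite_eq,
      Finset.mem_univ, if_true]

theorem Xid_PsiHom_inr (g : D.Mink) (q : Fin 4 ⊕ Unit) :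
    Xid (XB hD hF) (D.PsiHom g) (Sum.inr ()) q = if q = Sum.inr () then g else 0 := by
  induction g using D.mink_induction with
  | one =>
    rw [map_one, map_one, one_apply]
    simp only [eq_comm]
  | add a b ha hb =>
    rw [map_add, map_add, Matrix.add_apply, ha, hb]
    split_ifs <;> simp
  | smul c a ha =>
    rw [map_smul, map_smul, Matrix.smul_apply, ha]
    split_ifs <;> simp
  | x_mul i a ha =>
    rw [map_mul, map_mul, mul_apply, Fintype.sum_sum_type, PsiHom_x, Xid_PsiGen]
    simp only [affine_inr_inl, affine_inr_inr, zero_mul, Finset.sum_const_zero, zero_add,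
      Finset.univ_unique, Finset.sum_singleton]
    refine (congrArg _ ha).trans ?_
    split_ifs <;> simp

/-- The partial derivatives of the quantum Minkowski space. -/
def pdB (i : Fin 4) : D.Mink →ₗ[ℂ] D.Mink := pdOf (XB hD hF) D.PsiHom i

theorem pdB_one (i : Fin 4) : pdB hD hF i 1 = 0 := by
  rw [pdB, pdOf_apply, map_one, map_one]
  exact one_apply_ne (by simp)

theorem pdB_x_mul (i k : Fin 4) (g : D.Mink) : pdB hD hF i (D.x k * g) =
    (if k = i then g else 0) +
      ∑ l, ((∑ n, D.R k l i n • D.x n) + D.Z k l i • 1) * pdB hD hF l g := by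
  rw [pdB, pdOf_apply, map_mul, map_mul, mul_apply, Fintype.sum_sum_type, PsiHom_x, Xid_PsiGen,
    add_comm]
  simp only [Finset.univ_unique, Finset.sum_singleton, affine_inl_inl, affine_inl_inr, of_apply,
    Algebra.algebraMap_eq_smul_one]
  refine congrArg₂ _ ?_ rfl
  refine (congrArg _ (Xid_PsiHom_inr hD hF g _)).trans ?_
  rw [if_pos rfl]
  split_ifs <;> simp

theorem pd_ext {pd pd' : Fin 4 → D.Mink →ₗ[ℂ] D.Mink} (h1 : ∀ i, pd i 1 = 0)
    (h1' : ∀ i, pd' i 1 = 0)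
    (h : ∀ i k g, pd i (D.x k * g) = (if k = i then g else 0) +
      ∑ l, ((∑ n, D.R k l i n • D.x n) + D.Z k l i • 1) * pd l g)
    (h' : ∀ i k g, pd' i (D.x k * g) = (if k = i then g else 0) +
      ∑ l, ((∑ n, D.R k l i n • D.x n) + D.Z k l i • 1) * pd' l g) : pd = pd' := by
  have key : ∀ g : D.Mink, ∀ i, pd i g = pd' i g := fun g => by
    induction g using D.mink_induction with
    | one => intro i; rw [h1, h1']
    | add a b ha hb => intro i; rw [map_add, map_add, ha, hb]
    | smul c a ha => intro i; rw [map_smul, map_smul, ha]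
    | x_mul k a ha => intro i; rw [h, h']; simp only [ha]
  exact funext fun i => LinearMap.ext fun g => key g i

/-! ### Covariance of the partial derivatives -/

theorem lTensor_inB_mul (φ : D.Mink →ₗ[ℂ] D.Mink) (b : D.Poin) (t : D.Poin ⊗[ℂ] D.Mink) :
    φ.lTensor D.Poin (D.inB b * t) = D.inB b * φ.lTensor D.Poin t := by
  induction t with
  | zero => simp
  | add s t hs ht => rw [mul_add, map_add, map_add, mul_add, hs, ht]
  | tmul c g =>
    rw [Algebra.TensorProduct.includeLeft_apply, Algebra.TensorProduct.tmul_mul_tmul,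
      LinearMap.lTensor_tmul, LinearMap.lTensor_tmul, Algebra.TensorProduct.tmul_mul_tmul, one_mul,
      one_mul]

theorem inC_mul_tmul (c : D.Mink) (b : D.Poin) (g : D.Mink) :
    D.inC c * (b ⊗ₜ[ℂ] g) = b ⊗ₜ (c * g) := by
  rw [Algebra.TensorProduct.includeRight_apply, Algebra.TensorProduct.tmul_mul_tmul, one_mul]

theorem lTensor_pdB_x_mul (j k : Fin 4) (t : D.Poin ⊗[ℂ] D.Mink) :
    (pdB hD hF j).lTensor D.Poin (D.inC (D.x k) * t) = (if k = j then t else 0) +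
      ∑ l, D.inC ((∑ n, D.R k l j n • D.x n) + D.Z k l j • 1) * (pdB hD hF l).lTensor D.Poin t := by
  induction t with
  | zero => simp
  | add s t hs ht =>
    rw [mul_add, map_add, hs, ht]
    simp only [map_add (LinearMap.lTensor D.Poin _), mul_add, Finset.sum_add_distrib]
    split_ifs
    · abel
    · abel
  | tmul b g =>
    rw [inC_mul_tmul, LinearMap.lTensor_tmul, pdB_x_mul, TensorProduct.tmul_add,
      TensorProduct.tmul_sum]
    refine congrArg₂ _ ?_ (Finset.sum_congr rfl fun l _ => ?_)
    · split_ifs <;> simp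
    · rw [LinearMap.lTensor_tmul, inC_mul_tmul]

/-- The coefficients that arise on moving a derivative through a transformed coordinate. -/
theorem covariance_coefficients (k i j : Fin 4) :
    (∑ n, D.inB (D.Lam k n) * ∑ l, D.inC ((∑ m, D.R n l j m • D.x m) + D.Z n l j • 1) *
      D.inB (D.Lam i l)) + D.inB (D.y k) * D.inB (D.Lam i j) =
    ∑ a, D.inB (D.Lam a j) * ((∑ m, D.R k i a m • D.PsiGen m) + D.Z k i a • 1) := by
  have h1 : ∀ m, ∑ n, ∑ l, D.R n l j m • (D.inB (D.Lam k n) * D.inB (D.Lam i l)) =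
      ∑ a, ∑ b, D.R k i a b • (D.inB (D.Lam a j) * D.inB (D.Lam b m)) := fun m => by
    have h := congrArg D.inB (D.isLorentzPair_B.lamM_lamM_R k i j m)
    simp only [map_sum, map_smul, map_mul, lamM_wB, of_apply] at h
    exact h
  have h2 : D.inB (D.y k) * D.inB (D.Lam i j) +
      ∑ n, ∑ l, D.Z n l j • (D.inB (D.Lam k n) * D.inB (D.Lam i l)) =
      ∑ a, ∑ m, D.R k i a m • (D.inB (D.Lam a j) * D.inB (D.y m)) +
        ∑ a, D.Z k i a • D.inB (D.Lam a j) := by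
    have h := D.y_mul_lamM (w := D.wB) (wb := D.wbB) (y := D.y)
      (by rw [lamM_wB]; exact D.exch_Pm_w) (by rw [lamM_wB]; exact D.exch_Pm_wb) k i j
    have h := congrArg D.inB h
    simp only [map_add, map_sum, map_smul, map_mul, lamM_wB, of_apply] at h
    rw [Finset.sum_comm (f := fun n l => D.Z n l j • (D.inB (D.Lam k n) * D.inB (D.Lam i l)))]
    exact h
  have h3 : (∑ n, D.inB (D.Lam k n) * ∑ l, D.inC ((∑ m, D.R n l j m • D.x m) + D.Z n l j • 1) *
      D.inB (D.Lam i l)) =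
      (∑ m, (∑ n, ∑ l, D.R n l j m • (D.inB (D.Lam k n) * D.inB (D.Lam i l))) * D.inC (D.x m)) +
      ∑ n, ∑ l, D.Z n l j • (D.inB (D.Lam k n) * D.inB (D.Lam i l)) := by
    simp only [Finset.sum_mul]
    rw [Finset.sum_comm, ← Finset.sum_add_distrib]
    refine Finset.sum_congr rfl fun n _ => ?_
    rw [Finset.sum_comm, ← Finset.sum_add_distrib, Finset.mul_sum]
    refine Finset.sum_congr rfl fun l _ => ?_
    rw [(D.commute_inC_inB (D.Lam i l) _).eq, map_add, map_sum, map_smul, map_one, mul_add, mul_add,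
      ← mul_assoc, Finset.mul_sum, mul_smul_comm, mul_smul_comm, mul_one]
    simp only [map_smul, mul_smul_comm, smul_mul_assoc]
  have h4 : (∑ a, D.inB (D.Lam a j) * ((∑ m, D.R k i a m • D.PsiGen m) + D.Z k i a • 1)) =
      (∑ m, (∑ a, ∑ b, D.R k i a b • (D.inB (D.Lam a j) * D.inB (D.Lam b m))) * D.inC (D.x m)) +
      (∑ a, ∑ m, D.R k i a m • (D.inB (D.Lam a j) * D.inB (D.y m)) +
        ∑ a, D.Z k i a • D.inB (D.Lam a j)) := by
    simp only [Finset.sum_mul]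
    rw [Finset.sum_comm, ← add_assoc, ← Finset.sum_add_distrib, ← Finset.sum_add_distrib]
    refine Finset.sum_congr rfl fun a _ => ?_
    rw [Finset.sum_comm, ← Finset.sum_add_distrib, mul_add, mul_smul_comm, mul_one, Finset.mul_sum]
    refine congrArg₂ _ (Finset.sum_congr rfl fun b _ => ?_) rfl
    rw [PsiGen, mul_smul_comm, mul_add, smul_add, Finset.mul_sum, Finset.smul_sum]
    simp only [smul_mul_assoc, mul_assoc]
  rw [h3, h4, add_assoc, add_comm (∑ n, ∑ l, _) (_ * _), h2]
  simp only [h1]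

/-- The partial derivatives are covariant. -/
theorem lTensor_pdB_PsiHom (j : Fin 4) (g : D.Mink) :
    (pdB hD hF j).lTensor D.Poin (D.PsiHom g) =
      ∑ i, D.inB (D.Lam i j) * D.PsiHom (pdB hD hF i g) := by
  induction g using D.mink_induction generalizing j with
  | one =>
    simp only [pdB_one, map_zero, mul_zero, Finset.sum_const_zero, map_one]
    rw [Algebra.TensorProduct.one_def, LinearMap.lTensor_tmul, pdB_one, TensorProduct.tmul_zero]
  | add a b ha hb => simp only [map_add, ha, hb, mul_add, Finset.sum_add_distrib]
  | smul c a ha => simp only [map_smul, ha, mul_smul_comm, Finset.smul_sum]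
  | x_mul k g ih =>
    have h1 : (pdB hD hF j).lTensor D.Poin (D.PsiHom (D.x k * g)) =
        D.inB (D.Lam k j) * D.PsiHom g + ∑ i, ((∑ n, D.inB (D.Lam k n) *
          ∑ l, D.inC ((∑ m, D.R n l j m • D.x m) + D.Z n l j • 1) * D.inB (D.Lam i l)) +
            D.inB (D.y k) * D.inB (D.Lam i j)) * D.PsiHom (pdB hD hF i g) := by
      have e1 : ∀ n, (pdB hD hF j).lTensor D.Poin
          (D.inB (D.Lam k n) * D.inC (D.x n) * D.PsiHom g) =
          (if n = j then D.inB (D.Lam k n) * D.PsiHom g else 0) +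
          ∑ i, D.inB (D.Lam k n) * (∑ l, D.inC ((∑ m, D.R n l j m • D.x m) + D.Z n l j • 1) *
            D.inB (D.Lam i l)) * D.PsiHom (pdB hD hF i g) := fun n => by
        rw [mul_assoc, lTensor_inB_mul, lTensor_pdB_x_mul, mul_add, mul_ite, mul_zero,
          Finset.mul_sum]
        refine congrArg₂ _ rfl ?_
        simp only [ih, Finset.mul_sum, Finset.sum_mul, mul_assoc]
        exact Finset.sum_comm
      rw [map_mul, PsiHom_x, PsiGen, add_mul, map_add, lTensor_inB_mul, ih, Finset.sum_mul, map_sum]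
      simp only [e1, Finset.sum_add_distrib, Finset.sum_ite_eq', Finset.mem_univ, if_true]
      rw [add_assoc, Finset.sum_comm, Finset.mul_sum, ← Finset.sum_add_distrib]
      refine congrArg₂ _ rfl (Finset.sum_congr rfl fun i _ => ?_)
      rw [add_mul, Finset.sum_mul, mul_assoc]
    have h2 : ∑ i, D.inB (D.Lam i j) * D.PsiHom (pdB hD hF i (D.x k * g)) =
        D.inB (D.Lam k j) * D.PsiHom g + ∑ i, (∑ a, D.inB (D.Lam a j) *
          ((∑ m, D.R k i a m • D.PsiGen m) + D.Z k i a • 1)) * D.PsiHom (pdB hD hF i g) := by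
      have e1 : ∀ i, D.inB (D.Lam i j) * D.PsiHom (pdB hD hF i (D.x k * g)) =
          (if k = i then D.inB (D.Lam i j) * D.PsiHom g else 0) +
          ∑ l, D.inB (D.Lam i j) * ((∑ m, D.R k l i m • D.PsiGen m) + D.Z k l i • 1) *
            D.PsiHom (pdB hD hF l g) := fun i => by
        rw [pdB_x_mul, map_add, apply_ite D.PsiHom, map_zero, mul_add, mul_ite, mul_zero, map_sum,
          Finset.mul_sum]
        simp only [map_mul, map_add, map_sum, map_smul, PsiHom_x, map_one, mul_assoc]
      simp only [e1, Finset.sum_add_distrib, Finset.sum_ite_eq, Finset.mem_univ, if_true]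
      rw [Finset.sum_comm]
      simp only [Finset.sum_mul]
    rw [h1, h2]
    simp only [covariance_coefficients]

end PoincareData

end QuantumMinkowski

end

noncomputable section

namespace QuantumMinkowski

open Matrix
open scoped Kronecker

/-! ### Intertwining by the gamma matrices -/

/-- Completeness of the Pauli matrices. -/
theorem sum_pauli_mul_pauli (A B C E : Fin 2) :
    ∑ i, pauli i A B * pauli i C E = if A = E ∧ B = C then 2 else 0 := by
  fin_cases A <;> fin_cases B <;> fin_cases C <;> fin_cases E <;>
    simp [Fin.sum_univ_four, pauli] <;> norm_num

section pair

variable {S : Type} [Ring S] [Algebra ℂ S]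

theorem sum_pauli_smul_lamM (w wb : Matrix (Fin 2) (Fin 2) S) (b : Fin 4) (A B : Fin 2) :
    ∑ i, pauli i A B • lamM w wb b i = ∑ P, ∑ Q, pauli b Q P • (w P B * wb Q A) := by
  have h : ∀ P Q C E, ∑ i, pauli i A B • (Vinv b P Q * V C E i) • (w P C * wb Q E) =
      if A = E ∧ B = C then pauli b Q P • (w P C * wb Q E) else 0 := fun P Q C E => by
    have : ∀ i, pauli i A B * (Vinv b P Q * V C E i) = Vinv b P Q * (pauli i A B * pauli i C E) :=
      fun i => by rw [V]; ring
    simp only [smul_smul, ← Finset.sum_smul, this, ← Finset.mul_sum, sum_pauli_mul_pauli]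
    split_ifs
    · rw [Vinv]
      ring_nf
    · simp
  simp only [lamM_apply, Finset.smul_sum]
  rw [Finset.sum_comm]
  refine Finset.sum_congr rfl fun P _ => ?_
  rw [Finset.sum_comm]
  refine Finset.sum_congr rfl fun Q _ => ?_
  rw [Finset.sum_comm]
  refine Eq.trans (Finset.sum_congr rfl fun C _ =>
    Finset.sum_comm.trans (Finset.sum_congr rfl fun E _ => h P Q C E)) ?_
  rw [Finset.sum_eq_single B, Finset.sum_eq_single A]
  · simp
  · intro E _ hE
    rw [if_neg fun h => hE h.1.symm]
  · simp
  · intro C _ hC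
    exact Finset.sum_eq_zero fun E _ => if_neg fun h => hC h.2.symm
  · simp

/-- The matrix `E⁻¹ w E`, which is the inverse of `wᵀ`. -/
def contra (L : LorentzCase) (w : Matrix (Fin 2) (Fin 2) S) : Matrix (Fin 2) (Fin 2) S :=
  L.E'.map (algebraMap ℂ S) * w * L.E.map (algebraMap ℂ S)

end pair

namespace PoincareData

variable (D : PoincareData) {S : Type} [Ring S] [Algebra ℂ S] {w wb : Matrix (Fin 2) (Fin 2) S}

/-- The matrix `σ_i ∘ τ X⁻¹ τ`. -/
def sigmaD (i : Fin 4) : Matrix (Fin 2) (Fin 2) ℂ :=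
  of fun k l => ∑ a, ∑ b, pauli i a b * D.Xm⁻¹ (b, a) (l, k)

theorem gammaA_eq (i : Fin 4) :
    D.gammaA i = D.lor.qHalf⁻¹ • (D.lor.Eᵀ * D.sigmaD i * D.lor.E) := rfl

variable {D}

theorem contra_mul_transpose (h : IsLorentzPair D.lor w wb) : contra D.lor w * wᵀ = 1 := by
  rw [contra, mul_assoc, mul_assoc, ← mul_assoc w, h.w_E, ← map_algebraMap_mul, D.lor.E'_mul_E,
    Matrix.map_one _ (map_zero _) (map_one _)]

/-- The mixed relation turns `w ⊗ w̄` into `w̄ ⊗ w`: the matrices `σ_i ∘ D` intertwine as the Pauli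
matrices do, with the two factors exchanged. -/
theorem sum_sigmaD_smul_lamM (h : IsLorentzPair D.lor w wb) (b : Fin 4) (k l : Fin 2) :
    ∑ i, D.sigmaD i k l • lamM w wb b i =
      (wbᵀ * (D.sigmaD b)ᵀ.map (algebraMap ℂ S) * w) l k := by
  have hX := (exch_blk_iff _).mp h.exch_w_wb
  have hX' : ∀ P Q, ∑ c, ∑ d, D.Xm⁻¹ (c, d) (l, k) • (w P c * wb Q d) =
      ∑ c, ∑ d, D.Xm⁻¹ (P, Q) (c, d) • (wb c l * w d k) := fun P Q => by
    have := congrFun (congrFun hX (P, Q)) (l, k)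
    simpa only [mul_apply, map_apply, kroneckerMap_apply, Fintype.sum_prod_type, ← Algebra.commutes,
      ← Algebra.smul_def] using this
  calc _ = ∑ a, ∑ b', D.Xm⁻¹ (b', a) (l, k) • ∑ i, pauli i a b' • lamM w wb b i := by
        simp only [sigmaD, of_apply, Finset.sum_smul, Finset.smul_sum, smul_smul, mul_comm]
        rw [Finset.sum_comm]
        exact Finset.sum_congr rfl fun a _ => Finset.sum_comm
    _ = ∑ P, ∑ Q, pauli b Q P • ∑ c, ∑ d, D.Xm⁻¹ (c, d) (l, k) • (w P c * wb Q d) := by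
        simp only [sum_pauli_smul_lamM, Fin.sum_univ_two, smul_add, smul_smul, mul_comm]
        abel
    _ = _ := by
        simp only [hX']
        simp only [mul_apply, map_apply, transpose_apply, sigmaD, of_apply, Fin.sum_univ_two,
          smul_add, map_add, mul_add, add_mul, smul_smul, ← Algebra.commutes,
          ← Algebra.smul_def, smul_mul_assoc]
        abel

/-- The Pauli matrices, in the lower left block of `γ`, intertwine `w̄` with `(wᵀ)⁻¹ ⊗ Λ`. -/
theorem sum_pauli_smul_wb (h : IsLorentzPair D.lor w wb) (b : Fin 4) (A K : Fin 2) :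
    ∑ M, pauli b M A • wb M K =
      ∑ M, ∑ i, pauli i K M • (contra D.lor w A M * lamM w wb b i) := by
  have h1 : ∀ P, ∑ M, contra D.lor w A M * w P M = if A = P then 1 else 0 := fun P => by
    have := congrFun (congrFun (contra_mul_transpose h) A) P
    rwa [mul_apply, one_apply] at this
  calc _ = ∑ P, ∑ Q, pauli b Q P • ((∑ M, contra D.lor w A M * w P M) * wb Q K) := by
        simp only [h1, ite_mul, one_mul, zero_mul, smul_ite, smul_zero, Finset.sum_ite_irrel,
          Finset.sum_const_zero, Finset.sum_ite_eq, Finset.mem_univ, if_true]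
    _ = ∑ M, contra D.lor w A M * ∑ i, pauli i K M • lamM w wb b i := by
        simp only [sum_pauli_smul_lamM, Fin.sum_univ_two, mul_add, add_mul, smul_add,
          mul_smul_comm, mul_assoc]
        abel
    _ = _ := by simp only [Finset.mul_sum, mul_smul_comm]

/-- The matrices `A_i`, in the upper right block of `γ`, intertwine `(wᵀ)⁻¹` with `w̄ ⊗ Λ`. -/
theorem sum_gammaA_smul_contra (h : IsLorentzPair D.lor w wb) (b : Fin 4) (A K : Fin 2) :
    ∑ M, D.gammaA b M A • contra D.lor w M K =
      ∑ M, ∑ i, D.gammaA i K M • (wb A M * lamM w wb b i) := by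
  have hwb := h.wb_E
  set E := D.lor.E.map (algebraMap ℂ S) with hE
  set Et := D.lor.Eᵀ.map (algebraMap ℂ S) with hEt
  set E' := D.lor.E'.map (algebraMap ℂ S) with hE'
  set N := (D.sigmaD b)ᵀ.map (algebraMap ℂ S) with hN
  have hEE : E * E' = 1 := by
    rw [hE, hE', ← map_algebraMap_mul, D.lor.E_mul_E', Matrix.map_one _ (map_zero _) (map_one _)]
  have h1 : ((D.lor.Eᵀ * D.sigmaD b * D.lor.E)ᵀ).map (algebraMap ℂ S) = Et * N * E := by
    rw [transpose_mul, transpose_mul, transpose_transpose, ← mul_assoc, map_algebraMap_mul,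
      map_algebraMap_mul]
  have key : Et * N * E * contra D.lor w = wb * Et * (wbᵀ * N * w) * E := by
    calc _ = Et * N * (E * E') * w * E := by simp only [contra, mul_assoc, hE, hE']
      _ = wb * Et * wbᵀ * N * w * E := by rw [hEE, mul_one, hwb]
      _ = _ := by simp only [mul_assoc]
  have e1 : ∑ M, D.gammaA b M A • contra D.lor w M K =
      D.lor.qHalf⁻¹ • (Et * N * E * contra D.lor w) A K := by
    rw [← h1, mul_apply, Finset.smul_sum]
    refine Finset.sum_congr rfl fun M _ => ?_
    rw [gammaA_eq, Matrix.smul_apply, smul_assoc, map_apply, transpose_apply, Algebra.smul_def _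
      (contra D.lor w M K)]
  have e2 : ∀ T : Matrix (Fin 2) (Fin 2) S,
      (∀ k l, ∑ i, D.sigmaD i k l • lamM w wb b i = T l k) →
      ∑ M, ∑ i, D.gammaA i K M • (wb A M * lamM w wb b i) =
        D.lor.qHalf⁻¹ • (wb * Et * T * E) A K := fun T hT => by
    have e3 : ∀ M, ∑ i, D.gammaA i K M • (wb A M * lamM w wb b i) = D.lor.qHalf⁻¹ •
        ∑ l, ∑ k, (D.lor.E k K * D.lor.E l M) • (wb A M * T l k) := fun M => by
      simp only [← hT, gammaA_eq, Matrix.smul_apply, smul_assoc, ← Finset.smul_sum]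
      refine congrArg _ ?_
      simp only [mul_apply, transpose_apply, Finset.mul_sum, Finset.sum_mul, Finset.sum_smul,
        Finset.smul_sum, mul_smul_comm, smul_smul]
      rw [Finset.sum_comm]
      refine Finset.sum_congr rfl fun l _ => ?_
      rw [Finset.sum_comm]
      refine Finset.sum_congr rfl fun k _ => Finset.sum_congr rfl fun i _ => ?_
      congr 1
      ring
    simp only [e3, ← Finset.smul_sum]
    refine congrArg _ ?_
    simp only [mul_apply, hE, hEt, map_apply, transpose_apply, Fin.sum_univ_two, add_mul,
      ← Algebra.commutes, mul_add, ← Algebra.smul_def, smul_mul_assoc, smul_smul]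
    abel
  rw [e1, e2 _ (sum_sigmaD_smul_lamM h b), key]

end PoincareData

end QuantumMinkowski

end

noncomputable section

namespace QuantumMinkowski

open Matrix
open scoped Kronecker

/-! ### The exchange of the spin representation with the vector representation -/

section exchange

variable {S n : Type} [Ring S] [Algebra ℂ S] [Fintype n] [DecidableEq n]

/-- The exchange relation, multiplied on both sides by the inverse of its coefficients. -/
theorem Exch.inv {u : Matrix n n S} {w : Matrix (Fin 2) (Fin 2) S}
    {g s : Matrix (Fin 2) (Fin 2) (Matrix n n ℂ)} (h : Exch u w g) (hs : s * g = 1)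
    (A B : Fin 2) (i j : n) : ∑ C, ∑ l, s A C i l • (u l j * w C B) =
      ∑ C, ∑ l, s C B l j • (w A C * u i l) := by
  have h1 : ∀ A B i j, star (conj2 s A B i j) = s A B i j := fun A B i j => star_star _
  have h2 : conj2 (conj2 s) = s := by
    ext A B i j
    exact h1 A B i j
  have := (exch_conj_iff (g := conj2 s) (by rw [h2]; exact hs)).mp h A B i j
  simp only [h1] at this
  exact this.symm

theorem conj_exchange {R : Type} [Ring R] {U W G p r : R} (h : U * (W * G) = G * W * U)
    (hp : U * p = p * U) (hr : U * r = r * U) (hrp : r * p = 1) :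
    U * (p * W * r * (p * G * r)) = p * G * r * (p * W * r) * U :=
  calc _ = U * p * W * (r * p) * G * r := by simp only [mul_assoc]
    _ = p * (U * (W * G)) * r := by rw [hrp, hp, mul_one]; simp only [mul_assoc]
    _ = p * G * W * (U * r) := by rw [h]; simp only [mul_assoc]
    _ = p * G * (r * p) * W * r * U := by rw [hr, hrp, mul_one]; simp only [mul_assoc]
    _ = _ := by simp only [mul_assoc]

theorem map_scalar_algebraMap (M : Matrix (Fin 2) (Fin 2) ℂ) :
    (M.map (algebraMap ℂ S)).map (scalar n) = M.map (algebraMap ℂ (Matrix n n S)) := by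
  ext A B : 1
  rw [map_apply, map_apply, map_apply, Matrix.algebraMap_eq_diagonal, scalar_apply]
  rfl

theorem map_cst_algebraMap (M : Matrix (Fin 2) (Fin 2) ℂ) :
    (M.map (algebraMap ℂ (Matrix n n ℂ))).map (cst S n) =
      M.map (algebraMap ℂ (Matrix n n S)) := by
  ext A B : 1
  rw [map_apply, map_apply, map_apply, AlgHom.commutes]

/-- Conjugation of the exchange relation by scalar matrices. -/
theorem Exch.conj {u : Matrix n n S} {w : Matrix (Fin 2) (Fin 2) S}
    {g : Matrix (Fin 2) (Fin 2) (Matrix n n ℂ)} (h : Exch u w g) {P Q : Matrix (Fin 2) (Fin 2) ℂ}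
    (hQP : Q * P = 1) :
    Exch u (P.map (algebraMap ℂ S) * w * Q.map (algebraMap ℂ S))
      (P.map (algebraMap ℂ (Matrix n n ℂ)) * g * Q.map (algebraMap ℂ (Matrix n n ℂ))) := by
  have e3 : ∀ M : Matrix (Fin 2) (Fin 2) ℂ,
      scalar (Fin 2) u * M.map (algebraMap ℂ (Matrix n n S)) =
        M.map (algebraMap ℂ (Matrix n n S)) * scalar (Fin 2) u := fun M =>
    (commute_scalar_map_of_forall (u := u) (h := M.map (algebraMap ℂ (Matrix n n S)))
      fun A B => (Algebra.commute_algebraMap_left (M A B) u).symm).eq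
  have e4 : Q.map (algebraMap ℂ (Matrix n n S)) * P.map (algebraMap ℂ (Matrix n n S)) = 1 := by
    rw [← Matrix.map_mul, hQP, Matrix.map_one _ (map_zero _) (map_one _)]
  rw [Exch] at h ⊢
  rw [Matrix.map_mul, Matrix.map_mul, Matrix.map_mul, Matrix.map_mul, map_scalar_algebraMap,
    map_scalar_algebraMap, map_cst_algebraMap, map_cst_algebraMap]
  set U := scalar (Fin 2) u
  set W := w.map (scalar n)
  set G := g.map (cst S n)
  set p := P.map (algebraMap ℂ (Matrix n n S))
  set r := Q.map (algebraMap ℂ (Matrix n n S))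
  exact conj_exchange h (e3 P) (e3 Q) e4

end exchange

theorem contra_apply {S : Type} [Ring S] [Algebra ℂ S] (L : LorentzCase)
    (w : Matrix (Fin 2) (Fin 2) S) (A B : Fin 2) :
    contra L w A B = ∑ c, ∑ d, (L.E' A c * L.E d B) • w c d := by
  simp only [contra, mul_apply, map_apply, Finset.sum_mul]
  rw [Finset.sum_comm]
  refine Finset.sum_congr rfl fun c _ => Finset.sum_congr rfl fun d _ => ?_
  rw [← Algebra.commutes, ← mul_assoc, ← map_mul, mul_comm, ← Algebra.smul_def, mul_comm]

namespace PoincareData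

variable (D : PoincareData)

theorem cw_eq : of D.cw = contra D.lor D.wB := by
  ext A B
  rw [contra_apply]
  rfl

/-- The gamma matrices intertwine the spin representation and its product with `Λ`. -/
theorem sum_gamma_smul_Gspin (a b : ℂ) (i : Fin 4) (c s : Spin) :
    ∑ m, D.gamma a b i m c • D.Gspin m s =
      ∑ m, ∑ j, D.gamma a b j s m • (D.Gspin c m * D.Lam i j) := by
  have h := D.isLorentzPair_B
  have hc := D.cw_eq
  simp only [Lam_eq]
  rcases c with A | A <;> rcases s with K | K
  · simp [gamma, Gspin]
  · have := congrArg (a • ·) (sum_pauli_smul_wb h i A K)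
    simp only [← hc] at this
    simpa [gamma, Gspin, Finset.smul_sum, smul_smul] using this
  · have := congrArg (b • ·) (sum_gammaA_smul_contra h i A K)
    simp only [← hc] at this
    simpa [gamma, Gspin, Finset.smul_sum, smul_smul] using this
  · simp [gamma, Gspin]

variable {D} (hD : D.IsQuantumPoincareGroup) (hF : ∀ i j n m, D.Ftilde i j n m = 0)

/-- The value of `f` on the inverse of `ᶜw`. -/
def fcinv (D : PoincareData) : Matrix (Fin 2) (Fin 2) (Matrix (Fin 4) (Fin 4) ℂ) :=
  contra D.lor (D.wAinv.map D.fhom)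

theorem fcinv_mul : D.fcinv * contra D.lor D.fw = 1 := by
  have h : ∀ M : Matrix (Fin 2) (Fin 2) ℂ, ∀ N : Matrix (Fin 2) (Fin 2) ℂ, M * N = 1 →
      M.map (algebraMap ℂ (Matrix (Fin 4) (Fin 4) ℂ)) *
        N.map (algebraMap ℂ (Matrix (Fin 4) (Fin 4) ℂ)) = 1 := fun M N h => by
    rw [← Matrix.map_mul, h, Matrix.map_one _ (map_zero _) (map_one _)]
  rw [fcinv, contra, contra]
  calc _ = D.lor.E'.map (algebraMap ℂ (Matrix (Fin 4) (Fin 4) ℂ)) * (D.wAinv.map D.fhom) *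
        (D.lor.E.map (algebraMap ℂ (Matrix (Fin 4) (Fin 4) ℂ)) *
          D.lor.E'.map (algebraMap ℂ (Matrix (Fin 4) (Fin 4) ℂ))) * D.fw *
        D.lor.E.map (algebraMap ℂ (Matrix (Fin 4) (Fin 4) ℂ)) := by simp only [mul_assoc]
    _ = _ := by
      rw [h _ _ D.lor.E_mul_E', mul_one, mul_assoc _ _ D.fw, fhom_inv_mul_fw, mul_one,
        h _ _ D.lor.E'_mul_E]

theorem XB_w (A B : Fin 2) : XB hD hF (D.w A B) =
    affine ((D.wAinv.map D.fhom) A B)ᵀ 0 (if A = B then 1 else 0) := by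
  rw [← wX_apply, ← incl_wA, XB_incl]
  rfl

theorem XB_wbar (A B : Fin 2) : XB hD hF (D.wbar A B) =
    affine ((D.wbarAinv.map D.fhom) A B)ᵀ 0 (if A = B then 1 else 0) := by
  rw [← wbX_apply, ← incl_wbarA, XB_incl]
  rfl

theorem XB_cw_inl_inl (A B : Fin 2) (i j : Fin 4) :
    XB hD hF (D.cw A B) (Sum.inl i) (Sum.inl j) = D.fcinv A B j i := by
  simp only [cw, map_sum, map_smul, Matrix.sum_apply, Matrix.smul_apply, XB_w, affine_inl_inl,
    transpose_apply, fcinv, contra_apply]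

theorem XB_Gspin_inl_inr (a l : Spin) (i : Fin 4) :
    XB hD hF (D.Gspin a l) (Sum.inl i) (Sum.inr ()) = 0 := by
  rcases a with A | A <;> rcases l with B | B
  · simp [Gspin, cw, XB_w, affine_inl_inr]
  · simp [Gspin]
  · simp [Gspin]
  · simp [Gspin, XB_wbar, affine_inl_inr]

theorem exch_cw : Exch (of D.Lam) (of D.cw) (contra D.lor D.fw) := by
  have h := D.isLorentzPair_B.exch_lamM_w
  rw [lamM_wB] at h
  rw [cw_eq]
  exact h.conj D.lor.E_mul_E'

/-- The exchange of the spin representation with `Λ`, in terms of the values of `𝐗`. -/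
theorem exch_Gspin (a m : Spin) (j q : Fin 4) :
    ∑ l, ∑ p, XB hD hF (D.Gspin l m) (Sum.inl j) (Sum.inl p) • (D.Gspin a l * D.Lam q p) =
      ∑ i, ∑ l, XB hD hF (D.Gspin a l) (Sum.inl i) (Sum.inl q) • (D.Lam i j * D.Gspin l m) := by
  conv_rhs => rw [Finset.sum_comm]
  rcases a with A | A <;> rcases m with B | B
  · have h := (exch_cw (D := D)).inv fcinv_mul A B q j
    simp only [of_apply] at h
    simp only [Fintype.sum_sum_type, Gspin, fromBlocks_apply₁₁, fromBlocks_apply₁₂,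
      fromBlocks_apply₂₁, of_apply, XB_cw_inl_inl, Matrix.zero_apply, zero_mul, mul_zero, smul_zero,
      Finset.sum_const_zero, add_zero]
    exact h.symm
  · simp [Gspin]
  · simp [Gspin]
  · have h0 := D.isLorentzPair_B.exch_lamM_wb
    rw [lamM_wB] at h0
    have h := h0.inv D.fhom_inv_mul_fwb A B q j
    simp only [of_apply] at h
    simp only [Fintype.sum_sum_type, Gspin, fromBlocks_apply₂₂, fromBlocks_apply₁₂,
      fromBlocks_apply₂₁, of_apply, XB_wbar, affine_inl_inl, transpose_apply, Matrix.zero_apply,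
      zero_mul, mul_zero, smul_zero, Finset.sum_const_zero, zero_add]
    exact h.symm

/-- The consequence of the intertwining property for the values of `𝐗`. -/
theorem sum_gamma_mul_XB_Gspin (a b : ℂ) (k j p : Fin 4) (c s : Spin) :
    ∑ m, D.gamma a b k m c * XB hD hF (D.Gspin m s) (Sum.inl j) (Sum.inl p) =
      ∑ m, ∑ i, ∑ r, D.gamma a b i s m * (XB hD hF (D.Gspin c m) (Sum.inl j) (Sum.inl r) *
        D.R k p r i) := by
  have h := congrArg (fun t => XB hD hF t (Sum.inl j) (Sum.inl p))
    (D.sum_gamma_smul_Gspin a b k c s)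
  simp only [map_sum, map_smul, map_mul, Matrix.sum_apply, Matrix.smul_apply, smul_eq_mul] at h
  refine h.trans (Finset.sum_congr rfl fun m _ => Finset.sum_congr rfl fun i _ => ?_)
  rw [← Finset.mul_sum, mul_apply, Fintype.sum_sum_type]
  simp only [XB_Lam, affine_inl_inl, affine_inr_inl, mul_zero, Finset.sum_const_zero, add_zero,
    of_apply]

end PoincareData

end QuantumMinkowski

end

noncomputable section

namespace QuantumMinkowski

open Matrix

namespace PoincareData

variable {D : PoincareData}

/-! ### Slices of the tensor product -/

section slice

variable (X : D.Poin →ₐ[ℂ] Matrix (Fin 4 ⊕ Unit) (Fin 4 ⊕ Unit) ℂ) {W W' : Type}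
  [AddCommGroup W] [Module ℂ W] [AddCommGroup W'] [Module ℂ W']

/-- The application of the entry `(p, q)` of `𝐗` to the first tensor factor. -/
def slice (W : Type) [AddCommGroup W] [Module ℂ W] (p q : Fin 4 ⊕ Unit) : D.Poin ⊗[ℂ] W →ₗ[ℂ] W :=
  (TensorProduct.lid ℂ W).toLinearMap ∘ₗ
    ((Matrix.entryLinearMap ℂ ℂ p q).comp X.toLinearMap).rTensor W

theorem slice_tmul (p q : Fin 4 ⊕ Unit) (b : D.Poin) (v : W) :
    slice X W p q (b ⊗ₜ v) = X b p q • v := rfl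

theorem slice_mulLeft (p q : Fin 4 ⊕ Unit) (b : D.Poin) (t : D.Poin ⊗[ℂ] W) :
    slice X W p q ((LinearMap.mulLeft ℂ b).rTensor W t) = ∑ r, X b p r • slice X W r q t := by
  induction t with
  | zero => simp
  | add s t hs ht => simp only [map_add, hs, ht, smul_add, Finset.sum_add_distrib]
  | tmul c v =>
    rw [LinearMap.rTensor_tmul, LinearMap.mulLeft_apply, slice_tmul, map_mul, mul_apply,
      Finset.sum_smul]
    simp only [slice_tmul, smul_smul]

theorem slice_lTensor (p q : Fin 4 ⊕ Unit) (φ : W →ₗ[ℂ] W') (t : D.Poin ⊗[ℂ] W) :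
    slice X W' p q (φ.lTensor D.Poin t) = φ (slice X W p q t) := by
  induction t with
  | zero => simp
  | add s t hs ht => simp only [map_add, hs, ht]
  | tmul c v => rw [LinearMap.lTensor_tmul, slice_tmul, slice_tmul, map_smul]

theorem slice_eq_Xid (p q : Fin 4 ⊕ Unit) (t : D.Poin ⊗[ℂ] D.Mink) :
    slice X D.Mink p q t = Xid X t p q := by
  induction t with
  | zero => rw [map_zero, map_zero]; rfl
  | add s t hs ht => rw [map_add, map_add, Matrix.add_apply, hs, ht]
  | tmul c v => rw [slice_tmul, Xid_tmul_apply]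

theorem inB_mul (b : D.Poin) (t : D.Poin ⊗[ℂ] D.Mink) :
    D.inB b * t = (LinearMap.mulLeft ℂ b).rTensor D.Mink t := by
  induction t with
  | zero => simp
  | add s t hs ht => rw [mul_add, map_add, hs, ht]
  | tmul c v =>
    rw [Algebra.TensorProduct.includeLeft_apply, Algebra.TensorProduct.tmul_mul_tmul, one_mul]
    rfl

end slice

variable (hD : D.IsQuantumPoincareGroup) (hF : ∀ i j n m, D.Ftilde i j n m = 0)

theorem slice_PsiHom (i : Fin 4) (g : D.Mink) :
    slice (XB hD hF) D.Mink (Sum.inl i) (Sum.inr ()) (D.PsiHom g) = pdB hD hF i g :=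
  slice_eq_Xid _ _ _ _

/-- The exchange relation of the partial derivatives. -/
theorem pdB_pdB (j k : Fin 4) (g : D.Mink) : pdB hD hF j (pdB hD hF k g) =
    ∑ i, ∑ l, D.R i l k j • pdB hD hF l (pdB hD hF i g) := by
  rw [← slice_PsiHom hD hF k, ← slice_lTensor, lTensor_pdB_PsiHom, map_sum]
  refine Finset.sum_congr rfl fun i _ => ?_
  rw [inB_mul, slice_mulLeft, Fintype.sum_sum_type]
  simp only [XB_Lam, affine_inl_inl, affine_inl_inr, of_apply, slice_PsiHom, Pi.zero_apply,
    zero_smul, Finset.sum_const_zero, add_zero]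

/-! ### Bispinors -/

theorem bispinor_ext {N : Type} [AddCommGroup N] [Module ℂ N] {φ ψ : D.Bispinor →ₗ[ℂ] N}
    (h : ∀ (a : Spin) (g : D.Mink), φ (Pi.single a 1 ⊗ₜ g) = ψ (Pi.single a 1 ⊗ₜ g)) : φ = ψ := by
  refine TensorProduct.ext ((Pi.basisFun ℂ Spin).ext fun a => LinearMap.ext fun g => ?_)
  rw [Pi.basisFun_apply]
  exact h a g

theorem PsiTilde_single (Ψ : D.Mink →⋆ₐ[ℂ] D.Poin ⊗[ℂ] D.Mink) (a : Spin) (g : D.Mink) :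
    PsiTilde Ψ (Pi.single a 1 ⊗ₜ g) =
      ∑ l, (LinearMap.mulLeft ℂ (D.Gspin a l)).rTensor D.Bispinor
        ((TensorProduct.mk ℂ (Spin → ℂ) D.Mink (Pi.single l 1)).lTensor D.Poin (Ψ g)) := by
  rw [PsiTilde, LinearMap.sum_apply, Finset.sum_eq_single a]
  · rw [LinearMap.sum_apply]
    refine Finset.sum_congr rfl fun l _ => ?_
    rw [← LinearMap.comp_apply (LinearMap.rTensor _ _), LinearMap.rTensor_comp_lTensor]
    simp only [LinearMap.comp_apply, LinearMap.rTensor_tmul, LinearMap.proj_apply,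
      LinearEquiv.coe_coe, TensorProduct.lid_tmul, Pi.single_eq_same, one_smul]
    rfl
  · intro c _ hc
    rw [LinearMap.sum_apply]
    refine Finset.sum_eq_zero fun l _ => ?_
    simp only [LinearMap.comp_apply, LinearMap.rTensor_tmul, LinearMap.proj_apply,
      Pi.single_eq_of_ne hc, TensorProduct.zero_tmul, map_zero]
  · simp

theorem dirac_single (a b : ℂ) (pd : Fin 4 → D.Mink →ₗ[ℂ] D.Mink) (c : Spin) (g : D.Mink) :
    dirac a b pd (Pi.single c 1 ⊗ₜ g) =
      ∑ i, ∑ m, D.gamma a b i m c • (Pi.single m 1 ⊗ₜ[ℂ] pd i g : D.Bispinor) := by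
  rw [dirac, LinearMap.sum_apply]
  refine Finset.sum_congr rfl fun i _ => ?_
  have h : (D.gamma a b i) *ᵥ Pi.single c 1 =
      ∑ m, D.gamma a b i m c • (Pi.single m 1 : Spin → ℂ) := by
    rw [mulVec_single_one]
    ext m
    simp [Pi.single_apply, Finset.sum_apply]
  rw [TensorProduct.map_tmul, toLin'_apply, h, TensorProduct.sum_tmul]
  rfl

theorem pdTilde_single (j : Fin 4) (a : Spin) (g : D.Mink) :
    pdTilde (XB hD hF) D.PsiHom j (Pi.single a 1 ⊗ₜ g) =
      ∑ l, ∑ p, XB hD hF (D.Gspin a l) (Sum.inl j) (Sum.inl p) •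
        (Pi.single l 1 ⊗ₜ[ℂ] pdB hD hF p g : D.Bispinor) := by
  change slice (XB hD hF) D.Bispinor (Sum.inl j) (Sum.inr ()) (PsiTilde _ _) = _
  rw [PsiTilde_single, map_sum]
  refine Finset.sum_congr rfl fun l _ => ?_
  rw [slice_mulLeft, Fintype.sum_sum_type]
  simp only [slice_lTensor, slice_PsiHom, Finset.univ_unique, Finset.sum_singleton,
    TensorProduct.mk_apply]
  rw [show (default : Unit) = () from rfl, XB_Gspin_inl_inr, zero_smul, add_zero]

/-- The summation behind the commutation with the Dirac operator: second derivatives `v` with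
`∂∂ = R ∂∂`, and gamma matrices `γ` which intertwine the coefficients `K` with `K R`. -/
theorem sum_exchange {σ ι N : Type} [Fintype σ] [Fintype ι] [AddCommGroup N] [Module ℂ N]
    {v : σ → ι → ι → N} {γ : ι → σ → σ → ℂ} {K : σ → σ → ι → ℂ} {R : ι → ι → ι → ι → ℂ}
    (hv : ∀ s i r, v s i r = ∑ k, ∑ p, R k p r i • v s p k)
    (hγ : ∀ k p c s, ∑ m, γ k m c * K m s p = ∑ m, ∑ i, ∑ r, γ i s m * (K c m r * R k p r i))
    (c : σ) : ∑ i, ∑ m, ∑ s, ∑ p, (γ i m c * K m s p) • v s p i =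
      ∑ m, ∑ r, ∑ i, ∑ s, (K c m r * γ i s m) • v s i r := by
  have h1 : ∀ i, ∑ m, ∑ s, ∑ p, (γ i m c * K m s p) • v s p i =
      ∑ s, ∑ p, ∑ m, ∑ i', ∑ r, (γ i' s m * (K c m r * R i p r i')) • v s p i := fun i => by
    rw [Finset.sum_comm]
    refine Finset.sum_congr rfl fun s _ => ?_
    rw [Finset.sum_comm]
    refine Finset.sum_congr rfl fun p _ => ?_
    rw [← Finset.sum_smul, hγ]
    simp only [Finset.sum_smul]
  have h2 : ∀ m r i s, (K c m r * γ i s m) • v s i r =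
      ∑ k, ∑ p, (γ i s m * (K c m r * R k p r i)) • v s p k := fun m r i s => by
    rw [hv]
    simp only [Finset.smul_sum, smul_smul]
    refine Finset.sum_congr rfl fun k _ => Finset.sum_congr rfl fun p _ => ?_
    rw [mul_right_comm, mul_comm (_ * _) (γ i s m)]
  simp only [h1, h2]
  simp only [← Fintype.sum_prod_type']
  exact Fintype.sum_equiv
    { toFun := fun (k, s, p, m, i, r) => (m, r, i, s, k, p)
      invFun := fun (m, r, i, s, k, p) => (k, s, p, m, i, r)
      left_inv := fun _ => rfl
      right_inv := fun _ => rfl } _ _ fun _ => rfl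

/-- The derivatives of bispinors commute with the Dirac operator. -/
theorem pdTilde_comp_dirac (a b : ℂ) (j : Fin 4) :
    pdTilde (XB hD hF) D.PsiHom j ∘ₗ dirac a b (pdB hD hF) =
      dirac a b (pdB hD hF) ∘ₗ pdTilde (XB hD hF) D.PsiHom j := by
  refine bispinor_ext fun c g => ?_
  rw [LinearMap.comp_apply, LinearMap.comp_apply, dirac_single, pdTilde_single, map_sum, map_sum]
  simp only [map_sum, map_smul, pdTilde_single, dirac_single, Finset.smul_sum, smul_smul]
  refine sum_exchange
    (v := fun s p i => (Pi.single s 1 ⊗ₜ[ℂ] pdB hD hF p (pdB hD hF i g) : D.Bispinor))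
    (γ := D.gamma a b) (K := fun m s p => XB hD hF (D.Gspin m s) (Sum.inl j) (Sum.inl p)) (R := D.R)
    (fun s i r => ?_) (fun k p c s => sum_gamma_mul_XB_Gspin hD hF a b k j p c s) c
  rw [pdB_pdB]
  simp only [TensorProduct.tmul_sum, TensorProduct.tmul_smul]

/-- The map `b ↦ b h⁽¹⁾ ⊗ ε_m ⊗ h⁽²⁾`. -/
def spinInsert (m : Spin) (h : D.Mink) : D.Poin →ₗ[ℂ] D.Poin ⊗[ℂ] D.Bispinor :=
  ((TensorProduct.mk ℂ (Spin → ℂ) D.Mink (Pi.single m 1)).lTensor D.Poin) ∘ₗ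
    (LinearMap.mulRight ℂ (D.PsiHom h)) ∘ₗ D.inB.toLinearMap

theorem spinInsert_apply (m : Spin) (h : D.Mink) (b : D.Poin) : spinInsert m h b =
    (TensorProduct.mk ℂ (Spin → ℂ) D.Mink (Pi.single m 1)).lTensor D.Poin
      (D.inB b * D.PsiHom h) := rfl

theorem rTensor_lTensor_comm {A A' W W' : Type} [AddCommGroup A] [Module ℂ A] [AddCommGroup A']
    [Module ℂ A'] [AddCommGroup W] [Module ℂ W] [AddCommGroup W'] [Module ℂ W'] (α : A →ₗ[ℂ] A')
    (φ : W →ₗ[ℂ] W') (t : A ⊗[ℂ] W) :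
    α.rTensor W' (φ.lTensor A t) = φ.lTensor A' (α.rTensor W t) := by
  rw [← LinearMap.comp_apply, ← LinearMap.comp_apply, LinearMap.rTensor_comp_lTensor,
    LinearMap.lTensor_comp_rTensor]

theorem PsiTilde_single_eq (a : Spin) (h : D.Mink) :
    PsiTilde D.PsiHom (Pi.single a 1 ⊗ₜ h) = ∑ l, spinInsert l h (D.Gspin a l) := by
  rw [PsiTilde_single]
  refine Finset.sum_congr rfl fun l _ => ?_
  rw [spinInsert_apply, inB_mul, rTensor_lTensor_comm]

theorem mulLeft_spinInsert (b c : D.Poin) (m : Spin) (h : D.Mink) :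
    (LinearMap.mulLeft ℂ b).rTensor D.Bispinor (spinInsert m h c) = spinInsert m h (b * c) := by
  rw [spinInsert_apply, spinInsert_apply, rTensor_lTensor_comm, ← inB_mul, ← mul_assoc,
    map_mul D.inB]

theorem pdTilde_spinInsert (j : Fin 4) (l : Spin) (g : D.Mink) (b : D.Poin) :
    (pdTilde (XB hD hF) D.PsiHom j).lTensor D.Poin (spinInsert l g b) =
      ∑ m, ∑ p, ∑ q, XB hD hF (D.Gspin l m) (Sum.inl j) (Sum.inl p) •
        spinInsert m (pdB hD hF q g) (b * D.Lam q p) := by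
  have h : (pdTilde (XB hD hF) D.PsiHom j) ∘ₗ
      TensorProduct.mk ℂ (Spin → ℂ) D.Mink (Pi.single l 1) =
      ∑ m, ∑ p, XB hD hF (D.Gspin l m) (Sum.inl j) (Sum.inl p) •
        (TensorProduct.mk ℂ (Spin → ℂ) D.Mink (Pi.single m 1) ∘ₗ pdB hD hF p) := by
    refine LinearMap.ext fun h => ?_
    rw [LinearMap.comp_apply, TensorProduct.mk_apply, pdTilde_single]
    simp only [LinearMap.sum_apply, LinearMap.smul_apply, LinearMap.comp_apply,
      TensorProduct.mk_apply]
  have h2 : ∀ m p, LinearMap.lTensor D.Poin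
      (TensorProduct.mk ℂ (Spin → ℂ) D.Mink (Pi.single m 1) ∘ₗ pdB hD hF p)
        (D.inB b * D.PsiHom g) = ∑ q, spinInsert m (pdB hD hF q g) (b * D.Lam q p) := fun m p => by
    rw [LinearMap.lTensor_comp, LinearMap.comp_apply, lTensor_inB_mul, lTensor_pdB_PsiHom,
      Finset.mul_sum, map_sum]
    refine Finset.sum_congr rfl fun q _ => ?_
    rw [spinInsert_apply, map_mul D.inB, mul_assoc]
  rw [spinInsert_apply, ← LinearMap.comp_apply, ← LinearMap.lTensor_comp, h]
  rw [← LinearMap.coe_lTensorHom, map_sum, LinearMap.sum_apply]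
  refine Finset.sum_congr rfl fun m _ => ?_
  rw [map_sum, LinearMap.sum_apply]
  refine Finset.sum_congr rfl fun p _ => ?_
  rw [map_smul, LinearMap.smul_apply, LinearMap.coe_lTensorHom, h2, Finset.smul_sum]

section sums

variable {α β γ δ N : Type} [Fintype α] [Fintype β] [Fintype γ] [Fintype δ] [AddCommMonoid N]
  (F : α → β → γ → δ → N)

theorem sum_comm_inner : ∑ a, ∑ b, ∑ c, ∑ d, F a b c d = ∑ b, ∑ d, ∑ a, ∑ c, F a b c d := by
  rw [Finset.sum_comm]
  refine Finset.sum_congr rfl fun b _ => ?_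
  rw [Finset.sum_comm (s := (Finset.univ : Finset δ))]
  exact Finset.sum_congr rfl fun a _ => Finset.sum_comm

theorem sum_comm_pairs : ∑ a, ∑ b, ∑ c, ∑ d, F a b c d = ∑ c, ∑ d, ∑ b, ∑ a, F a b c d := by
  simp only [← Fintype.sum_prod_type']
  exact Fintype.sum_equiv
    { toFun := fun (a, b, c, d) => (c, d, b, a)
      invFun := fun (c, d, b, a) => (a, b, c, d)
      left_inv := fun _ => rfl
      right_inv := fun _ => rfl } _ _ fun _ => rfl

end sums

/-- The derivatives of bispinors are covariant. -/
theorem lTensor_pdTilde_PsiTilde (j : Fin 4) (φ : D.Bispinor) :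
    (pdTilde (XB hD hF) D.PsiHom j).lTensor D.Poin (PsiTilde D.PsiHom φ) =
      ∑ i, (LinearMap.mulLeft ℂ (D.Lam i j)).rTensor D.Bispinor
        (PsiTilde D.PsiHom (pdTilde (XB hD hF) D.PsiHom i φ)) := by
  suffices h : (pdTilde (XB hD hF) D.PsiHom j).lTensor D.Poin ∘ₗ PsiTilde D.PsiHom =
      ∑ i, (LinearMap.mulLeft ℂ (D.Lam i j)).rTensor D.Bispinor ∘ₗ PsiTilde D.PsiHom ∘ₗ
        pdTilde (XB hD hF) D.PsiHom i by
    have := congrArg (fun f => f φ) h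
    simpa only [LinearMap.sum_apply, LinearMap.comp_apply] using this
  refine bispinor_ext fun a g => ?_
  have h : ∀ m q, ∑ l, ∑ p, XB hD hF (D.Gspin l m) (Sum.inl j) (Sum.inl p) •
      spinInsert m (pdB hD hF q g) (D.Gspin a l * D.Lam q p) =
      ∑ i, ∑ l, XB hD hF (D.Gspin a l) (Sum.inl i) (Sum.inl q) •
        spinInsert m (pdB hD hF q g) (D.Lam i j * D.Gspin l m) := fun m q => by
    have := congrArg (spinInsert m (pdB hD hF q g)) (exch_Gspin hD hF a m j q)
    simpa only [map_sum, map_smul] using this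
  have h1 : (pdTilde (XB hD hF) D.PsiHom j).lTensor D.Poin
      (PsiTilde D.PsiHom (Pi.single a 1 ⊗ₜ g)) =
      ∑ m, ∑ q, ∑ l, ∑ p, XB hD hF (D.Gspin l m) (Sum.inl j) (Sum.inl p) •
        spinInsert m (pdB hD hF q g) (D.Gspin a l * D.Lam q p) := by
    rw [PsiTilde_single_eq, map_sum]
    simp only [pdTilde_spinInsert]
    exact sum_comm_inner _
  have h2 : ∀ i, (LinearMap.mulLeft ℂ (D.Lam i j)).rTensor D.Bispinor
      (PsiTilde D.PsiHom (pdTilde (XB hD hF) D.PsiHom i (Pi.single a 1 ⊗ₜ g))) =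
      ∑ l, ∑ q, ∑ m, XB hD hF (D.Gspin a l) (Sum.inl i) (Sum.inl q) •
        spinInsert m (pdB hD hF q g) (D.Lam i j * D.Gspin l m) := fun i => by
    rw [pdTilde_single]
    simp only [map_sum, map_smul, PsiTilde_single_eq, mulLeft_spinInsert, Finset.smul_sum]
  rw [LinearMap.comp_apply, h1, LinearMap.sum_apply]
  simp only [LinearMap.comp_apply, h2, h]
  exact sum_comm_pairs _

/-! ### The standard maps -/

theorem areStandardMaps :
    D.AreStandardMaps D.eps D.anti D.fhom (XB hD hF) D.PsiHom (pdB hD hF) where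
  eps_w A B := by rw [eps_wA]
  eps_wbar A B := by rw [eps_wbarA]
  S_w A B := by
    have h := congrFun (congrFun D.inv_mul_wA A) B
    simp only [anti_wA]
    rwa [mul_apply, one_apply] at h
  w_S A B := by
    have h := congrFun (congrFun D.wA_mul_inv A) B
    simp only [anti_wA]
    rwa [mul_apply, one_apply] at h
  S_wbar A B := by
    have h := congrFun (congrFun D.inv_mul_wbarA A) B
    simp only [anti_wbarA]
    rwa [mul_apply, one_apply] at h
  wbar_S A B := by
    have h := congrFun (congrFun D.wbarA_mul_inv A) B
    simp only [anti_wbarA]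
    rwa [mul_apply, one_apply] at h
  f_w A B i j := by rw [fhom_wA, fw_apply]
  f_wbar A B i j := by rw [fhom_wbarA, fwb_apply]
  X_incl a := by
    rw [XB_incl, XA_apply]
    ext (p | p) (q | q)
    · rw [affine_inl_inl, fS_apply]; rfl
    · rfl
    · rfl
    · rfl
  X_y i := by
    rw [XB_y]
    ext (p | p) (q | q) <;> rfl
  Ψ_x i := by
    rw [PsiHom_x, PsiGen]
    simp only [inB_mul_inC]
    rfl
  pd_one := pdB_one hD hF
  pd_x_mul := pdB_x_mul hD hF

/-- The standard maps are determined by their defining properties. -/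
theorem AreStandardMaps.unique {ε ε' : D.Lor →ₐ[ℂ] ℂ} {S S' : D.Lor →ₐ[ℂ] D.Lorᵐᵒᵖ}
    {f f' : D.Lor →ₐ[ℂ] Matrix (Fin 4) (Fin 4) ℂ}
    {X X' : D.Poin →ₐ[ℂ] Matrix (Fin 4 ⊕ Unit) (Fin 4 ⊕ Unit) ℂ}
    {Ψ Ψ' : D.Mink →⋆ₐ[ℂ] D.Poin ⊗[ℂ] D.Mink} {pd pd' : Fin 4 → D.Mink →ₗ[ℂ] D.Mink}
    (h' : D.AreStandardMaps ε' S' f' X' Ψ' pd') (h : D.AreStandardMaps ε S f X Ψ pd) :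
    ε' = ε ∧ S' = S ∧ f' = f ∧ X' = X ∧ Ψ' = Ψ ∧ pd' = pd := by
  have inv_unique : ∀ {u v v' : Matrix (Fin 2) (Fin 2) D.Lor}, v * u = 1 → u * v' = 1 → v = v' :=
    fun h1 h2 => left_inv_eq_right_inv h1 h2
  have hε : ε' = ε := lor_algHom_ext (fun A B => by rw [h'.eps_w, h.eps_w])
    (fun A B => by rw [h'.eps_wbar, h.eps_wbar])
  have hS1 : (of fun A B => (S' (D.wA A B)).unop : Matrix (Fin 2) (Fin 2) D.Lor) =
      of fun A B => (S (D.wA A B)).unop := by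
    refine inv_unique (u := of D.wA) ?_ ?_
    · ext A B
      rw [mul_apply, one_apply]
      exact h'.S_w A B
    · ext A B
      rw [mul_apply, one_apply]
      exact h.w_S A B
  have hS2 : (of fun A B => (S' (D.wbarA A B)).unop : Matrix (Fin 2) (Fin 2) D.Lor) =
      of fun A B => (S (D.wbarA A B)).unop := by
    refine inv_unique (u := of D.wbarA) ?_ ?_
    · ext A B
      rw [mul_apply, one_apply]
      exact h'.S_wbar A B
    · ext A B
      rw [mul_apply, one_apply]
      exact h.wbar_S A B
  have hS : S' = S := lor_algHom_ext
    (fun A B => MulOpposite.unop_injective (congrFun (congrFun hS1 A) B))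
    (fun A B => MulOpposite.unop_injective (congrFun (congrFun hS2 A) B))
  have hf : f' = f := lor_algHom_ext
    (fun A B => by ext i j; rw [h'.f_w, h.f_w]) (fun A B => by ext i j; rw [h'.f_wbar, h.f_wbar])
  have hXi : ∀ a, X' (D.incl a) = X (D.incl a) := fun a => by
    rw [h'.X_incl, h.X_incl, hε, hS, hf]
  have hX : X' = X := by
    refine StarPres.algHom_ext (P := D.poincareRelators) fun g => ?_
    cases g with
    | w A B =>
      have := hXi (D.wA A B)
      rwa [incl_wA] at this
    | wbar A B =>
      have := hXi (D.wbarA A B)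
      rwa [incl_wbarA] at this
    | y i => exact (h'.X_y i).trans (h.X_y i).symm
  have hΨ : Ψ' = Ψ := by
    have : Ψ'.toAlgHom = Ψ.toAlgHom := by
      refine StarPres.algHom_ext (P := D.minkowskiRelators) fun g => ?_
      cases g with
      | x i => exact (h'.Ψ_x i).trans (h.Ψ_x i).symm
    exact StarAlgHom.ext fun a => DFunLike.congr_fun this a
  exact ⟨hε, hS, hf, hX, hΨ, pd_ext h'.pd_one h.pd_one h'.pd_x_mul h.pd_x_mul⟩

end PoincareData

end QuantumMinkowski

end

open QuantumMinkowski PoincareData in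
theorem proposition3p1 (D : PoincareData) (hD : D.IsQuantumPoincareGroup)
    (hF : ∀ i j n m, D.Ftilde i j n m = 0) :
    ∃ (ε : D.Lor →ₐ[ℂ] ℂ) (S : D.Lor →ₐ[ℂ] D.Lorᵐᵒᵖ)
      (f : D.Lor →ₐ[ℂ] Matrix (Fin 4) (Fin 4) ℂ)
      (X : D.Poin →ₐ[ℂ] Matrix (Fin 4 ⊕ Unit) (Fin 4 ⊕ Unit) ℂ)
      (Ψ : D.Mink →⋆ₐ[ℂ] D.Poin ⊗[ℂ] D.Mink) (pd : Fin 4 → D.Mink →ₗ[ℂ] D.Mink),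
      D.AreStandardMaps ε S f X Ψ pd ∧
      (∀ ε' S' f' X' Ψ' pd', D.AreStandardMaps ε' S' f' X' Ψ' pd' →
        ε' = ε ∧ S' = S ∧ f' = f ∧ X' = X ∧ Ψ' = Ψ ∧ pd' = pd) ∧
      (∀ (a b : ℂ) (j : Fin 4),
        pdTilde X Ψ j ∘ₗ dirac a b pd = dirac a b pd ∘ₗ pdTilde X Ψ j) ∧
      (∀ (j : Fin 4) (φ : D.Bispinor),
        (pdTilde X Ψ j).lTensor D.Poin (PsiTilde Ψ φ) =
          ∑ i, (LinearMap.mulLeft ℂ (D.Lam i j)).rTensor D.Bispinor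
            (PsiTilde Ψ (pdTilde X Ψ i φ))) := by
  refine ⟨D.eps, D.anti, D.fhom, XB hD hF, D.PsiHom, pdB hD hF, areStandardMaps hD hF,
    fun ε' S' f' X' Ψ' pd' h => h.unique (areStandardMaps hD hF),
    pdTilde_comp_dirac hD hF, lTensor_pdTilde_PsiTilde hD hF⟩
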